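/- Let $\mathcal S$ be the space of Schwartz functions $f:\mathbb R\to\mathbb C$, with the norms defined by $\|f\|_0=\|f\|_{L^2(\mathbb R)}$ and $$\|f\|_{n+1}^2=\|Mf\|_n^2+\|Df\|_n^2+\|f\|_n^2\quad(n\ge 0),\qquad (Mf)(x)=ixf(x),\quad (Df)(x)=f'(x).$$ Let $\mathcal N$ be the space of all $f\in\mathcal S$ with $\int_{\mathbb R}x^nf(x)\,dx=0$ for every $n\ge 0$, and let $\mathcal N_-$ be the space of all $f\in\mathcal N$ that are supported in $(-\infty,0)$ (that is, $f(x)=0$ for all $x\ge 0$). Let $(\mathbb Hf)(t)=\frac1\pi\,\mathrm{p.v.}\!\int_{-\infty}^{\infty}\frac{f(x)}{x-t}\,dx$ be the Hilbert transform, which maps $\mathcal N$ into $\mathcal S$, and let $P_\pm=\frac12(I\pm i\mathbb H)$. Let $\Psi=-iP_+(\mathcal N_-)\oplus iP_-(\mathcal N_-)\subset\mathcal S$. Every $f\in\Psi$ can be written as $f=-iP_+g+iP_-h$ with unique $g,h\in\mathcal N_-$. Equip $\Psi$ with the locally convex topology given by the norms $\|f\|_{\Psi,n}$, $n=0,1,2,\dots$,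 where $$\|f\|_{\Psi,n}^2=\|{-iP_+g}\|_n^2+\|iP_-h\|_n^2+\|iP_-g\|_n^2+\|{-iP_+h}\|_n^2 .$$ Then $\Psi$ is a nuclear Fréchet space. Moreover, let $\Psi^\times$ be the space of continuous antilinear functionals on $\Psi$ with the weak* topology. Then $\Psi\subset L^2(\mathbb R)\subset\Psi^\times$ is a rigged Hilbert space, that is: $\Psi$ is a dense subspace of the Hilbert space $L^2(\mathbb R)$; its topology is complete, locally convex, nuclear and finer than the $L^2$ topology; every weak* Cauchy sequence in $\Psi^\times$ converges, and every weak* closed and bounded subset of $\Psi^\times$ is complete; and $L^2(\mathbb R)$, embedded in $\Psi^\times$ by $v\mapsto\bigl(\varphi\mapsto\int_{\mathbb R}\overline{\varphi(x)}\,v(x)\,dx\bigr)$, is a dense subspace of $\Psi^\times$. -/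

import Mathlib

open MeasureTheory Filter Topology SchwartzMap

namespace HardyRigged
noncomputable section

/-- The Hilbert transform of `f` at `t`: the Cauchy principal value
`(1/π) p.v. ∫ f(x) / (x - t) dx`. -/
def hilbertPV (f : ℝ → ℂ) (t : ℝ) : ℂ :=
  limUnder (𝓝[>] (0 : ℝ))
    (fun ε : ℝ => (1 / (Real.pi : ℂ)) * ∫ x in {x : ℝ | ε < |x - t|}, f x / ((x : ℂ) - (t : ℂ)))

/-- The multiplication `f ↦ x f` on Schwartz functions. -/
def mulX : 𝓢(ℝ, ℂ) →L[ℂ] 𝓢(ℝ, ℂ) := SchwartzMap.smulLeftCLM ℂ (fun x : ℝ => (x : ℂ))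

theorem mulX_apply (f : 𝓢(ℝ, ℂ)) (x : ℝ) : mulX f x = (x : ℂ) * f x := by
  have h : (fun x : ℝ => (x : ℂ)).HasTemperateGrowth :=
    Complex.ofRealCLM.hasTemperateGrowth
  simp [mulX, SchwartzMap.smulLeftCLM_apply_apply h]

theorem mulX_pow_apply (k : ℕ) (f : 𝓢(ℝ, ℂ)) (x : ℝ) :
    (mulX^[k] f) x = (x : ℂ) ^ k * f x := by
  induction k generalizing f with
  | zero => simp
  | succ k ih => rw [Function.iterate_succ_apply, ih, mulX_apply]; ring

/-- The Schwartz functions all of whose moments vanish. -/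
def vanishingMoments : Submodule ℂ 𝓢(ℝ, ℂ) where
  carrier := {f | ∀ n : ℕ, ∫ x : ℝ, (x : ℂ) ^ n * f x = 0}
  zero_mem' := by intro n; simp
  add_mem' := by
    intro f g hf hg n
    have h1 : ∀ u : 𝓢(ℝ, ℂ), Integrable (fun x : ℝ => (x : ℂ) ^ n * u x) := by
      intro u
      exact ((mulX^[n] u).integrable (μ := volume)).congr
        (Eventually.of_forall fun x => mulX_pow_apply n u x)
    simp only [add_apply, mul_add]
    rw [integral_add (h1 f) (h1 g), hf n, hg n, add_zero]
  smul_mem' := by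
    intro c f hf n
    have : ∀ x : ℝ, (x : ℂ) ^ n * (c • f) x = c * ((x : ℂ) ^ n * f x) := by
      intro x; simp only [smul_apply, smul_eq_mul]; ring
    simp only [this, integral_const_mul, hf n, mul_zero]

theorem integrable_pow_mul (n : ℕ) (u : 𝓢(ℝ, ℂ)) :
    Integrable (fun x : ℝ => (x : ℂ) ^ n * u x) := by
  exact ((mulX^[n] u).integrable (μ := volume)).congr
    (Eventually.of_forall fun x => mulX_pow_apply n u x)

theorem mulX_mem {f : 𝓢(ℝ, ℂ)} (hf : f ∈ vanishingMoments) : mulX f ∈ vanishingMoments := by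
  intro n
  rw [← hf (n + 1)]
  congr 1; ext x; rw [mulX_apply]; ring

theorem derivCLM_mem {f : 𝓢(ℝ, ℂ)} (hf : f ∈ vanishingMoments) :
    SchwartzMap.derivCLM ℂ ℂ f ∈ vanishingMoments := by
  intro n
  have h := integral_mul_deriv_eq_deriv_mul_of_integrable
    (u := fun x : ℝ => (x : ℂ) ^ n) (v := f)
    (u' := fun x : ℝ => (n : ℂ) * (x : ℂ) ^ (n - 1)) (v' := fun x => deriv f x)
    (fun x _ => by
      simpa [Pi.pow_def] using (Complex.ofRealCLM.hasDerivAt (x := x)).pow n)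
    (fun x _ => f.hasDerivAt x)
    (by simpa only [Pi.mul_def, SchwartzMap.derivCLM_apply] using
          integrable_pow_mul n (SchwartzMap.derivCLM ℂ ℂ f))
    (by simpa only [Pi.mul_def, mul_assoc] using (integrable_pow_mul (n - 1) f).const_mul (n : ℂ))
    (by simpa only [Pi.mul_def] using integrable_pow_mul n f)
  simp only [SchwartzMap.derivCLM_apply]
  rw [h]
  simp only [mul_assoc, integral_const_mul, hf (n - 1), mul_zero, neg_zero]

theorem exists_bound (f : 𝓢(ℝ, ℂ)) : ∃ C : ℝ, 0 ≤ C ∧ ∀ x : ℝ, ‖f x‖ ≤ C * (1 + x ^ 2)⁻¹ := by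
  obtain ⟨A, hA, hA'⟩ := f.decay 0 0
  obtain ⟨B, hB, hB'⟩ := f.decay 2 0
  refine ⟨A + B, by positivity, fun x => ?_⟩
  have h1 := hA' x
  have h2 := hB' x
  simp only [pow_zero, one_mul, norm_iteratedFDeriv_zero, Real.norm_eq_abs, sq_abs] at h1 h2
  rw [← div_eq_mul_inv, le_div_iff₀ (by positivity)]
  nlinarith

/-- The symmetrized kernel of the principal value. -/
def symKernel (f : ℝ → ℂ) (t s : ℝ) : ℂ := (f (t + s) - f (t - s)) / (s : ℂ)

theorem one_add_sq_inv_le (t s : ℝ) :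
    (1 + (t + s) ^ 2)⁻¹ ≤ 2 * (1 + t ^ 2) * (1 + s ^ 2)⁻¹ := by
  rw [← div_eq_mul_inv, inv_eq_one_div, div_le_div_iff₀ (by positivity) (by positivity)]
  nlinarith [sq_nonneg (t * (t + s)), sq_nonneg (2 * t + s), sq_nonneg (s + 2 * t), sq_nonneg t]

theorem symKernel_bound (f : 𝓢(ℝ, ℂ)) : ∃ C : ℝ, 0 ≤ C ∧ ∀ t s : ℝ, 0 < s →
    ‖symKernel f t s‖ ≤ C * (1 + t ^ 2) * (1 + s ^ 2)⁻¹ := by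
  obtain ⟨A, hA, hA'⟩ := exists_bound f
  obtain ⟨B, hB, hB'⟩ := exists_bound (SchwartzMap.derivCLM ℂ ℂ f)
  refine ⟨4 * A + 4 * B, by positivity, fun t s hs => ?_⟩
  rw [symKernel, norm_div, Complex.norm_real, Real.norm_eq_abs, abs_of_pos hs]
  rcases le_total s 1 with h | h
  · have hlip : ‖f (t + s) - f (t - s)‖ ≤ B * ‖(t + s) - (t - s)‖ := by
      refine Convex.norm_image_sub_le_of_norm_hasDerivWithin_le (s := Set.univ)
        (fun x _ => (f.hasDerivAt x).hasDerivWithinAt) (fun x _ => ?_) convex_univ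
        (Set.mem_univ _) (Set.mem_univ _)
      have := hB' x
      rw [SchwartzMap.derivCLM_apply] at this
      refine this.trans (mul_le_of_le_one_right hB (inv_le_one_of_one_le₀ (by nlinarith)))
    have h2 : ‖(t + s) - (t - s)‖ = 2 * s := by
      rw [show (t + s) - (t - s) = 2 * s by ring, Real.norm_eq_abs, abs_of_pos (by positivity)]
    rw [h2] at hlip
    have h3 : ‖f (t + s) - f (t - s)‖ / s ≤ 2 * B := by
      rw [div_le_iff₀ hs]; linarith
    have h4 : (1 : ℝ) ≤ 2 * (1 + s ^ 2)⁻¹ := by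
      rw [← div_eq_mul_inv, le_div_iff₀ (by positivity)]; nlinarith
    have h5 : (1 : ℝ) ≤ 2 * (1 + s ^ 2)⁻¹ * (1 + t ^ 2) := by nlinarith [sq_nonneg t]
    have h6 : 0 ≤ A * (1 + t ^ 2) * (1 + s ^ 2)⁻¹ := by positivity
    nlinarith
  · have h1 := (hA' (t + s)).trans (mul_le_mul_of_nonneg_left (one_add_sq_inv_le t s) hA)
    have h2 := (hA' (t - s)).trans (mul_le_mul_of_nonneg_left (by
      simpa [sub_eq_add_neg] using one_add_sq_inv_le t (-s)) hA)
    have h3 : ‖f (t + s) - f (t - s)‖ / s ≤ ‖f (t + s)‖ + ‖f (t - s)‖ :=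
      (div_le_self (norm_nonneg _) h).trans (norm_sub_le _ _)
    have h6 : 0 ≤ B * (1 + t ^ 2) * (1 + s ^ 2)⁻¹ := by positivity
    nlinarith

theorem symKernel_aesm (f : 𝓢(ℝ, ℂ)) (t : ℝ) (μ : Measure ℝ) :
    AEStronglyMeasurable (symKernel f t) μ := by
  have hf : Measurable f := f.continuous.measurable
  refine Measurable.aestronglyMeasurable ?_
  unfold symKernel
  fun_prop

theorem symKernel_integrable (f : 𝓢(ℝ, ℂ)) (t : ℝ) :
    IntegrableOn (symKernel f t) (Set.Ioi 0) := by
  obtain ⟨C, _, hC⟩ := symKernel_bound f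
  refine Integrable.mono' ((integrable_inv_one_add_sq.const_mul (C * (1 + t ^ 2))).integrableOn)
    (symKernel_aesm f t _) ?_
  filter_upwards [ae_restrict_mem measurableSet_Ioi] with s hs
  exact hC t s hs

/-- The principal value through the symmetrized kernel. -/
def symHilbert (f : ℝ → ℂ) (t : ℝ) : ℂ :=
  (1 / (Real.pi : ℂ)) * ∫ s in Set.Ioi (0 : ℝ), symKernel f t s

theorem truncated_eq (f : 𝓢(ℝ, ℂ)) (t : ℝ) {ε : ℝ} (hε : 0 < ε) :
    ∫ x in {x : ℝ | ε < |x - t|}, f x / ((x : ℂ) - (t : ℂ)) =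
      ∫ s in Set.Ioi ε, symKernel f t s := by
  have hmeas : Measurable f := f.continuous.measurable
  have hset : {x : ℝ | ε < |x - t|} = Set.Iio (t - ε) ∪ Set.Ioi (t + ε) := by
    ext x
    simp only [Set.mem_ofPred_eq, lt_abs, Set.mem_union, Set.mem_Iio, Set.mem_Ioi]
    constructor
    · rintro (h | h)
      · right; linarith
      · left; linarith
    · rintro (h | h)
      · right; linarith
      · left; linarith
  have hm : MeasurableSet {x : ℝ | ε < |x - t|} :=
    hset ▸ measurableSet_Iio.union measurableSet_Ioi
  have hint : IntegrableOn (fun x : ℝ => f x / ((x : ℂ) - (t : ℂ))) {x : ℝ | ε < |x - t|} := by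
    refine Integrable.mono' ((f.integrable (μ := volume)).norm.const_mul ε⁻¹).integrableOn
      (Measurable.aestronglyMeasurable (by fun_prop)) ?_
    filter_upwards [ae_restrict_mem hm] with x hx
    rw [norm_div, ← Complex.ofReal_sub, Complex.norm_real, Real.norm_eq_abs, div_eq_inv_mul]
    have hx' : ε < |x - t| := hx
    gcongr
  rw [hset] at hint ⊢
  rw [setIntegral_union (Set.disjoint_left.2 (fun x hx hx' => by
      simp only [Set.mem_Iio, Set.mem_Ioi] at hx hx'; linarith)) measurableSet_Ioi
      (hint.mono_set Set.subset_union_left) (hint.mono_set Set.subset_union_right)]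
  have e1 : ∫ x in Set.Ioi (t + ε), f x / ((x : ℂ) - (t : ℂ)) =
      ∫ s in Set.Ioi ε, f (t + s) / (s : ℂ) := by
    have := (measurePreserving_add_left volume t).setIntegral_preimage_emb
      (MeasurableEquiv.addLeft t).measurableEmbedding
      (fun x : ℝ => f x / ((x : ℂ) - (t : ℂ))) (Set.Ioi (t + ε))
    rw [← this]
    simp
  have e2 : ∫ x in Set.Iio (t - ε), f x / ((x : ℂ) - (t : ℂ)) =
      ∫ s in Set.Ioi ε, - (f (t - s) / (s : ℂ)) := by
    have := (Measure.measurePreserving_sub_left volume t).setIntegral_preimage_emb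
      (MeasurableEquiv.subLeft t).measurableEmbedding
      (fun x : ℝ => f x / ((x : ℂ) - (t : ℂ))) (Set.Iio (t - ε))
    rw [← this]
    simp [div_neg]
  have i1 : IntegrableOn (fun s : ℝ => f (t + s) / (s : ℂ)) (Set.Ioi ε) := by
    have := ((measurePreserving_add_left volume t).integrableOn_comp_preimage
      (MeasurableEquiv.addLeft t).measurableEmbedding).2 (hint.mono_set Set.subset_union_right)
    simpa [Function.comp_def] using this
  have i2 : IntegrableOn (fun s : ℝ => - (f (t - s) / (s : ℂ))) (Set.Ioi ε) := by
    have := ((Measure.measurePreserving_sub_left volume t).integrableOn_comp_preimage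
      (MeasurableEquiv.subLeft t).measurableEmbedding).2 (hint.mono_set Set.subset_union_left)
    simpa [Function.comp_def, div_neg] using this
  rw [e1, e2, ← integral_add i2 i1]
  congr 1; ext s
  simp only [symKernel]; ring

/-- The principal value of a Schwartz function converges at every point. -/
theorem tendsto_hilbertPV (f : 𝓢(ℝ, ℂ)) (t : ℝ) :
    Tendsto (fun ε : ℝ => (1 / (Real.pi : ℂ)) *
      ∫ x in {x : ℝ | ε < |x - t|}, f x / ((x : ℂ) - (t : ℂ))) (𝓝[>] (0 : ℝ))
      (𝓝 (symHilbert f t)) := by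
  have h := (aecover_Ioi_of_Ioi (μ := volume) (A := (0 : ℝ)) (l := 𝓝[>] (0 : ℝ))
    (a := fun ε : ℝ => ε)
    (tendsto_nhdsWithin_of_tendsto_nhds tendsto_id)).integral_tendsto_of_countably_generated
      (symKernel_integrable f t)
  refine (h.const_mul (1 / (Real.pi : ℂ))).congr' ?_
  filter_upwards [self_mem_nhdsWithin] with ε hε
  have hε' : (0 : ℝ) < ε := hε
  rw [truncated_eq f t hε', Measure.restrict_restrict measurableSet_Ioi,
    Set.inter_eq_left.2 (Set.Ioi_subset_Ioi hε'.le)]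

theorem hilbertPV_eq (f : 𝓢(ℝ, ℂ)) : hilbertPV f = symHilbert f :=
  funext fun t => (tendsto_hilbertPV f t).limUnder_eq

theorem hasDerivAt_symHilbert (f : 𝓢(ℝ, ℂ)) (t : ℝ) :
    HasDerivAt (symHilbert f) (symHilbert (SchwartzMap.derivCLM ℂ ℂ f) t) t := by
  obtain ⟨C, hC, hb⟩ := symKernel_bound (SchwartzMap.derivCLM ℂ ℂ f)
  have h := hasDerivAt_integral_of_dominated_loc_of_deriv_le (𝕜 := ℝ)
    (μ := volume.restrict (Set.Ioi (0 : ℝ))) (F := fun t s => symKernel f t s)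
    (F' := fun t s => symKernel (SchwartzMap.derivCLM ℂ ℂ f) t s) (x₀ := t)
    (s := Metric.ball t 1) (bound := fun s => C * (1 + (|t| + 1) ^ 2) * (1 + s ^ 2)⁻¹)
    (Metric.ball_mem_nhds t one_pos)
    (Eventually.of_forall fun x => symKernel_aesm f x _) (symKernel_integrable f t)
    (symKernel_aesm _ t _)
    (by
      filter_upwards [ae_restrict_mem measurableSet_Ioi] with s hs x hx
      refine (hb x s hs).trans ?_
      have hx' : |x| ≤ |t| + 1 := by
        rw [Metric.mem_ball, Real.dist_eq] at hx
        have := abs_sub_abs_le_abs_sub x t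
        linarith
      have : x ^ 2 ≤ (|t| + 1) ^ 2 := by
        rw [← sq_abs x]; gcongr
      gcongr)
    ((integrable_inv_one_add_sq.const_mul _).integrableOn)
    (by
      filter_upwards with s x _
      have h1 := (f.hasDerivAt (x + s)).comp_add_const x s
      have h2 := (f.hasDerivAt (x - s)).comp_sub_const x s
      simp only [symKernel, SchwartzMap.derivCLM_apply]
      exact (h1.sub h2).div_const (s : ℂ))
  exact h.2.const_mul _

theorem contDiff_symHilbert (n : ℕ) (f : 𝓢(ℝ, ℂ)) : ContDiff ℝ n (symHilbert f) := by
  induction n generalizing f with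
  | zero =>
    exact contDiff_zero.2 (continuous_iff_continuousAt.2 fun t =>
      (hasDerivAt_symHilbert f t).continuousAt)
  | succ n ih =>
    rw [Nat.cast_succ, contDiff_succ_iff_deriv]
    refine ⟨fun t => (hasDerivAt_symHilbert f t).differentiableAt, by simp, ?_⟩
    rw [funext fun t => (hasDerivAt_symHilbert f t).deriv]
    exact ih _

theorem iteratedDeriv_symHilbert (n : ℕ) (f : 𝓢(ℝ, ℂ)) :
    iteratedDeriv n (symHilbert f) = symHilbert ((SchwartzMap.derivCLM ℂ ℂ)^[n] f) := by
  induction n generalizing f with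
  | zero => simp
  | succ n ih =>
    rw [iteratedDeriv_succ', funext fun t => (hasDerivAt_symHilbert f t).deriv, ih,
      Function.iterate_succ_apply]

theorem symHilbert_mulX {f : 𝓢(ℝ, ℂ)} (hf : f ∈ vanishingMoments) (t : ℝ) :
    symHilbert (mulX f) t = (t : ℂ) * symHilbert f t := by
  have i1 : Integrable (fun s : ℝ => f (t + s)) := (f.integrable (μ := volume)).comp_add_left t
  have i2 : Integrable (fun s : ℝ => f (t - s)) := (f.integrable (μ := volume)).comp_sub_left t
  have h0 : ∫ s in Set.Ioi (0 : ℝ), (f (t + s) + f (t - s)) = 0 := by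
    have e1 : ∫ s in Set.Ioi (0 : ℝ), f (t - s) = ∫ s in Set.Iic (0 : ℝ), f (t + s) := by
      have := integral_comp_neg_Ioi 0 (fun s : ℝ => f (t + s))
      simpa [sub_eq_add_neg] using this
    rw [integral_add i1.integrableOn i2.integrableOn, e1, add_comm]
    have e2 := intervalIntegral.integral_Iic_add_Ioi (b := (0 : ℝ)) i1.integrableOn i1.integrableOn
    rw [e2, integral_add_left_eq_self (fun s : ℝ => f s) t]
    simpa using hf 0
  have h1 : ∫ s in Set.Ioi (0 : ℝ), symKernel (mulX f) t s =
      ∫ s in Set.Ioi (0 : ℝ), ((t : ℂ) * symKernel f t s + (f (t + s) + f (t - s))) := by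
    refine setIntegral_congr_fun measurableSet_Ioi fun s hs => ?_
    have hs' : (s : ℂ) ≠ 0 := by exact_mod_cast (ne_of_gt hs)
    simp only [symKernel, mulX_apply, Complex.ofReal_add, Complex.ofReal_sub]
    field_simp
    ring
  have h2 : ∫ s in Set.Ioi (0 : ℝ), ((t : ℂ) * symKernel f t s + (f (t + s) + f (t - s))) =
      (∫ s in Set.Ioi (0 : ℝ), (t : ℂ) * symKernel f t s) +
        ∫ s in Set.Ioi (0 : ℝ), (f (t + s) + f (t - s)) :=
    integral_add ((symKernel_integrable f t).const_mul _) (i1.integrableOn.add i2.integrableOn)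
  rw [symHilbert, h1, h2, h0, integral_const_mul, symHilbert]
  ring

theorem symHilbert_mulX_pow (k : ℕ) {f : 𝓢(ℝ, ℂ)} (hf : f ∈ vanishingMoments) (t : ℝ) :
    symHilbert (mulX^[k] f) t = (t : ℂ) ^ k * symHilbert f t := by
  induction k generalizing f with
  | zero => simp
  | succ k ih => rw [Function.iterate_succ_apply, ih (mulX_mem hf), symHilbert_mulX hf]; ring

theorem symHilbert_poly_bound (f : 𝓢(ℝ, ℂ)) :
    ∃ C : ℝ, 0 ≤ C ∧ ∀ t : ℝ, ‖symHilbert f t‖ ≤ C * (1 + t ^ 2) := by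
  obtain ⟨C, hC, hb⟩ := symKernel_bound f
  refine ⟨‖(1 / (Real.pi : ℂ))‖ * (C * ∫ s in Set.Ioi (0 : ℝ), (1 + s ^ 2)⁻¹),
    mul_nonneg (norm_nonneg _) (mul_nonneg hC (integral_nonneg fun s => by positivity)),
    fun t => ?_⟩
  have h : ‖∫ s in Set.Ioi (0 : ℝ), symKernel f t s‖ ≤
      ∫ s in Set.Ioi (0 : ℝ), C * (1 + t ^ 2) * (1 + s ^ 2)⁻¹ := by
    refine norm_integral_le_of_norm_le (integrable_inv_one_add_sq.const_mul _).integrableOn ?_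
    filter_upwards [ae_restrict_mem measurableSet_Ioi] with s hs
    exact hb t s hs
  rw [integral_const_mul] at h
  rw [symHilbert, norm_mul]
  calc _ ≤ ‖(1 / (Real.pi : ℂ))‖ * (C * (1 + t ^ 2) * ∫ s in Set.Ioi (0 : ℝ), (1 + s ^ 2)⁻¹) := by
        gcongr
    _ = _ := by ring

theorem symHilbert_decay (k : ℕ) {f : 𝓢(ℝ, ℂ)} (hf : f ∈ vanishingMoments) :
    ∃ C : ℝ, ∀ t : ℝ, ‖t‖ ^ k * ‖symHilbert f t‖ ≤ C := by
  obtain ⟨A, hA, hA'⟩ := symHilbert_poly_bound (mulX^[k] f)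
  obtain ⟨B, hB, hB'⟩ := symHilbert_poly_bound (mulX^[k + 2] f)
  refine ⟨A + B, fun t => ?_⟩
  have h1 := hA' t
  have h2 := hB' t
  rw [symHilbert_mulX_pow _ hf, norm_mul, norm_pow, Complex.norm_real, Real.norm_eq_abs] at h1 h2
  rw [pow_add, sq_abs] at h2
  rw [Real.norm_eq_abs]
  have h3 : (|t| ^ k * ‖symHilbert f t‖) * (1 + t ^ 2) ≤ (A + B) * (1 + t ^ 2) := by nlinarith
  exact le_of_mul_le_mul_right h3 (by positivity)

theorem symHilbert_add (f g : 𝓢(ℝ, ℂ)) (t : ℝ) :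
    symHilbert (f + g : 𝓢(ℝ, ℂ)) t = symHilbert f t + symHilbert g t := by
  rw [symHilbert, symHilbert, symHilbert, ← mul_add,
    ← integral_add (symKernel_integrable f t) (symKernel_integrable g t)]
  refine congrArg _ (integral_congr_ae (Eventually.of_forall fun s => ?_))
  simp only [symKernel, add_apply]; ring

theorem symHilbert_smul (c : ℂ) (f : 𝓢(ℝ, ℂ)) (t : ℝ) :
    symHilbert (c • f : 𝓢(ℝ, ℂ)) t = c * symHilbert f t := by
  rw [symHilbert, symHilbert, mul_left_comm, ← integral_const_mul c]
  refine congrArg (fun z : ℂ => (1 / (Real.pi : ℂ)) * z) (integral_congr_ae (Eventually.of_forall fun s => ?_))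
  simp only [symKernel, smul_apply, smul_eq_mul]; ring

/-- The Hilbert transform as an operator from the Schwartz functions with vanishing moments
to the Schwartz functions. -/
def hilbertTransform : vanishingMoments →ₗ[ℂ] 𝓢(ℝ, ℂ) where
  toFun f :=
    { toFun := hilbertPV (f : 𝓢(ℝ, ℂ))
      smooth' := by
        rw [hilbertPV_eq]
        exact contDiff_infty.2 fun n => contDiff_symHilbert n _
      decay' := by
        intro k n
        rw [hilbertPV_eq]
        simp only [norm_iteratedFDeriv_eq_norm_iteratedDeriv, iteratedDeriv_symHilbert]
        refine symHilbert_decay k ?_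
        induction n with
        | zero => exact f.2
        | succ n ih => rw [Function.iterate_succ_apply']; exact derivCLM_mem ih }
  map_add' f g := by
    ext t
    change hilbertPV ((f : 𝓢(ℝ, ℂ)) + (g : 𝓢(ℝ, ℂ)) : 𝓢(ℝ, ℂ)) t =
      hilbertPV (f : 𝓢(ℝ, ℂ)) t + hilbertPV (g : 𝓢(ℝ, ℂ)) t
    rw [hilbertPV_eq, hilbertPV_eq, hilbertPV_eq, symHilbert_add]
  map_smul' c f := by
    ext t
    change hilbertPV (c • (f : 𝓢(ℝ, ℂ)) : 𝓢(ℝ, ℂ)) t = c • hilbertPV (f : 𝓢(ℝ, ℂ)) t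
    rw [hilbertPV_eq, hilbertPV_eq, symHilbert_smul, smul_eq_mul]

/-- `P₊ = (I + i ℍ) / 2`, restricted to the Schwartz functions with vanishing moments. -/
def projPlus : vanishingMoments →ₗ[ℂ] 𝓢(ℝ, ℂ) :=
  (1 / 2 : ℂ) • (vanishingMoments.subtype + Complex.I • hilbertTransform)

/-- `P₋ = (I - i ℍ) / 2`, restricted to the Schwartz functions with vanishing moments. -/
def projMinus : vanishingMoments →ₗ[ℂ] 𝓢(ℝ, ℂ) :=
  (1 / 2 : ℂ) • (vanishingMoments.subtype - Complex.I • hilbertTransform)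

/-- `𝒩₋`: the Schwartz functions with vanishing moments that are supported in `(-∞, 0)`. -/
def nMinus : Submodule ℂ vanishingMoments where
  carrier := {f | ∀ x : ℝ, f.1 x ≠ 0 → x < 0}
  zero_mem' := by intro x hx; exact absurd rfl hx
  add_mem' := by
    intro f g hf hg x hx
    by_contra h
    have h1 : f.1 x = 0 := by by_contra h1; exact h (hf x h1)
    have h2 : g.1 x = 0 := by by_contra h2; exact h (hg x h2)
    exact hx (by simp [h1, h2])
  smul_mem' := by
    intro c f hf x hx
    refine hf x fun h => hx (by simp [h])

/-- The vector space `-iP₊(𝒩₋) + iP₋(𝒩₋)`. -/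
def psiSubspace : Submodule ℂ 𝓢(ℝ, ℂ) :=
  nMinus.map ((-Complex.I) • projPlus) ⊔ nMinus.map (Complex.I • projMinus)

/-- The linear map `(g, h) ↦ -iP₊g + iP₋h` on `𝒩₋ × 𝒩₋`, with values in Schwartz functions. -/
def sumMap : (nMinus × nMinus) →ₗ[ℂ] 𝓢(ℝ, ℂ) :=
  (((-Complex.I) • projPlus).comp nMinus.subtype).coprod
    ((Complex.I • projMinus).comp nMinus.subtype)

theorem range_sumMap : LinearMap.range sumMap = psiSubspace := by
  rw [sumMap, LinearMap.range_coprod, LinearMap.range_comp, LinearMap.range_comp,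
    Submodule.range_subtype, psiSubspace]

/-! ### The norms -/

/-- The seminorm `√(p² + q²)`. -/
def l2add {E : Type*} [AddCommGroup E] [Module ℂ E] (p q : Seminorm ℂ E) : Seminorm ℂ E :=
  Seminorm.of (fun x => √(p x ^ 2 + q x ^ 2))
    (by
      intro x y
      have h1 := map_add_le_add p x y
      have h2 := map_add_le_add q x y
      have a1 := apply_nonneg p x
      have a2 := apply_nonneg p y
      have a3 := apply_nonneg q x
      have a4 := apply_nonneg q y
      have a5 := apply_nonneg p (x + y)
      have a6 := apply_nonneg q (x + y)
      have s1 := Real.sq_sqrt (show 0 ≤ p x ^ 2 + q x ^ 2 by positivity)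
      have s2 := Real.sq_sqrt (show 0 ≤ p y ^ 2 + q y ^ 2 by positivity)
      have n1 := Real.sqrt_nonneg (p x ^ 2 + q x ^ 2)
      have n2 := Real.sqrt_nonneg (p y ^ 2 + q y ^ 2)
      have c : p x * p y + q x * q y ≤ √(p x ^ 2 + q x ^ 2) * √(p y ^ 2 + q y ^ 2) := by
        refine abs_le_of_sq_le_sq' ?_ (by positivity) |>.2
        rw [mul_pow, s1, s2]
        nlinarith [sq_nonneg (p x * q y - q x * p y)]
      refine Real.sqrt_le_iff.2 ⟨by positivity, ?_⟩
      nlinarith [pow_le_pow_left₀ a5 h1 2, pow_le_pow_left₀ a6 h2 2])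
    (by
      intro c x
      rw [map_smul_eq_mul, map_smul_eq_mul, mul_pow, mul_pow, ← mul_add,
        Real.sqrt_mul (by positivity), Real.sqrt_sq (norm_nonneg c)])

theorem l2add_sq {E : Type*} [AddCommGroup E] [Module ℂ E] (p q : Seminorm ℂ E) (x : E) :
    l2add p q x ^ 2 = p x ^ 2 + q x ^ 2 :=
  Real.sq_sqrt (by positivity)

/-- The Hilbert space `L²(ℝ)`. -/
abbrev L2 : Type := Lp ℂ 2 (volume : Measure ℝ)

/-- `(M f)(x) = i x f(x)`. -/
def opM : 𝓢(ℝ, ℂ) →ₗ[ℂ] 𝓢(ℝ, ℂ) := Complex.I • (mulX : 𝓢(ℝ, ℂ) →ₗ[ℂ] 𝓢(ℝ, ℂ))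

/-- `(D f)(x) = f'(x)`. -/
def opD : 𝓢(ℝ, ℂ) →ₗ[ℂ] 𝓢(ℝ, ℂ) := (SchwartzMap.derivCLM ℂ ℂ : 𝓢(ℝ, ℂ) →ₗ[ℂ] 𝓢(ℝ, ℂ))

/-- The inclusion of the Schwartz functions in `L²(ℝ)`. -/
def schwartzToL2 : 𝓢(ℝ, ℂ) →ₗ[ℂ] L2 :=
  (SchwartzMap.toLpCLM ℂ ℂ 2 volume : 𝓢(ℝ, ℂ) →L[ℂ] L2)

/-- The norms on Schwartz functions: `‖f‖₀` is the `L²` norm, and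
`‖f‖²ₙ₊₁ = ‖M f‖²ₙ + ‖D f‖²ₙ + ‖f‖²ₙ`. -/
def schwartzNorm : ℕ → Seminorm ℂ 𝓢(ℝ, ℂ)
  | 0 => (normSeminorm ℂ L2).comp schwartzToL2
  | n + 1 => l2add (l2add ((schwartzNorm n).comp opM) ((schwartzNorm n).comp opD)) (schwartzNorm n)

theorem schwartzNorm_zero (f : 𝓢(ℝ, ℂ)) : schwartzNorm 0 f = ‖schwartzToL2 f‖ := rfl

theorem schwartzNorm_succ_sq (n : ℕ) (f : 𝓢(ℝ, ℂ)) :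
    schwartzNorm (n + 1) f ^ 2 =
      schwartzNorm n (opM f) ^ 2 + schwartzNorm n (opD f) ^ 2 + schwartzNorm n f ^ 2 := by
  rw [schwartzNorm, l2add_sq, l2add_sq]; rfl

/-- The image of a seminorm under a surjective linear map: the infimum over each fibre. When the
map is also injective, it is the seminorm carried over along the bijection. -/
def pushSeminorm {V W : Type*} [AddCommGroup V] [Module ℂ V] [AddCommGroup W] [Module ℂ W]
    (T : V →ₗ[ℂ] W) (hT : Function.Surjective T) (q : Seminorm ℂ V) : Seminorm ℂ W :=
  have bdd : ∀ w : W, BddBelow (Set.range fun v : {v : V // T v = w} => q v.1) := fun w =>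
    ⟨0, by rintro _ ⟨v, rfl⟩; exact apply_nonneg q v.1⟩
  have ne : ∀ w : W, Nonempty {v : V // T v = w} := fun w => (hT w).elim fun v hv => ⟨⟨v, hv⟩⟩
  Seminorm.ofSMulLE (fun w => ⨅ v : {v : V // T v = w}, q v.1)
    (le_antisymm ((ciInf_le (bdd 0) ⟨0, map_zero T⟩).trans (by simp))
      (Real.iInf_nonneg fun v => apply_nonneg q v.1))
    (by
      intro w₁ w₂
      have := ne w₁
      have := ne w₂
      refine le_ciInf_add_ciInf fun v₁ v₂ => ?_
      refine (ciInf_le (bdd (w₁ + w₂)) ⟨v₁.1 + v₂.1, by rw [map_add, v₁.2, v₂.2]⟩).trans ?_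
      exact map_add_le_add q _ _)
    (by
      intro c w
      have := ne w
      rw [Real.mul_iInf_of_nonneg (norm_nonneg c)]
      refine le_ciInf fun v => ?_
      refine (ciInf_le (bdd (c • w)) ⟨c • v.1, by rw [map_smul, v.2]⟩).trans ?_
      exact (map_smul_eq_mul q c v.1).le)

/-! ### The space `Ψ` -/

/-- The space `Ψ = -iP₊(𝒩₋) ⊕ iP₋(𝒩₋)`; it carries the topology of the norms `psiNorm n`. -/
def Psi : Type := psiSubspace

instance : AddCommGroup Psi := inferInstanceAs (AddCommGroup psiSubspace)

instance : Module ℂ Psi := inferInstanceAs (Module ℂ psiSubspace)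

/-- The elements of `Ψ` as Schwartz functions. -/
def Psi.toSchwartz : Psi →ₗ[ℂ] 𝓢(ℝ, ℂ) := psiSubspace.subtype

/-- The inclusion of `Ψ` in `L²(ℝ)`. -/
def Psi.toL2 : Psi →ₗ[ℂ] L2 := schwartzToL2.comp Psi.toSchwartz

/-- The element `-iP₊g + iP₋h` of `Ψ`, for `g, h ∈ 𝒩₋`. -/
def Psi.ofPair : (nMinus × nMinus) →ₗ[ℂ] Psi :=
  LinearMap.codRestrict psiSubspace sumMap fun gh =>
    range_sumMap ▸ LinearMap.mem_range_self sumMap gh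

theorem Psi.toSchwartz_ofPair (g h : nMinus) :
    Psi.toSchwartz (Psi.ofPair (g, h)) =
      (-Complex.I) • projPlus g.1 + Complex.I • projMinus h.1 := rfl

theorem Psi.ofPair_surjective : Function.Surjective Psi.ofPair := by
  intro f
  have hf : (f : psiSubspace).1 ∈ LinearMap.range sumMap := by
    rw [range_sumMap]; exact (f : psiSubspace).2
  obtain ⟨gh, hgh⟩ := hf
  exact ⟨gh, Subtype.ext hgh⟩

/-- The square root of `‖-iP₊g‖²ₙ + ‖iP₋h‖²ₙ + ‖iP₋g‖²ₙ + ‖-iP₊h‖²ₙ` as a seminorm in `(g, h)`. -/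
def pairNorm (n : ℕ) : Seminorm ℂ (nMinus × nMinus) :=
  let a : nMinus →ₗ[ℂ] 𝓢(ℝ, ℂ) := ((-Complex.I) • projPlus).comp nMinus.subtype
  let b : nMinus →ₗ[ℂ] 𝓢(ℝ, ℂ) := (Complex.I • projMinus).comp nMinus.subtype
  let fst : (nMinus × nMinus) →ₗ[ℂ] nMinus := LinearMap.fst ℂ nMinus nMinus
  let snd : (nMinus × nMinus) →ₗ[ℂ] nMinus := LinearMap.snd ℂ nMinus nMinus
  l2add (l2add (l2add ((schwartzNorm n).comp (a.comp fst)) ((schwartzNorm n).comp (b.comp snd)))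
    ((schwartzNorm n).comp (b.comp fst))) ((schwartzNorm n).comp (a.comp snd))

theorem pairNorm_sq (n : ℕ) (g h : nMinus) :
    pairNorm n (g, h) ^ 2 =
      schwartzNorm n ((-Complex.I) • projPlus g.1) ^ 2
        + schwartzNorm n (Complex.I • projMinus h.1) ^ 2
        + schwartzNorm n (Complex.I • projMinus g.1) ^ 2
        + schwartzNorm n ((-Complex.I) • projPlus h.1) ^ 2 := by
  rw [pairNorm, l2add_sq, l2add_sq, l2add_sq]; rfl

/-- The norms of `Ψ`: for `f = -iP₊g + iP₋h` with `g, h ∈ 𝒩₋` (a unique decomposition),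
`‖f‖²ₙ = ‖-iP₊g‖²ₙ + ‖iP₋h‖²ₙ + ‖iP₋g‖²ₙ + ‖-iP₊h‖²ₙ`. -/
def psiNorm : SeminormFamily ℂ Psi ℕ := fun n =>
  pushSeminorm Psi.ofPair Psi.ofPair_surjective (pairNorm n)

instance : TopologicalSpace Psi := psiNorm.moduleFilterBasis.topology

theorem psi_withSeminorms : WithSeminorms psiNorm := ⟨rfl⟩

instance : IsTopologicalAddGroup Psi := psi_withSeminorms.topologicalAddGroup

instance : UniformSpace Psi := IsTopologicalAddGroup.rightUniformSpace Psi

/-! ### Fréchet spaces, nuclear spaces, rigged Hilbert spaces -/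

/-- A Fréchet space: a complete, metrizable, locally convex topological vector space. -/
structure IsFrechetSpace (E : Type*) [AddCommGroup E] [Module ℂ E] [UniformSpace E] : Prop where
  uniformAddGroup : IsUniformAddGroup E
  continuousSMul : ContinuousSMul ℂ E
  locallyConvex : LocallyConvexSpace ℝ E
  metrizable : TopologicalSpace.MetrizableSpace E
  complete : CompleteSpace E

/-- A bounded operator between Banach spaces is nuclear if it is a sum
`x ↦ ∑ₖ fₖ(x) yₖ` with `∑ₖ ‖fₖ‖ ‖yₖ‖ < ∞`. -/
def IsNuclearMap {E F : Type*} [NormedAddCommGroup E] [NormedSpace ℂ E] [NormedAddCommGroup F]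
    [NormedSpace ℂ F] (T : E →L[ℂ] F) : Prop :=
  ∃ (f : ℕ → E →L[ℂ] ℂ) (y : ℕ → F), Summable (fun k => ‖f k‖ * ‖y k‖) ∧
    ∀ x : E, HasSum (fun k => f k x • y k) (T x)

/-- The vector space `E` with the seminorm `p` as its only seminorm. -/
def WithOneSeminorm {E : Type*} [AddCommGroup E] [Module ℂ E] (_p : Seminorm ℂ E) : Type _ := E

section
variable {E : Type*} [AddCommGroup E] [Module ℂ E] (p : Seminorm ℂ E)

instance : AddCommGroup (WithOneSeminorm p) := inferInstanceAs (AddCommGroup E)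

instance : SeminormedAddCommGroup (WithOneSeminorm p) :=
  AddGroupSeminorm.toSeminormedAddCommGroup (E := WithOneSeminorm p) p.toAddGroupSeminorm

instance : Module ℂ (WithOneSeminorm p) := inferInstanceAs (Module ℂ E)

instance : NormedSpace ℂ (WithOneSeminorm p) where
  norm_smul_le c x := (map_smul_eq_mul p c (x : E)).le

/-- The local Banach space `E_p`: the Hausdorff completion of `(E, p)`, that is, the completion
of the normed space `E / ker p`. -/
abbrev LocalBanach : Type _ := UniformSpace.Completion (WithOneSeminorm p)

/-- The canonical map from `E` to the local Banach space `E_p`. -/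
def toLocalBanach (x : E) : LocalBanach p :=
  ((show WithOneSeminorm p from x : WithOneSeminorm p) : UniformSpace.Completion (WithOneSeminorm p))

end

/-- A locally convex space is nuclear if for every continuous seminorm `p` there is a continuous
seminorm `q ≥ p` such that the canonical map `E_q → E_p` of the local Banach spaces is nuclear. -/
def IsNuclearSpace (E : Type*) [AddCommGroup E] [Module ℂ E] [TopologicalSpace E] : Prop :=
  ∀ p : Seminorm ℂ E, Continuous p → ∃ q : Seminorm ℂ E, Continuous q ∧ p ≤ q ∧
    ∃ T : LocalBanach q →L[ℂ] LocalBanach p,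
      (∀ x : E, T (toLocalBanach q x) = toLocalBanach p x) ∧ IsNuclearMap T

/-- `Φ^×`: the continuous antilinear functionals on `Φ`, with the weak* topology (pointwise
convergence on `Φ`). -/
abbrev AntiDual (Φ : Type*) [AddCommGroup Φ] [Module ℂ Φ] [TopologicalSpace Φ] : Type _ :=
  Φ →SLₚₜ[starRingEnd ℂ] ℂ

/-- `Φ ⊂ H ⊂ Φ^×` is a rigged Hilbert space, where `j` is the inclusion of `Φ` in `H`. A vector
`v ∈ H` acts on `Φ` as the antilinear functional `φ ↦ ⟪j φ, v⟫`. The weak* completeness of the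
antidual is completeness for bounded sets and for sequences. -/
structure IsRiggedHilbertSpace {Φ H : Type*} [AddCommGroup Φ] [Module ℂ Φ] [UniformSpace Φ]
    [NormedAddCommGroup H] [InnerProductSpace ℂ H] (j : Φ →ₗ[ℂ] H) : Prop where
  hilbert : CompleteSpace H
  injective : Function.Injective j
  dense : DenseRange j
  uniformAddGroup : IsUniformAddGroup Φ
  continuousSMul : ContinuousSMul ℂ Φ
  locallyConvex : LocallyConvexSpace ℝ Φ
  complete : CompleteSpace Φ
  nuclear : IsNuclearSpace Φ
  continuous : Continuous j
  antidual_seqComplete : ∀ u : ℕ → AntiDual Φ, CauchySeq u → ∃ F : AntiDual Φ, Tendsto u atTop (𝓝 F)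
  antidual_quasiComplete : ∀ s : Set (AntiDual Φ), IsClosed s → Bornology.IsVonNBounded ℂ s →
    IsComplete s
  antidual_contains : ∃ ι : H →ₗ[ℂ] AntiDual Φ,
    (∀ (v : H) (φ : Φ), ι v φ = inner ℂ (j φ) v) ∧ Function.Injective ι ∧ DenseRange ι

end
end HardyRigged

namespace HardyRigged
noncomputable section

/-! ### Sobolev inequality and completeness for the norms of Schwartz functions -/

/-! Write `f = -iP₊g + iP₋h`; then `2f = i(h - g) + ℍ(g + h)`. On the positive half line `g` and `h`
vanish, and there `ℍu` is, up to the factor `-1/π`, the Stieltjes transform of `y ↦ u(-y)`. That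
transform is injective (`ae_eq_zero_of_stieltjes_eq_zero`), so `f = 0` forces `g + h = 0` and then
`h - g = 0`. Hence `Ψ` with its norms is a copy of `𝒩₋ × 𝒩₋` with `pairNorm`.

Completeness: by a Sobolev inequality the norms `‖·‖ₙ` dominate all Schwartz seminorms. The norms of
`Ψ` control both `-iP₊` and `iP₋` of both `g` and `h`, and `g = i(-iP₊g) - i(iP₋g)`, so Cauchy
sequences have Schwartz limits. The moment and support conditions are closed, and pointwise
continuity of `ℍ` identifies the limits of the two parts.

Nuclearity: `‖f‖₀²` is at most a sum of squares of windowed Fourier coefficients, which are bounded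
by a summable sequence times `‖f‖₅`. This property (`SquareSumDominated`) survives pullback along
linear maps and square sums, so it climbs from `‖·‖₀` to `‖·‖ₙ` and passes to `Ψ`; a factorization
through `ℓ²` turns it into nuclearity of the canonical maps.

Antidual: a Fréchet space is barrelled, so Banach–Steinhaus gives the two completeness statements. A
weak* neighbourhood tests finitely many vectors, on whose span any functional is represented by a
vector of `L²`; hence `L²` is weak* dense.

Density of `Ψ` in `L²`: let `θ` be the conjugate of a function orthogonal to `Ψ`. The pairs `(-u,
u)` and `(u, u)` give `∫ θ u = 0` and `∫ θ ℍu = 0` for all `u ∈ 𝒩₋`. The key is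
`ae_eq_zero_of_integral_nMinus_eq_zero`, which rests on the indeterminacy of the log-normal moment
problem. For `V_c(x) = exp(-log²|x|/2 + c log|x|)` on `x < 0`, replacing `c` by `c + 2πi` multiplies
all moments by one common factor, so a combination of the two functions lies in `𝒩₋`. Thus the
entire function `A(c) = ∫ θ V_c` satisfies a functional equation, and `A(c) exp(-c²/2 - c/2)` is
antiperiodic with antiperiod `2πi`. The growth hypothesis makes it bounded, so by Liouville it
vanishes, and Fourier uniqueness gives `θ = 0` on `x < 0`. Some growth condition is needed, since
the powers `xⁿ` annihilate `𝒩₋` too. On `x > 0`, Fubini turns `∫ θ ℍu = 0` into the statement that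
the Stieltjes transform of `θ` annihilates `𝒩₋`; it vanishes by the same criterion, and injectivity
gives `θ = 0`. -/

theorem opM_apply (f : 𝓢(ℝ, ℂ)) (x : ℝ) : opM f x = Complex.I * ((x : ℂ) * f x) := by
  simp [opM, mulX_apply]

theorem opD_apply (f : 𝓢(ℝ, ℂ)) (x : ℝ) : opD f x = deriv f x := by
  simp [opD, SchwartzMap.derivCLM_apply]

theorem integrable_norm_sq (f : 𝓢(ℝ, ℂ)) : Integrable (fun x : ℝ => ‖f x‖ ^ 2) :=
  (f.memLp 2 volume).integrable_norm_pow (by norm_num)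

theorem schwartzNorm_zero_sq (f : 𝓢(ℝ, ℂ)) : schwartzNorm 0 f ^ 2 = ∫ x : ℝ, ‖f x‖ ^ 2 := by
  have h := SchwartzMap.inner_toL2_toL2_eq f f volume
  rw [inner_self_eq_norm_sq_to_K] at h
  have h2 : ∫ x : ℝ, inner ℂ (f x) (f x) = ((∫ x : ℝ, ‖f x‖ ^ 2 : ℝ) : ℂ) := by
    rw [← integral_complex_ofReal]
    refine integral_congr_ae (Eventually.of_forall fun x => ?_)
    simp [inner_self_eq_norm_sq_to_K]
  rw [h2] at h
  have h3 : ((‖f.toLp 2 volume‖ ^ 2 : ℝ) : ℂ) = ((∫ x : ℝ, ‖f x‖ ^ 2 : ℝ) : ℂ) := by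
    rw [← h]; simp
  exact_mod_cast h3

theorem schwartzNorm_opM_le (n : ℕ) (f : 𝓢(ℝ, ℂ)) :
    schwartzNorm n (opM f) ≤ schwartzNorm (n + 1) f := by
  refine le_of_sq_le_sq ?_ (apply_nonneg _ _)
  rw [schwartzNorm_succ_sq]
  nlinarith [sq_nonneg (schwartzNorm n (opD f)), sq_nonneg (schwartzNorm n f)]

theorem schwartzNorm_opD_le (n : ℕ) (f : 𝓢(ℝ, ℂ)) :
    schwartzNorm n (opD f) ≤ schwartzNorm (n + 1) f := by
  refine le_of_sq_le_sq ?_ (apply_nonneg _ _)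
  rw [schwartzNorm_succ_sq]
  nlinarith [sq_nonneg (schwartzNorm n (opM f)), sq_nonneg (schwartzNorm n f)]

theorem schwartzNorm_le_succ (n : ℕ) (f : 𝓢(ℝ, ℂ)) :
    schwartzNorm n f ≤ schwartzNorm (n + 1) f := by
  refine le_of_sq_le_sq ?_ (apply_nonneg _ _)
  rw [schwartzNorm_succ_sq]
  nlinarith [sq_nonneg (schwartzNorm n (opM f)), sq_nonneg (schwartzNorm n (opD f))]

theorem schwartzNorm_mono : Monotone schwartzNorm :=
  monotone_nat_of_le_succ fun n f => schwartzNorm_le_succ n f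

theorem schwartzNorm_iterate_opM_le (m k : ℕ) (f : 𝓢(ℝ, ℂ)) :
    schwartzNorm m (opM^[k] f) ≤ schwartzNorm (m + k) f := by
  induction k generalizing f with
  | zero => simp
  | succ k ih =>
    rw [Function.iterate_succ_apply]
    exact (ih _).trans (schwartzNorm_opM_le _ _)

theorem schwartzNorm_iterate_opD_le (m k : ℕ) (f : 𝓢(ℝ, ℂ)) :
    schwartzNorm m (opD^[k] f) ≤ schwartzNorm (m + k) f := by
  induction k generalizing f with
  | zero => simp
  | succ k ih =>
    rw [Function.iterate_succ_apply]
    exact (ih _).trans (schwartzNorm_opD_le _ _)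

theorem norm_iterate_opM_apply (k : ℕ) (f : 𝓢(ℝ, ℂ)) (x : ℝ) :
    ‖(opM^[k] f) x‖ = |x| ^ k * ‖f x‖ := by
  induction k generalizing f with
  | zero => simp
  | succ k ih =>
    rw [Function.iterate_succ_apply, ih, opM_apply]
    simp only [norm_mul, Complex.norm_I, Complex.norm_real, Real.norm_eq_abs, pow_succ]
    ring

theorem iterate_opD_apply (n : ℕ) (f : 𝓢(ℝ, ℂ)) (x : ℝ) :
    (opD^[n] f) x = iteratedDeriv n f x := by
  induction n generalizing f with
  | zero => simp
  | succ n ih =>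
    rw [Function.iterate_succ_apply, ih, iteratedDeriv_succ']
    congr 1

/-- One-dimensional Sobolev inequality: `|f(x)|²` is the integral of its derivative `2 Re⟨f, f'⟩`
over `(-∞, x]`, which is at most `‖f‖₀² + ‖f'‖₀²`. -/
theorem norm_apply_le_schwartzNorm (f : 𝓢(ℝ, ℂ)) (x : ℝ) : ‖f x‖ ≤ schwartzNorm 1 f := by
  have hb : ∀ y : ℝ, ‖2 * inner ℝ (f y) (deriv f y)‖ ≤ ‖f y‖ ^ 2 + ‖opD f y‖ ^ 2 := by
    intro y
    rw [opD_apply, norm_mul, Real.norm_eq_abs, Real.norm_eq_abs, abs_two]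
    nlinarith [abs_real_inner_le_norm (f y) (deriv f y), sq_nonneg (‖f y‖ - ‖deriv f y‖)]
  have hi : Integrable (fun y : ℝ => ‖f y‖ ^ 2 + ‖opD f y‖ ^ 2) :=
    (integrable_norm_sq f).add (integrable_norm_sq (opD f))
  have hi' : Integrable (fun y : ℝ => 2 * inner ℝ (f y) (deriv f y)) := by
    refine hi.mono' ?_ (Eventually.of_forall hb)
    have h1 : Continuous f := f.continuous
    have h2 : Continuous (deriv f) := (opD f).continuous.congr fun y => opD_apply f y
    exact (by fun_prop : Continuous _).aestronglyMeasurable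
  have h := integral_Iic_of_hasDerivAt_of_tendsto (f := fun y : ℝ => ‖f y‖ ^ 2) (a := x) (m := 0)
    (by have h1 : Continuous f := f.continuous
        exact (by fun_prop : Continuous _).continuousWithinAt)
    (fun y _ => (f.hasDerivAt y).norm_sq) hi'.integrableOn
    (by
      have h1 : Tendsto f atBot (𝓝 0) := f.tendsto_cocompact.mono_left atBot_le_cocompact
      simpa using h1.norm.pow 2)
  rw [sub_zero] at h
  refine le_of_sq_le_sq ?_ (apply_nonneg _ _)
  calc ‖f x‖ ^ 2 ≤ ∫ y in Set.Iic x, (‖f y‖ ^ 2 + ‖opD f y‖ ^ 2) := by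
        rw [← h]
        exact integral_mono hi'.integrableOn hi.integrableOn fun y => (le_abs_self _).trans (hb y)
    _ ≤ ∫ y, (‖f y‖ ^ 2 + ‖opD f y‖ ^ 2) :=
        setIntegral_le_integral hi (Eventually.of_forall fun y => by positivity)
    _ = schwartzNorm 0 f ^ 2 + schwartzNorm 0 (opD f) ^ 2 := by
        rw [schwartzNorm_zero_sq, schwartzNorm_zero_sq,
          integral_add (integrable_norm_sq f) (integrable_norm_sq _)]
    _ ≤ schwartzNorm 1 f ^ 2 := by
        rw [schwartzNorm_succ_sq]
        nlinarith [sq_nonneg (schwartzNorm 0 (opM f))]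

/-- In the index, `1` pays for the supremum bound, `k` for the factors `x` and `n` for the
derivatives. So the norms `‖·‖ₙ` dominate every Schwartz seminorm. -/
theorem pow_mul_norm_iteratedDeriv_le (k n : ℕ) (f : 𝓢(ℝ, ℂ)) (x : ℝ) :
    |x| ^ k * ‖iteratedDeriv n f x‖ ≤ schwartzNorm (1 + k + n) f := by
  rw [← iterate_opD_apply, ← norm_iterate_opM_apply]
  exact (norm_apply_le_schwartzNorm _ _).trans
    ((schwartzNorm_iterate_opM_le _ _ _).trans (schwartzNorm_iterate_opD_le _ _ _))

theorem continuous_schwartzNorm (n : ℕ) : Continuous (schwartzNorm n) := by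
  induction n with
  | zero =>
    exact continuous_norm.comp (SchwartzMap.toLpCLM ℂ ℂ 2 volume).continuous
  | succ n ih =>
    have hM : Continuous opM := (Complex.I • mulX).continuous
    have hD : Continuous opD := (SchwartzMap.derivCLM ℂ ℂ).continuous
    have h : (schwartzNorm (n + 1) : 𝓢(ℝ, ℂ) → ℝ) = fun f =>
        √(schwartzNorm n (opM f) ^ 2 + schwartzNorm n (opD f) ^ 2 + schwartzNorm n f ^ 2) := by
      funext f
      rw [← schwartzNorm_succ_sq, Real.sqrt_sq (apply_nonneg _ _)]
    rw [h]
    have h1 := ih.comp hM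
    have h2 := ih.comp hD
    simp only [Function.comp_def] at h1 h2
    fun_prop

theorem iteratedDeriv_sub_apply (n : ℕ) (f g : 𝓢(ℝ, ℂ)) (x : ℝ) :
    iteratedDeriv n (f - g : 𝓢(ℝ, ℂ)) x = iteratedDeriv n f x - iteratedDeriv n g x := by
  simp only [← iterate_opD_apply, iterate_map_sub, sub_apply]

/-- A sequence of Schwartz functions that is Cauchy for all the norms converges. -/
theorem exists_tendsto_of_cauchy_schwartzNorm (f : ℕ → 𝓢(ℝ, ℂ))
    (hf : ∀ n : ℕ, ∀ ε > 0, ∃ N, ∀ k ≥ N, ∀ l ≥ N, schwartzNorm n (f k - f l) < ε) :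
    ∃ F : 𝓢(ℝ, ℂ), Tendsto f atTop (𝓝 F) := by
  have hc : ∀ n : ℕ, UniformCauchySeqOn (fun k x => iteratedDeriv n (f k) x) atTop Set.univ := by
    intro n
    rw [Metric.uniformCauchySeqOn_iff]
    intro ε hε
    obtain ⟨N, hN⟩ := hf (1 + 0 + n) ε hε
    refine ⟨N, fun k hk l hl x _ => ?_⟩
    rw [dist_eq_norm, ← iteratedDeriv_sub_apply]
    refine lt_of_le_of_lt ?_ (hN k hk l hl)
    simpa using pow_mul_norm_iteratedDeriv_le 0 n (f k - f l) x
  have hlim : ∀ (n : ℕ) (x : ℝ), ∃ y : ℂ,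
      Tendsto (fun k => iteratedDeriv n (f k) x) atTop (𝓝 y) := by
    intro n x
    exact cauchySeq_tendsto_of_complete ((hc n).cauchySeq (Set.mem_univ x))
  choose G hG using hlim
  have hu : ∀ n : ℕ, TendstoUniformly (fun k x => iteratedDeriv n (f k) x) (G n) atTop := by
    intro n
    rw [← tendstoUniformlyOn_univ]
    exact (hc n).tendstoUniformlyOn_of_tendsto fun x _ => hG n x
  -- Uniform convergence of the derivatives makes each limit the derivative of the preceding one.
  have hd : ∀ (n : ℕ) (x : ℝ), HasDerivAt (G n) (G (n + 1) x) x := by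
    intro n
    refine hasDerivAt_of_tendstoUniformly (hu (n + 1)) (Eventually.of_forall fun k x => ?_) (hG n)
    have h := (opD^[n] (f k)).hasDerivAt x
    rw [← opD_apply, ← Function.iterate_succ_apply' opD, iterate_opD_apply] at h
    exact h.congr_of_eventuallyEq (Eventually.of_forall fun y => (iterate_opD_apply n (f k) y).symm)
  have hcd : ∀ m n : ℕ, ContDiff ℝ m (G n) := by
    intro m
    induction m with
    | zero =>
      exact fun n => contDiff_zero.2 (continuous_iff_continuousAt.2 fun x => (hd n x).continuousAt)
    | succ m ih =>
      intro n
      rw [Nat.cast_succ, contDiff_succ_iff_deriv]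
      refine ⟨fun x => (hd n x).differentiableAt, by simp, ?_⟩
      rw [funext fun x => (hd n x).deriv]
      exact ih _
  have hit : ∀ n m : ℕ, iteratedDeriv n (G m) = G (m + n) := by
    intro n
    induction n with
    | zero => simp
    | succ n ih =>
      intro m
      rw [iteratedDeriv_succ', funext fun x => (hd m x).deriv, ih]
      congr 1; ring
  have hest : ∀ k n : ℕ, ∀ ε > 0, ∃ N, ∀ i ≥ N, ∀ x : ℝ,
      |x| ^ k * ‖iteratedDeriv n (f i) x - G n x‖ ≤ ε := by
    intro k n ε hε
    obtain ⟨N, hN⟩ := hf (1 + k + n) ε hε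
    refine ⟨N, fun i hi x => ?_⟩
    -- With `i` fixed, let `l → ∞` in the Cauchy estimate.
    have ht : Tendsto (fun l => |x| ^ k * ‖iteratedDeriv n (f i) x - iteratedDeriv n (f l) x‖)
        atTop (𝓝 (|x| ^ k * ‖iteratedDeriv n (f i) x - G n x‖)) :=
      ((tendsto_const_nhds.sub (hG n x)).norm).const_mul _
    refine le_of_tendsto ht (eventually_atTop.2 ⟨N, fun l hl => ?_⟩)
    rw [← iteratedDeriv_sub_apply]
    exact (pow_mul_norm_iteratedDeriv_le k n _ x).trans (hN i hi l hl).le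
  let F : 𝓢(ℝ, ℂ) :=
    { toFun := G 0
      smooth' := contDiff_infty.2 fun m => hcd m 0
      decay' := by
        intro k n
        obtain ⟨N, hN⟩ := hest k n 1 one_pos
        refine ⟨1 + SchwartzMap.seminorm ℂ k n (f N), fun x => ?_⟩
        rw [norm_iteratedFDeriv_eq_norm_iteratedDeriv, hit, zero_add, Real.norm_eq_abs]
        have h1 := hN N le_rfl x
        have h2 := SchwartzMap.le_seminorm' ℂ k n (f N) x
        have h3 : ‖G n x‖ ≤ ‖iteratedDeriv n (f N) x - G n x‖ + ‖iteratedDeriv n (f N) x‖ := by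
          rw [norm_sub_rev]; exact norm_le_norm_sub_add _ _
        have h4 := mul_le_mul_of_nonneg_left h3 (show 0 ≤ |x| ^ k by positivity)
        linarith }
  have hFG : ∀ n : ℕ, iteratedDeriv n F = G n := fun n => by
    rw [show (F : ℝ → ℂ) = G 0 from rfl, hit, zero_add]
  refine ⟨F, ?_⟩
  rw [(schwartz_withSeminorms ℂ ℝ ℂ).tendsto_nhds_atTop]
  rintro ⟨k, n⟩ ε hε
  obtain ⟨N, hN⟩ := hest k n (ε / 2) (by positivity)
  refine ⟨N, fun i hi => lt_of_le_of_lt ?_ (half_lt_self hε)⟩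
  refine SchwartzMap.seminorm_le_bound' ℂ k n _ (by positivity) fun x => ?_
  rw [iteratedDeriv_sub_apply, hFG]
  exact hN i hi x

theorem tendsto_schwartzNorm_sub {f : ℕ → 𝓢(ℝ, ℂ)} {F : 𝓢(ℝ, ℂ)} (hF : Tendsto f atTop (𝓝 F))
    (n : ℕ) : Tendsto (fun k => schwartzNorm n (f k - F)) atTop (𝓝 0) := by
  have h0 := ((continuous_schwartzNorm n).tendsto 0).comp (tendsto_sub_nhds_zero_iff.2 hF)
  simpa [Function.comp_def] using h0

/-! ### Seminorms dominated by square sums of functionals -/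

/-- The seminorm `p` is bounded by the `ℓ²` norm of a sequence of functionals whose norms with
respect to `q` are summable. -/
def SquareSumDominated {E : Type*} [AddCommGroup E] [Module ℂ E] (p q : Seminorm ℂ E) : Prop :=
  ∃ (l : ℕ → E →ₗ[ℂ] ℂ) (c : ℕ → ℝ), Summable c ∧ (∀ k x, ‖l k x‖ ≤ c k * q x) ∧
    ∀ x, p x ^ 2 ≤ ∑' k, ‖l k x‖ ^ 2

section
variable {E : Type*} [AddCommGroup E] [Module ℂ E]

theorem summable_sq_of_le {l : ℕ → E →ₗ[ℂ] ℂ} {c : ℕ → ℝ} {q : Seminorm ℂ E} (hc : Summable c)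
    (hl : ∀ k x, ‖l k x‖ ≤ c k * q x) (x : E) : Summable fun k => ‖l k x‖ ^ 2 := by
  have h : Summable fun k => ‖l k x‖ :=
    (hc.mul_right (q x)).of_nonneg_of_le (fun k => norm_nonneg _) fun k => hl k x
  refine h.of_norm_bounded_eventually_nat ?_
  filter_upwards [h.tendsto_atTop_zero.eventually (gt_mem_nhds one_pos)] with k hk
  rw [norm_pow, norm_norm, sq]
  exact mul_le_of_le_one_left (norm_nonneg _) hk.le

theorem SquareSumDominated.comp {F : Type*} [AddCommGroup F] [Module ℂ F] {p q : Seminorm ℂ E}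
    (h : SquareSumDominated p q) (T : F →ₗ[ℂ] E) : SquareSumDominated (p.comp T) (q.comp T) := by
  obtain ⟨l, c, hc, hl, hp⟩ := h
  exact ⟨fun k => (l k).comp T, c, hc, fun k x => hl k (T x), fun x => hp (T x)⟩

theorem SquareSumDominated.mono_const {p q q' : Seminorm ℂ E}
    (h : SquareSumDominated p q) {C : ℝ} (hq : ∀ x, q x ≤ C * q' x) : SquareSumDominated p q' := by
  obtain ⟨l, c, hc, hl, hp⟩ := h
  refine ⟨l, fun k => |c k| * C, hc.abs.mul_right C, fun k x => (hl k x).trans ?_, hp⟩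
  calc c k * q x ≤ |c k| * q x := mul_le_mul_of_nonneg_right (le_abs_self _) (apply_nonneg _ _)
    _ ≤ |c k| * (C * q' x) := mul_le_mul_of_nonneg_left (hq x) (abs_nonneg _)
    _ = _ := by ring

theorem SquareSumDominated.mono {p q q' : Seminorm ℂ E}
    (h : SquareSumDominated p q) (hq : q ≤ q') : SquareSumDominated p q' :=
  h.mono_const (C := 1) fun x => by simpa using hq x

theorem SquareSumDominated.of_denumerable {ι : Type*} [Denumerable ι] {p q : Seminorm ℂ E}
    (l : ι → E →ₗ[ℂ] ℂ) (c : ι → ℝ) (hc : Summable c) (hl : ∀ k x, ‖l k x‖ ≤ c k * q x)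
    (hp : ∀ x, p x ^ 2 ≤ ∑' k, ‖l k x‖ ^ 2) : SquareSumDominated p q := by
  let e : ℕ ≃ ι := (Denumerable.eqv ι).symm
  refine ⟨fun k => l (e k), fun k => c (e k), e.summable_iff.2 hc, fun k x => hl (e k) x,
    fun x => ?_⟩
  rw [e.tsum_eq (fun k => ‖l k x‖ ^ 2)]
  exact hp x

theorem SquareSumDominated.l2add {p p' q : Seminorm ℂ E} (h : SquareSumDominated p q)
    (h' : SquareSumDominated p' q) : SquareSumDominated (l2add p p') q := by
  obtain ⟨l, c, hc, hl, hp⟩ := h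
  obtain ⟨l', c', hc', hl', hp'⟩ := h'
  refine SquareSumDominated.of_denumerable (ι := ℕ ⊕ ℕ) (Sum.elim l l') (Sum.elim c c')
    (HasSum.summable (HasSum.sum (f := Sum.elim c c') hc.hasSum hc'.hasSum)) ?_ fun x => ?_
  · rintro (k | k) x
    · exact hl k x
    · exact hl' k x
  · have h := HasSum.sum (f := fun k : ℕ ⊕ ℕ => ‖Sum.elim l l' k x‖ ^ 2)
      (summable_sq_of_le hc hl x).hasSum (summable_sq_of_le hc' hl' x).hasSum
    rw [l2add_sq, h.tsum_eq]
    exact add_le_add (hp x) (hp' x)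

/-- The canonical map to the local Banach space as a linear map. -/
def toLocalBanachₗ (p : Seminorm ℂ E) : E →ₗ[ℂ] LocalBanach p where
  toFun := toLocalBanach p
  map_add' x y := UniformSpace.Completion.coe_add (α := WithOneSeminorm p) x y
  map_smul' c x := UniformSpace.Completion.coe_smul (X := WithOneSeminorm p) c x

theorem norm_toLocalBanachₗ (p : Seminorm ℂ E) (x : E) : ‖toLocalBanachₗ p x‖ = p x :=
  UniformSpace.Completion.norm_coe (E := WithOneSeminorm p) x

theorem denseRange_toLocalBanachₗ (p : Seminorm ℂ E) : DenseRange (toLocalBanachₗ p) :=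
  UniformSpace.Completion.denseRange_coe (α := WithOneSeminorm p)

/-- The map factors as `E_q → ℓ² → E_p`. The first arrow `A` extends `x ↦ (lₖ x)`. The second sends
`(lₖ x)` to `x`, which is a contraction on the range because `p` is at most the `ℓ²` norm; it
extends to the closure `K` of the range and, after orthogonal projection onto `K`, to all of `ℓ²`.
Expanding `A x` in the standard basis gives the nuclear series, with functionals of norm at most
`|cₖ|` and vectors of norm at most `1`. -/
theorem SquareSumDominated.exists_nuclear {p q : Seminorm ℂ E} (h : SquareSumDominated p q) :
    ∃ T : LocalBanach q →L[ℂ] LocalBanach p,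
      (∀ x : E, T (toLocalBanach q x) = toLocalBanach p x) ∧ IsNuclearMap T := by
  obtain ⟨l, c, hc, hl, hp⟩ := h
  let H := lp (fun _ : ℕ => ℂ) 2
  have hs := summable_sq_of_le hc hl
  let L : E →ₗ[ℂ] H :=
    { toFun := fun x => ⟨fun k => l k x, memℓp_gen (by simpa using hs x)⟩
      map_add' := fun x y => by ext k; exact map_add (l k) x y
      map_smul' := fun a x => by ext k; exact map_smul (l k) a x }
  have hL : ∀ x k, (L x : ℕ → ℂ) k = l k x := fun x k => rfl
  have hLn : ∀ x, ‖L x‖ ^ 2 = ∑' k, ‖l k x‖ ^ 2 := fun x => by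
    have := lp.norm_rpow_eq_tsum (p := 2) (by norm_num) (L x)
    simpa [hL] using this
  let K : Submodule ℂ H := (LinearMap.range L).topologicalClosure
  have hKc : IsClosed (K : Set H) := Submodule.isClosed_topologicalClosure _
  have : CompleteSpace K := hKc.completeSpace_coe
  let L' : E →ₗ[ℂ] K := L.codRestrict K fun x =>
    Submodule.le_topologicalClosure _ (LinearMap.mem_range_self L x)
  have hL'd : DenseRange L' := by
    rw [DenseRange, IsInducing.subtypeVal.dense_iff]
    rintro ⟨x, hx⟩
    rw [← Set.range_comp]
    exact hx
  have hB : ∀ x, ‖toLocalBanachₗ p x‖ ≤ 1 * ‖L' x‖ := fun x => by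
    rw [norm_toLocalBanachₗ, one_mul]
    refine le_of_sq_le_sq ?_ (norm_nonneg _)
    exact (hp x).trans (hLn x).ge
  have hLb : ∀ x, ‖L x‖ ≤ (∑' k, |c k|) * ‖toLocalBanachₗ q x‖ := fun x => by
    rw [norm_toLocalBanachₗ]
    have h1 : Summable fun k => |c k| * q x := hc.abs.mul_right _
    have h2 : ∀ k, ‖l k x‖ ≤ |c k| * q x := fun k =>
      (hl k x).trans (mul_le_mul_of_nonneg_right (le_abs_self _) (apply_nonneg _ _))
    have h3 : ∀ k, ‖l k x‖ ≤ (∑' k, |c k|) * q x := fun k => (h2 k).trans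
      (mul_le_mul_of_nonneg_right (hc.abs.le_tsum k fun _ _ => abs_nonneg _) (apply_nonneg _ _))
    refine le_of_sq_le_sq ?_
      (mul_nonneg (tsum_nonneg fun _ => abs_nonneg _) (apply_nonneg _ _))
    rw [hLn, sq ((∑' k, |c k|) * q x)]
    calc ∑' k, ‖l k x‖ ^ 2 ≤ ∑' k, |c k| * q x * ((∑' k, |c k|) * q x) := by
          refine (hs x).tsum_le_tsum (fun k => ?_) (h1.mul_right _)
          rw [sq]
          exact mul_le_mul (h2 k) (h3 k) (norm_nonneg _)
            (mul_nonneg (abs_nonneg _) (apply_nonneg _ _))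
      _ = _ := by rw [tsum_mul_right, tsum_mul_right]
  let B : K →L[ℂ] LocalBanach p := (toLocalBanachₗ p).extendOfNorm L'
  let A : LocalBanach q →L[ℂ] H := L.extendOfNorm (toLocalBanachₗ q)
  have hBe : ∀ x, B (L' x) = toLocalBanachₗ p x := LinearMap.extendOfNorm_eq hL'd ⟨1, hB⟩
  have hAe : ∀ x, A (toLocalBanachₗ q x) = L x :=
    LinearMap.extendOfNorm_eq (denseRange_toLocalBanachₗ q) ⟨_, hLb⟩
  let P : H →L[ℂ] LocalBanach p := B.comp K.orthogonalProjectionOnto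
  have hPn : ∀ v, ‖P v‖ ≤ ‖v‖ := fun v => by
    have h1 := LinearMap.norm_extendOfNorm_apply_le hL'd 1 hB (K.orthogonalProjectionOnto v)
    rw [one_mul] at h1
    exact h1.trans (K.norm_orthogonalProjectionOnto_apply_le v)
  let f : ℕ → LocalBanach q →L[ℂ] ℂ := fun k => (lp.evalCLM ℂ (fun _ : ℕ => ℂ) 2 k).comp A
  have hf : ∀ k x, f k x = (A x : ℕ → ℂ) k := fun k x => rfl
  have hfn : ∀ k, ‖f k‖ ≤ |c k| := fun k => by
    refine ContinuousLinearMap.opNorm_le_bound _ (abs_nonneg _) fun x => ?_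
    refine (denseRange_toLocalBanachₗ q).induction_on (p := fun x => ‖f k x‖ ≤ |c k| * ‖x‖) x
      (isClosed_le (by fun_prop) (by fun_prop)) fun y => ?_
    rw [hf, hAe, norm_toLocalBanachₗ, hL]
    exact (hl k y).trans (mul_le_mul_of_nonneg_right (le_abs_self _) (apply_nonneg _ _))
  refine ⟨P.comp A, fun x => ?_, f, fun k => P (lp.single 2 k 1), ?_, fun x => ?_⟩
  · change B (K.orthogonalProjectionOnto (A (toLocalBanachₗ q x))) = toLocalBanachₗ p x
    rw [hAe, ← hBe]
    congr 1
    exact K.orthogonalProjectionOnto_mem_subspace_eq_self (L' x)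
  · refine hc.abs.of_nonneg_of_le (fun k => by positivity) fun k => ?_
    refine (mul_le_mul (hfn k) ((hPn _).trans ?_) (norm_nonneg _) (abs_nonneg _)).trans_eq
      (mul_one _)
    rw [lp.norm_single (by norm_num)]
    simp
  · have h1 := (lp.hasSum_single (p := 2) (by norm_num) (A x)).mapL P
    have h2 : (fun k => P (lp.single 2 k ((A x : ℕ → ℂ) k))) =
        fun k => f k x • P (lp.single 2 k 1) := by
      funext k
      rw [hf, ← map_smul, ← lp.single_smul, smul_eq_mul, mul_one]
    rw [← h2]
    exact h1

end

/-! ### The `L²` norm of Schwartz functions through windowed Fourier coefficients -/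

theorem one_add_sq_mul_norm_le (n : ℕ) (f : 𝓢(ℝ, ℂ)) (x : ℝ) :
    (1 + x ^ 2) * ‖iteratedDeriv n f x‖ ≤ 2 * schwartzNorm (3 + n) f := by
  have h0 := pow_mul_norm_iteratedDeriv_le 0 n f x
  have h2 := pow_mul_norm_iteratedDeriv_le 2 n f x
  have h3 := schwartzNorm_mono (show 1 + 0 + n ≤ 3 + n by omega) f
  rw [sq_abs] at h2
  simp only [pow_zero, one_mul] at h0
  linarith

/-- The window `sin² (π (x - j) / 2)`, used on `[j, j + 2]`. -/
def window (j : ℤ) (x : ℝ) : ℝ := (1 - Real.cos (Real.pi * (x - j))) / 2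

theorem hasDerivAt_window (j : ℤ) (x : ℝ) :
    HasDerivAt (window j) (Real.pi * Real.sin (Real.pi * (x - j)) / 2) x := by
  have h := (((hasDerivAt_id x).sub_const (j : ℝ)).const_mul Real.pi).cos
  have h2 := (h.const_sub 1).div_const 2
  exact h2.congr_deriv (by simp only [id]; ring)

theorem hasDerivAt_deriv_window (j : ℤ) (x : ℝ) :
    HasDerivAt (fun x => Real.pi * Real.sin (Real.pi * (x - j)) / 2)
      (Real.pi ^ 2 * Real.cos (Real.pi * (x - j)) / 2) x := by
  have h := (((hasDerivAt_id x).sub_const (j : ℝ)).const_mul Real.pi).sin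
  have h2 := (h.const_mul Real.pi).div_const 2
  exact h2.congr_deriv (by simp only [id]; ring)

theorem continuous_window (j : ℤ) : Continuous (window j) := by
  unfold window; fun_prop

theorem abs_window_le (j : ℤ) (x : ℝ) : |window j x| ≤ 1 := by
  rw [window, abs_le]
  constructor <;> linarith [Real.cos_le_one (Real.pi * (x - j)), Real.neg_one_le_cos (Real.pi * (x - j))]

/-- The two windows are `(1 ∓ cos)/2` of the same angle, so their squares add up to `(1 + cos²)/2`.
-/
theorem half_le_window_sq_add (j : ℤ) (x : ℝ) :
    1 / 2 ≤ window j x ^ 2 + window (j - 1) x ^ 2 := by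
  have h : Real.cos (Real.pi * (x - ((j - 1 : ℤ) : ℝ))) = - Real.cos (Real.pi * (x - j)) := by
    rw [← Real.cos_add_pi]; congr 1; push_cast; ring
  rw [window, window, h]
  nlinarith [sq_nonneg (Real.cos (Real.pi * (x - j)))]

/-- The function `f` cut off by the window at `j`. -/
def windowed (j : ℤ) (f : ℝ → ℂ) (x : ℝ) : ℂ := (window j x : ℂ) * f x

theorem continuous_windowed (j : ℤ) (f : 𝓢(ℝ, ℂ)) : Continuous (windowed j f) := by
  have h1 := continuous_window j
  have h2 : Continuous f := f.continuous
  unfold windowed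
  fun_prop

theorem lt_add_two (j : ℤ) : (j : ℝ) < (j : ℝ) + 2 := by linarith

/-- The Fourier coefficients of `f` cut off by the window at `j`. -/
def windowCoeff (j l : ℤ) : 𝓢(ℝ, ℂ) →ₗ[ℂ] ℂ where
  toFun f := fourierCoeffOn (lt_add_two j) (windowed j f) l
  map_add' f g := by
    simp only [fourierCoeffOn_eq_integral]
    have hc : Continuous fun x : ℝ => (fourier (-l) (x : AddCircle ((j : ℝ) + 2 - j)) : ℂ) :=
      (fourier (-l)).continuous.comp (AddCircle.continuous_mk' _)
    rw [← smul_add, ← intervalIntegral.integral_add]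
    · congr 2; ext x; simp only [windowed, add_apply, smul_eq_mul]; ring
    · exact (hc.smul (continuous_windowed j f)).intervalIntegrable _ _
    · exact (hc.smul (continuous_windowed j g)).intervalIntegrable _ _
  map_smul' c f := by
    have h : windowed j (c • f : 𝓢(ℝ, ℂ)) = c • windowed j f := by
      ext x; simp only [windowed, smul_apply, smul_eq_mul, Pi.smul_apply]; ring
    rw [h, fourierCoeffOn.const_smul]
    rfl

theorem norm_fourierCoeffOn_le {a b : ℝ} (hab : a < b) {g : ℝ → ℂ} {C : ℝ}
    (hg : ∀ x ∈ Set.Icc a b, ‖g x‖ ≤ C) (n : ℤ) : ‖fourierCoeffOn hab g n‖ ≤ C := by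
  have hba : 0 < b - a := sub_pos.2 hab
  rw [fourierCoeffOn_eq_integral, norm_smul, Real.norm_eq_abs, abs_of_pos (by positivity),
    one_div_mul_eq_div, div_le_iff₀ hba]
  have h := intervalIntegral.norm_integral_le_of_norm_le_const (a := a) (b := b) (C := C)
    (f := fun x : ℝ => fourier (-n) (x : AddCircle (b - a)) • g x) fun x hx => by
      rw [Set.uIoc_of_le hab.le] at hx
      rw [norm_smul, fourier_apply, Circle.norm_coe, one_mul]
      exact hg x ⟨hx.1.le, hx.2⟩
  rwa [abs_of_pos hba] at h

/-- The window and its derivative vanish at both ends of `[j, j + 2]`, so two integrations by parts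
leave no boundary terms and give decay `l⁻²`. Decay in `j` comes from that of `f`, `f'`, `f''`,
which costs `‖·‖₅`. The constant is `180 = 10 · 9 · 2`, from `bF₂`, `hj` and the definition of `S`.
-/
theorem windowCoeff_bound (j l : ℤ) (f : 𝓢(ℝ, ℂ)) :
    ‖windowCoeff j l f‖ ≤
      180 * ((1 + (j : ℝ) ^ 2)⁻¹ * (1 + (l : ℝ) ^ 2)⁻¹) * schwartzNorm 5 f := by
  set S := 2 * schwartzNorm 5 f with hS
  have hpi := Real.pi_pos
  have hpi3 := Real.pi_gt_three
  have hpi4 := Real.pi_lt_d2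
  -- For `x = j + s` with `0 ≤ s ≤ 2`, `1 + j² ≤ 1 + 2x² + 2s² ≤ 9 (1 + x²)`.
  have hj : ∀ x ∈ Set.Icc (j : ℝ) (j + 2), (1 + x ^ 2)⁻¹ ≤ 9 * (1 + (j : ℝ) ^ 2)⁻¹ := by
    intro x hx
    rw [← div_eq_mul_inv, inv_eq_one_div, div_le_div_iff₀ (by positivity) (by positivity)]
    nlinarith [hx.1, hx.2, sq_nonneg (2 * x - (x - j)), sq_nonneg (x + (x - j))]
  have hb : ∀ n ≤ 2, ∀ x ∈ Set.Icc (j : ℝ) (j + 2),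
      ‖iteratedDeriv n f x‖ ≤ S * (9 * (1 + (j : ℝ) ^ 2)⁻¹) := by
    intro n hn x hx
    have h1 := one_add_sq_mul_norm_le n f x
    have h2 := schwartzNorm_mono (show 3 + n ≤ 5 by omega) f
    calc ‖iteratedDeriv n f x‖ ≤ S * (1 + x ^ 2)⁻¹ := by
          rw [← div_eq_mul_inv, le_div_iff₀ (by positivity)]
          linarith
      _ ≤ _ := mul_le_mul_of_nonneg_left (hj x hx) (by positivity)
  set F₁ : ℝ → ℂ := fun x =>
    ((Real.pi * Real.sin (Real.pi * (x - j)) / 2 : ℝ) : ℂ) * f x + (window j x : ℂ) * opD f x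
  set F₂ : ℝ → ℂ := fun x => ((Real.pi ^ 2 * Real.cos (Real.pi * (x - j)) / 2 : ℝ) : ℂ) * f x
    + ((Real.pi * Real.sin (Real.pi * (x - j)) / 2 : ℝ) : ℂ) * opD f x
    + (((Real.pi * Real.sin (Real.pi * (x - j)) / 2 : ℝ) : ℂ) * opD f x
      + (window j x : ℂ) * opD (opD f) x)
  have hfd : ∀ (g : 𝓢(ℝ, ℂ)) (x : ℝ), HasDerivAt g (opD g x) x := fun g x => by
    rw [opD_apply]; exact g.hasDerivAt x
  have hd₁ : ∀ x, HasDerivAt (windowed j f) (F₁ x) x := fun x =>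
    (hasDerivAt_window j x).ofReal_comp.mul (hfd f x)
  have hd₂ : ∀ x, HasDerivAt F₁ (F₂ x) x := fun x =>
    ((hasDerivAt_deriv_window j x).ofReal_comp.mul (hfd f x)).add
      ((hasDerivAt_window j x).ofReal_comp.mul (hfd (opD f) x))
  have hw := continuous_window j
  have hc0 : Continuous f := f.continuous
  have hc1 : Continuous (opD f) := (opD f).continuous
  have hc2 : Continuous (opD (opD f)) := (opD (opD f)).continuous
  have hF₁ : Continuous F₁ := by fun_prop
  have hF₂ : Continuous F₂ := by fun_prop
  have hS0 : 0 ≤ S := by positivity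
  set B := S * (9 * (1 + (j : ℝ) ^ 2)⁻¹) with hB
  have hB0 : 0 ≤ B := by positivity
  have e1 : ∀ x, opD f x = iteratedDeriv 1 f x := fun x => iterate_opD_apply 1 f x
  have e2 : ∀ x, opD (opD f) x = iteratedDeriv 2 f x := fun x => iterate_opD_apply 2 f x
  have bF : ∀ x ∈ Set.Icc (j : ℝ) (j + 2), ‖windowed j f x‖ ≤ B := by
    intro x hx
    rw [windowed, norm_mul, Complex.norm_real, Real.norm_eq_abs]
    have h1 := hb 0 (by norm_num) x hx
    rw [iteratedDeriv_zero] at h1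
    nlinarith [abs_window_le j x, abs_nonneg (window j x), norm_nonneg (f x)]
  -- `10 = 5 + 2 + 2 + 1`, from `π²/2 ≤ 5`, twice `π/2 ≤ 2`, and the window itself.
  have bF₂ : ∀ x ∈ Set.Icc (j : ℝ) (j + 2), ‖F₂ x‖ ≤ 10 * B := by
    intro x hx
    have h0 := hb 0 (by norm_num) x hx
    have h1 := hb 1 (by norm_num) x hx
    have h2 := hb 2 le_rfl x hx
    rw [iteratedDeriv_zero] at h0
    rw [← e1] at h1
    rw [← e2] at h2
    have a0 : |Real.pi ^ 2 * Real.cos (Real.pi * (x - j)) / 2| ≤ 5 := by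
      rw [abs_div, abs_mul, abs_of_pos (by positivity : 0 < Real.pi ^ 2), abs_two]
      nlinarith [Real.abs_cos_le_one (Real.pi * (x - j)), abs_nonneg (Real.cos (Real.pi * (x - j)))]
    have a1 : |Real.pi * Real.sin (Real.pi * (x - j)) / 2| ≤ 2 := by
      rw [abs_div, abs_mul, abs_of_pos hpi, abs_two]
      nlinarith [Real.abs_sin_le_one (Real.pi * (x - j)), abs_nonneg (Real.sin (Real.pi * (x - j)))]
    have t : ∀ {r : ℝ} {z : ℂ} {K : ℝ}, |r| ≤ K → ‖z‖ ≤ B → ‖(r : ℂ) * z‖ ≤ K * B := by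
      intro r z K hr hz
      rw [norm_mul, Complex.norm_real, Real.norm_eq_abs]
      exact mul_le_mul hr hz (norm_nonneg _) ((abs_nonneg _).trans hr)
    refine (norm_add_le_of_le (norm_add_le_of_le (t a0 h0) (t a1 h1))
      (norm_add_le_of_le (t a1 h1) (t (abs_window_le j x) h2))).trans (by linarith)
  have key : ‖windowCoeff j l f‖ ≤ 10 * B * (1 + (l : ℝ) ^ 2)⁻¹ := by
    change ‖fourierCoeffOn (lt_add_two j) (windowed j f) l‖ ≤ _
    rcases eq_or_ne l 0 with rfl | hl
    · refine (norm_fourierCoeffOn_le _ bF 0).trans ?_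
      norm_num
      linarith
    · have z1 : windowed j f j = 0 := by simp [windowed, window]
      have p2 : Real.pi * ((j : ℝ) + 2 - j) = 2 * Real.pi := by ring
      have z2 : windowed j f ((j : ℝ) + 2) = 0 := by
        rw [windowed, window, p2]; simp
      have z3 : F₁ j = 0 := by simp [F₁, window]
      have z4 : F₁ ((j : ℝ) + 2) = 0 := by
        simp only [F₁, window, p2]; simp
      rw [fourierCoeffOn_of_hasDerivAt (lt_add_two j) hl (fun x _ => hd₁ x)
          (hF₁.intervalIntegrable _ _),
        fourierCoeffOn_of_hasDerivAt (lt_add_two j) hl (fun x _ => hd₂ x)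
          (hF₂.intervalIntegrable _ _), z1, z2, z3, z4]
      have hl' : (l : ℝ) ≠ 0 := by exact_mod_cast hl
      have hlc : (l : ℂ) ≠ 0 := by exact_mod_cast hl
      have hpc : (Real.pi : ℂ) ≠ 0 := by exact_mod_cast hpi.ne'
      set q := fourierCoeffOn (lt_add_two j) F₂ l with hq
      have hqb : ‖q‖ ≤ 10 * B := norm_fourierCoeffOn_le _ bF₂ l
      -- Each integration by parts on an interval of length `2` contributes a factor `2 / (2πil)`,
      -- and the product of the two is `-1/(πl)²`.
      have e3 : 1 / (-2 * (Real.pi : ℂ) * Complex.I * l) *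
          -((((j : ℝ) + 2 : ℝ) : ℂ) - ((j : ℝ) : ℂ)) * (1 / (-2 * (Real.pi : ℂ) * Complex.I * l) *
            -((((j : ℝ) + 2 : ℝ) : ℂ) - ((j : ℝ) : ℂ)) * q) =
          ((-(1 / (Real.pi * l) ^ 2) : ℝ) : ℂ) * q := by
        push_cast
        field_simp
        rw [Complex.I_sq]
        ring
      rw [sub_self, mul_zero, zero_sub, zero_sub, ← neg_mul, ← neg_mul]
      simp only [mul_assoc] at e3 ⊢
      rw [e3, norm_mul, Complex.norm_real, norm_neg, Real.norm_eq_abs,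
        abs_of_pos (by positivity), mul_comm _ ‖q‖]
      refine (mul_le_mul hqb ?_ (by positivity) (by positivity)).trans_eq (mul_assoc _ _ _)
      -- `1 + l² ≤ 2l² ≤ π²l²`, as `l` is a nonzero integer.
      rw [one_div]
      refine inv_anti₀ (by positivity) ?_
      have : (1 : ℝ) ≤ (l : ℝ) ^ 2 := by
        have h1 : (1 : ℤ) ≤ l ^ 2 := Int.one_le_abs hl |> fun h => by nlinarith [sq_abs l]
        exact_mod_cast h1
      have h9 : 9 ≤ Real.pi ^ 2 := by nlinarith
      rw [mul_pow]
      nlinarith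
  refine key.trans_eq ?_
  rw [hB, hS]; ring

theorem hasSum_windowCoeff_sq (j : ℤ) (f : 𝓢(ℝ, ℂ)) :
    HasSum (fun l : ℤ => ‖windowCoeff j l f‖ ^ 2)
      (1 / 2 * ∫ x in (j : ℝ)..(j + 2), ‖windowed j f x‖ ^ 2) := by
  have h := hasSum_sq_fourierCoeffOn (f := windowed j f) (lt_add_two j)
    ((memLp_two_iff_integrable_sq_norm (continuous_windowed j f).aestronglyMeasurable).2
      ((((continuous_windowed j f).norm.pow 2).integrableOn_Icc (a := (j : ℝ))
        (b := (j : ℝ) + 2)).mono_set Set.Ioc_subset_Icc_self))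
  rw [add_sub_cancel_left, smul_eq_mul, ← one_div] at h
  exact h

theorem summable_inv_one_add_sq_int : Summable fun j : ℤ => (1 + (j : ℝ) ^ 2)⁻¹ := by
  have h : Summable fun j : ℤ => 1 / (j : ℝ) ^ 2 := Real.summable_one_div_int_pow.2 (by norm_num)
  refine h.of_norm_bounded_eventually ?_
  filter_upwards [(Set.finite_singleton (0 : ℤ)).compl_mem_cofinite] with j hj
  have : (j : ℝ) ≠ 0 := by exact_mod_cast hj
  rw [Real.norm_eq_abs, abs_of_pos (by positivity), one_div]
  exact inv_anti₀ (by positivity) (by linarith)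

/-- Every unit interval `[j, j + 1]` lies under the windows at `j` and `j - 1`, whose squares add up
to at least `1/2`. The integrals over `[j, j + 2]` are cut in two and regrouped by unit intervals.
-/
theorem integral_norm_sq_le (f : 𝓢(ℝ, ℂ))
    (hs : Summable fun j : ℤ => ∫ x in (j : ℝ)..(j + 2), ‖windowed j f x‖ ^ 2) :
    ∫ x : ℝ, ‖f x‖ ^ 2 ≤ 2 * ∑' j : ℤ, ∫ x in (j : ℝ)..(j + 2), ‖windowed j f x‖ ^ 2 := by
  have hw : ∀ (j : ℤ) (a b : ℝ), IntervalIntegrable (fun x => ‖windowed j f x‖ ^ 2) volume a b :=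
    fun j a b => ((continuous_windowed j f).norm.pow 2).intervalIntegrable a b
  set I : ℤ → ℝ := fun j => ∫ x in (j : ℝ)..(j + 1), ‖windowed j f x‖ ^ 2 with hI
  set J : ℤ → ℝ := fun j => ∫ x in (j : ℝ)..(j + 1), ‖windowed (j - 1) f x‖ ^ 2 with hJ
  have hI0 : ∀ j, 0 ≤ I j := fun j =>
    intervalIntegral.integral_nonneg (by linarith) fun x _ => by positivity
  have hJ0 : ∀ j, 0 ≤ J j := fun j =>
    intervalIntegral.integral_nonneg (by linarith) fun x _ => by positivity
  have hadd : ∀ j : ℤ, ∫ x in (j : ℝ)..(j + 2), ‖windowed j f x‖ ^ 2 = I j + J (j + 1) := by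
    intro j
    rw [hI, hJ, ← intervalIntegral.integral_add_adjacent_intervals (hw j j (j + 1)) (hw j _ _)]
    simp only [add_sub_cancel_right]
    push_cast
    rw [add_assoc (j : ℝ) 1 1, one_add_one_eq_two]
  have hsI : Summable I := hs.of_nonneg_of_le hI0 fun j => by rw [hadd]; linarith [hJ0 (j + 1)]
  have hsJ' : Summable fun j => J (j + 1) :=
    hs.of_nonneg_of_le (fun j => hJ0 _) fun j => by rw [hadd]; linarith [hI0 j]
  have hsJ : Summable J := (Equiv.addRight (1 : ℤ)).summable_iff.1 hsJ'
  have hN := (integrable_norm_sq f).hasSum_intervalIntegral 0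
  simp only [zero_add] at hN
  rw [← hN.tsum_eq, tsum_congr hadd, hsI.tsum_add hsJ',
    show ∑' j, J (j + 1) = ∑' j, J j from (Equiv.addRight (1 : ℤ)).tsum_eq J,
    ← hsI.tsum_add hsJ, ← tsum_mul_left]
  refine hN.summable.tsum_le_tsum (fun j => ?_) ((hsI.add hsJ).mul_left 2)
  rw [hI, hJ, ← intervalIntegral.integral_add (hw _ _ _) (hw _ _ _),
    ← intervalIntegral.integral_const_mul]
  refine intervalIntegral.integral_mono_on (by linarith)
    ((integrable_norm_sq f).intervalIntegrable) (((hw _ _ _).add (hw _ _ _)).const_mul 2)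
    fun x _ => ?_
  have h := half_le_window_sq_add j x
  simp only [windowed, norm_mul, Complex.norm_real, Real.norm_eq_abs, mul_pow, sq_abs]
  nlinarith [sq_nonneg ‖f x‖]

theorem squareSumDominated_schwartzNorm_zero :
    SquareSumDominated (schwartzNorm 0) (schwartzNorm 5) := by
  have hc : Summable fun k : ℤ × ℤ =>
      360 * ((1 + (k.1 : ℝ) ^ 2)⁻¹ * (1 + (k.2 : ℝ) ^ 2)⁻¹) :=
    (summable_inv_one_add_sq_int.mul_of_nonneg summable_inv_one_add_sq_int
      (fun j => by positivity) fun j => by positivity).mul_left 360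
  have hl : ∀ (k : ℤ × ℤ) (f : 𝓢(ℝ, ℂ)), ‖((2 : ℂ) • windowCoeff k.1 k.2) f‖ ≤
      360 * ((1 + (k.1 : ℝ) ^ 2)⁻¹ * (1 + (k.2 : ℝ) ^ 2)⁻¹) * schwartzNorm 5 f := fun k f => by
    rw [LinearMap.smul_apply, norm_smul, Complex.norm_two]
    linarith [windowCoeff_bound k.1 k.2 f]
  -- The factor `2` in the functionals becomes `4` after squaring: one `2` from the overlap of the
  -- windows, one from Parseval on an interval of length `2`.
  refine SquareSumDominated.of_denumerable (fun k : ℤ × ℤ => (2 : ℂ) • windowCoeff k.1 k.2) _ hc hl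
    fun f => ?_
  have hs : Summable fun k : ℤ × ℤ => ‖((2 : ℂ) • windowCoeff k.1 k.2) f‖ ^ 2 := by
    have h1 := ((summable_inv_one_add_sq_int.mul_of_nonneg summable_inv_one_add_sq_int
      (fun j => by positivity) fun j => by positivity)).mul_left ((360 * schwartzNorm 5 f) ^ 2)
    refine h1.of_nonneg_of_le (fun k => by positivity) fun k => ?_
    have h2 := pow_le_pow_left₀ (norm_nonneg _) (hl k f) 2
    refine h2.trans ?_
    set t := (1 + (k.1 : ℝ) ^ 2)⁻¹ * (1 + (k.2 : ℝ) ^ 2)⁻¹ with ht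
    have t0 : 0 ≤ t := by positivity
    have t1 : t ≤ 1 := mul_le_one₀ (inv_le_one_of_one_le₀ (by nlinarith [sq_nonneg (k.1 : ℝ)]))
      (by positivity) (inv_le_one_of_one_le₀ (by nlinarith [sq_nonneg (k.2 : ℝ)]))
    calc (360 * t * schwartzNorm 5 f) ^ 2 = (360 * schwartzNorm 5 f) ^ 2 * (t * t) := by ring
      _ ≤ (360 * schwartzNorm 5 f) ^ 2 * t :=
        mul_le_mul_of_nonneg_left (mul_le_of_le_one_left t0 t1) (by positivity)
  have hj : ∀ j : ℤ, HasSum (fun l : ℤ => ‖((2 : ℂ) • windowCoeff j l) f‖ ^ 2)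
      (2 * ∫ x in (j : ℝ)..(j + 2), ‖windowed j f x‖ ^ 2) := fun j => by
    have h := (hasSum_windowCoeff_sq j f).mul_left 4
    have e : (fun l : ℤ => ‖((2 : ℂ) • windowCoeff j l) f‖ ^ 2) =
        fun l => 4 * ‖windowCoeff j l f‖ ^ 2 := by
      funext l
      rw [LinearMap.smul_apply, norm_smul, Complex.norm_two]; ring
    rw [e, show ∀ r : ℝ, 2 * r = 4 * (1 / 2 * r) from fun r => by ring]
    exact h
  have hp := hs.hasSum.prod_fiberwise hj
  rw [schwartzNorm_zero_sq, ← hp.tsum_eq, tsum_mul_left]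
  exact integral_norm_sq_le f ((hp.summable.mul_left (1 / 2)).congr fun j => by ring)

/-- `‖·‖ₙ₊₁` is the square sum of pullbacks of `‖·‖ₙ` along `M`, `D` and the identity, so the gap of
five indices persists by induction. -/
theorem squareSumDominated_schwartzNorm (n : ℕ) :
    SquareSumDominated (schwartzNorm n) (schwartzNorm (n + 5)) := by
  induction n with
  | zero => exact squareSumDominated_schwartzNorm_zero
  | succ n ih =>
    refine SquareSumDominated.l2add (SquareSumDominated.l2add ?_ ?_) ?_
    · exact (ih.comp opM).mono fun f => by
        simpa [add_right_comm] using schwartzNorm_opM_le (n + 5) f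
    · exact (ih.comp opD).mono fun f => by
        simpa [add_right_comm] using schwartzNorm_opD_le (n + 5) f
    · exact ih.mono (schwartzNorm_mono (by omega))

/-! ### Injectivity of the Stieltjes transform -/

theorem inv_add_le {δ x t : ℝ} (hδ : 0 < δ) (hδ1 : δ ≤ 1) (hx : δ ≤ x) (ht : 0 < t) :
    (x + t)⁻¹ ≤ δ⁻¹ * (1 + t)⁻¹ := by
  rw [← mul_inv]
  exact inv_anti₀ (by positivity) (by nlinarith)

theorem inv_add_pow_le {δ x t : ℝ} (hδ : 0 < δ) (hδ1 : δ ≤ 1) (hx : δ ≤ x) (ht : 0 < t) (n : ℕ) :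
    ((x + t)⁻¹) ^ (n + 1) ≤ (δ⁻¹) ^ (n + 1) * (1 + t)⁻¹ := by
  have hx0 : 0 < x := hδ.trans_le hx
  refine (pow_le_pow_left₀ (by positivity) (inv_add_le hδ hδ1 hx ht) _).trans ?_
  rw [mul_pow]
  refine mul_le_mul_of_nonneg_left ?_ (by positivity)
  rw [pow_succ]
  refine mul_le_of_le_one_left (by positivity) (pow_le_one₀ (by positivity) ?_)
  exact inv_le_one_of_one_le₀ (by linarith)

theorem norm_inv_pow_smul_le {δ x t : ℝ} (hδ : 0 < δ) (hδ1 : δ ≤ 1) (hx : δ ≤ x) (ht : 0 < t)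
    (n : ℕ) (z : ℂ) :
    ‖((x + t)⁻¹) ^ (n + 1) • z‖ ≤ (δ⁻¹) ^ (n + 1) * ‖(1 + t)⁻¹ • z‖ := by
  have hx0 : 0 < x := hδ.trans_le hx
  rw [norm_smul, norm_smul, Real.norm_eq_abs, abs_of_pos (by positivity), Real.norm_eq_abs,
    abs_of_pos (by positivity), ← mul_assoc]
  exact mul_le_mul_of_nonneg_right (inv_add_pow_le hδ hδ1 hx ht n) (norm_nonneg _)

section
variable {φ : ℝ → ℂ}

theorem aestronglyMeasurable_inv_pow_smul {μ : Measure ℝ} (hm : AEStronglyMeasurable φ μ)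
    (x : ℝ) (n : ℕ) : AEStronglyMeasurable (fun t : ℝ => ((x + t)⁻¹) ^ n • φ t) μ :=
  (by fun_prop : Measurable fun t : ℝ => ((x + t)⁻¹) ^ n).aestronglyMeasurable.smul hm

theorem aestronglyMeasurable_inv_smul {μ : Measure ℝ} (hm : AEStronglyMeasurable φ μ)
    (x : ℝ) : AEStronglyMeasurable (fun t : ℝ => (x + t)⁻¹ • φ t) μ := by
  simpa using aestronglyMeasurable_inv_pow_smul hm x 1

theorem integrable_inv_pow_smul (hm : AEStronglyMeasurable φ (volume.restrict (Set.Ioi 0)))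
    (hφ : IntegrableOn (fun t : ℝ => (1 + t)⁻¹ • φ t) (Set.Ioi 0)) (n : ℕ) {x : ℝ} (hx : 0 < x) :
    IntegrableOn (fun t : ℝ => ((x + t)⁻¹) ^ (n + 1) • φ t) (Set.Ioi 0) := by
  refine Integrable.mono' (hφ.norm.const_mul (((min 1 x)⁻¹) ^ (n + 1)))
    (aestronglyMeasurable_inv_pow_smul hm _ _) ?_
  filter_upwards [ae_restrict_mem measurableSet_Ioi] with t ht
  exact norm_inv_pow_smul_le (lt_min one_pos hx) (min_le_left _ _) (min_le_right _ _) ht n _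

theorem hasDerivAt_stieltjes (hm : AEStronglyMeasurable φ (volume.restrict (Set.Ioi 0)))
    (hφ : IntegrableOn (fun t : ℝ => (1 + t)⁻¹ • φ t) (Set.Ioi 0)) (n : ℕ) {x : ℝ} (hx : 0 < x) :
    HasDerivAt (fun x : ℝ => ∫ t in Set.Ioi (0 : ℝ), ((x + t)⁻¹) ^ (n + 1) • φ t)
      ((-((n : ℝ) + 1)) • ∫ t in Set.Ioi (0 : ℝ), ((x + t)⁻¹) ^ (n + 2) • φ t) x := by
  -- A lower bound for `1` and for all `y > x/2`, hence a domination uniform near `x`.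
  set δ := min 1 (x / 2) with hδ
  have hδ0 : 0 < δ := lt_min one_pos (by positivity)
  have h := hasDerivAt_integral_of_dominated_loc_of_deriv_le (𝕜 := ℝ)
    (μ := volume.restrict (Set.Ioi (0 : ℝ))) (F := fun x t => ((x + t)⁻¹) ^ (n + 1) • φ t)
    (F' := fun x t => (-((n : ℝ) + 1)) • ((x + t)⁻¹) ^ (n + 2) • φ t) (x₀ := x)
    (s := Set.Ioi (x / 2)) (bound := fun t => ((n : ℝ) + 1) * ((δ⁻¹) ^ (n + 2) * ‖(1 + t)⁻¹ • φ t‖))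
    (Ioi_mem_nhds (half_lt_self hx))
    (Eventually.of_forall fun y => aestronglyMeasurable_inv_pow_smul hm _ _)
    (integrable_inv_pow_smul hm hφ n hx)
    ((aestronglyMeasurable_inv_pow_smul hm x (n + 2)).const_smul (-((n : ℝ) + 1)))
    (by
      filter_upwards [ae_restrict_mem measurableSet_Ioi] with t ht y hy
      rw [norm_smul, norm_neg, Real.norm_eq_abs, abs_of_nonneg (by positivity)]
      refine mul_le_mul_of_nonneg_left ?_ (by positivity)
      exact norm_inv_pow_smul_le hδ0 (min_le_left _ _)
        ((min_le_right _ _).trans (le_of_lt hy)) ht (n + 1) _)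
    ((hφ.norm.const_mul _).const_mul _)
    (by
      filter_upwards [ae_restrict_mem measurableSet_Ioi] with t ht y hy
      have ht0 : 0 < t := ht
      have hy0 : 0 < y := lt_trans (by positivity) (show x / 2 < y from hy)
      have h1 : HasDerivAt (fun y : ℝ => ((y + t)⁻¹) ^ (n + 1))
          (-((n : ℝ) + 1) * ((y + t)⁻¹) ^ (n + 2)) y := by
        have h2 := (((hasDerivAt_id y).add_const t).inv (by simp only [id]; positivity)).pow (n + 1)
        refine h2.congr_deriv ?_
        simp only [id, Nat.add_sub_cancel, Nat.cast_add, Nat.cast_one, Pi.inv_apply]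
        rw [pow_add _ n 2]
        field_simp
      have h3 := h1.smul_const (φ t)
      rwa [mul_smul] at h3)
  have h2 := h.2
  rw [integral_smul] at h2
  exact h2

/-- Differentiating an identically vanishing Stieltjes transform raises the power of the kernel by
one and leaves zero. -/
theorem stieltjes_pow_eq_zero (hm : AEStronglyMeasurable φ (volume.restrict (Set.Ioi 0)))
    (hφ : IntegrableOn (fun t : ℝ => (1 + t)⁻¹ • φ t) (Set.Ioi 0))
    (h0 : ∀ x > 0, ∫ t in Set.Ioi (0 : ℝ), (x + t)⁻¹ • φ t = 0) (n : ℕ) :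
    ∀ x > 0, ∫ t in Set.Ioi (0 : ℝ), ((x + t)⁻¹) ^ (n + 1) • φ t = 0 := by
  induction n with
  | zero => simpa using h0
  | succ n ih =>
    intro x hx
    have h1 := hasDerivAt_stieltjes hm hφ n hx
    have h2 : HasDerivAt (fun x : ℝ => ∫ t in Set.Ioi (0 : ℝ), ((x + t)⁻¹) ^ (n + 1) • φ t) 0 x :=
      (hasDerivAt_const x (0 : ℂ)).congr_of_eventuallyEq
        (by filter_upwards [Ioi_mem_nhds hx] with y hy using ih y hy)
    have h3 := h1.unique h2
    rw [smul_eq_zero] at h3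
    exact h3.resolve_left (by have : (0 : ℝ) ≤ n := n.cast_nonneg; intro h; linarith)

/-- A function on the half line is determined by its Stieltjes transform. -/
theorem ae_eq_zero_of_stieltjes_eq_zero
    (hm : AEStronglyMeasurable φ (volume.restrict (Set.Ioi 0)))
    (hφ : IntegrableOn (fun t : ℝ => (1 + t)⁻¹ • φ t) (Set.Ioi 0))
    (h0 : ∀ x > 0, ∫ t in Set.Ioi (0 : ℝ), (x + t)⁻¹ • φ t = 0) :
    ∀ᵐ t ∂(volume.restrict (Set.Ioi (0 : ℝ))), φ t = 0 := by
  set μ := volume.restrict (Set.Ioi (0 : ℝ)) with hμ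
  set ψ : ℝ → ℂ := fun t => (1 + t)⁻¹ • φ t with hψ
  have hψi : Integrable ψ μ := hφ
  have hy : ∀ᵐ t ∂μ, (1 + t)⁻¹ ∈ Set.Icc (0 : ℝ) 1 := by
    filter_upwards [ae_restrict_mem measurableSet_Ioi] with t ht
    have ht0 : 0 < t := ht
    exact ⟨by positivity, inv_le_one_of_one_le₀ (by linarith)⟩
  -- At `x = 1` these are the moments of `ψ` in the variable `(1 + t)⁻¹`, which runs through the
  -- compact interval `[0, 1]`; Weierstrass approximation then applies.
  have hpow : ∀ n : ℕ, ∫ t, ((1 + t)⁻¹) ^ n • ψ t ∂μ = 0 := by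
    intro n
    rw [← stieltjes_pow_eq_zero hm hφ h0 n 1 one_pos]
    congr 1; ext t
    rw [hψ, smul_smul, ← pow_succ]
  have hpowi : ∀ n : ℕ, Integrable (fun t => ((1 + t)⁻¹) ^ n • ψ t) μ := by
    intro n
    refine hψi.norm.mono' (aestronglyMeasurable_inv_pow_smul hψi.1 _ _) ?_
    filter_upwards [hy] with t ht
    rw [norm_smul, norm_pow, Real.norm_eq_abs, abs_of_nonneg ht.1]
    exact mul_le_of_le_one_left (norm_nonneg _) (pow_le_one₀ ht.1 ht.2)
  have hpoly : ∀ p : Polynomial ℝ, Integrable (fun t => p.eval ((1 + t)⁻¹) • ψ t) μ ∧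
      ∫ t, p.eval ((1 + t)⁻¹) • ψ t ∂μ = 0 := by
    intro p
    induction p using Polynomial.induction_on' with
    | add p q hp hq =>
      simp only [Polynomial.eval_add, add_smul]
      exact ⟨hp.1.add hq.1, by rw [integral_add hp.1 hq.1, hp.2, hq.2, add_zero]⟩
    | monomial n a =>
      simp only [Polynomial.eval_monomial, mul_smul]
      exact ⟨(hpowi n).smul a, by rw [integral_smul, hpow, smul_zero]⟩
  have hcont : ∀ g : ℝ → ℝ, ContinuousOn g (Set.Icc 0 1) →
      Integrable (fun t => g ((1 + t)⁻¹) • ψ t) μ → ∫ t, g ((1 + t)⁻¹) • ψ t ∂μ = 0 := by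
    intro g hg hgi
    have hle : ∀ ε > 0, ‖∫ t, g ((1 + t)⁻¹) • ψ t ∂μ‖ ≤ ε * ∫ t, ‖ψ t‖ ∂μ := by
      intro ε hε
      obtain ⟨p, hp⟩ := exists_polynomial_near_of_continuousOn 0 1 g hg ε hε
      rw [← sub_zero (∫ t, g ((1 + t)⁻¹) • ψ t ∂μ), ← (hpoly p).2, ← integral_sub hgi (hpoly p).1,
        ← integral_const_mul]
      refine norm_integral_le_of_norm_le (hψi.norm.const_mul ε) ?_
      filter_upwards [hy] with t ht
      rw [← sub_smul, norm_smul, Real.norm_eq_abs, abs_sub_comm]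
      exact mul_le_mul_of_nonneg_right (hp _ ht).le (norm_nonneg _)
    have ht : Tendsto (fun ε : ℝ => ε * ∫ t, ‖ψ t‖ ∂μ) (𝓝[>] 0) (𝓝 0) := by
      have : Tendsto (fun ε : ℝ => ε * ∫ t, ‖ψ t‖ ∂μ) (𝓝 0) (𝓝 (0 * ∫ t, ‖ψ t‖ ∂μ)) :=
        tendsto_id.mul_const _
      rw [zero_mul] at this
      exact this.mono_left nhdsWithin_le_nhds
    refine norm_le_zero_iff.1 (ge_of_tendsto ht ?_)
    filter_upwards [self_mem_nhdsWithin] with ε hε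
    exact hle ε hε
  have hzero := isOpen_Ioi.ae_eq_zero_of_integral_contDiff_smul_eq_zero (μ := μ) (f := ψ)
    (U := Set.Ioi (0 : ℝ)) (hψi.locallyIntegrable.locallyIntegrableOn _) ?_
  · filter_upwards [hzero, ae_restrict_mem measurableSet_Ioi] with t ht ht'
    have h1 := ht ht'
    rw [hψ, smul_eq_zero] at h1
    have ht0 : 0 < t := ht'
    exact h1.resolve_left (by positivity)
  intro η hη hηc hηs
  have hη0 : ∀ t ≤ 0, η t = 0 := fun t ht => by
    by_contra h
    exact absurd (hηs (subset_tsupport η h)) (not_lt.2 ht)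
  obtain ⟨R, hR⟩ := hηc.isCompact.isBounded.subset_closedBall 0
  have hηR : ∀ t, R < t → η t = 0 := fun t ht => by
    by_contra h
    have h1 := hR (subset_tsupport η h)
    rw [Metric.mem_closedBall, dist_zero_right, Real.norm_eq_abs] at h1
    linarith [le_abs_self t]
  have hηcont : Continuous η := hη.continuous
  -- A test function `η` on the half line is a function of `y = (1 + t)⁻¹`. It stays continuous at
  -- `y = 0`, that is at `t = ∞`, because `η` has compact support.
  have hg : ContinuousOn (fun y : ℝ => η (y⁻¹ - 1)) (Set.Icc 0 1) := by
    intro y hy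
    rcases eq_or_lt_of_le hy.1 with rfl | hy0
    · have hev : ∀ᶠ y in 𝓝[Set.Icc 0 1] (0 : ℝ), η (y⁻¹ - 1) = 0 := by
        have hn : Set.Iio ((|R| + 2)⁻¹) ∈ 𝓝 (0 : ℝ) := Iio_mem_nhds (by positivity)
        filter_upwards [self_mem_nhdsWithin, mem_nhdsWithin_of_mem_nhds hn] with y hy hy2
        rcases eq_or_lt_of_le hy.1 with rfl | hy0
        · exact hη0 _ (by norm_num)
        · refine hηR _ ?_
          have h1 : |R| + 2 < y⁻¹ := by
            rw [lt_inv_comm₀ (by positivity) hy0]; exact hy2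
          linarith [le_abs_self R]
      -- By the convention `0⁻¹ = 0` the value at `y = 0` is `η (-1) = 0`, which agrees with the
      -- limit.
      have h0' : η ((0 : ℝ)⁻¹ - 1) = 0 := hη0 _ (by norm_num)
      refine Tendsto.congr' (hev.mono fun y hy => hy.symm) ?_
      simp only [h0']
      exact tendsto_const_nhds
    · refine ContinuousAt.continuousWithinAt ?_
      exact hηcont.continuousAt.comp ((continuousAt_inv₀ hy0.ne').sub continuousAt_const)
  have heq : ∀ t, η (((1 + t)⁻¹)⁻¹ - 1) • ψ t = η t • ψ t := fun t => by
    rw [inv_inv, add_sub_cancel_left]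
  have h := hcont _ hg (by
    simp only [heq]
    obtain ⟨C, hC⟩ := hηc.exists_bound_of_continuous hηcont
    exact hψi.bdd_smul C hηcont.aestronglyMeasurable (Eventually.of_forall hC))
  simpa only [heq] using h

end

/-! ### The decomposition of the elements of `Ψ` -/

theorem nMinus_apply_eq_zero (u : nMinus) {x : ℝ} (hx : 0 ≤ x) : u.1.1 x = 0 := by
  by_contra h
  exact absurd (u.2 x h) (not_lt.2 hx)

/-- To the right of the support there is no singularity: `u (t + s)` vanishes, `u (t - s)`
contributes only for `s > t`, and `s = t + y` produces the Stieltjes kernel. -/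
theorem symHilbert_of_pos {u : 𝓢(ℝ, ℂ)} (hu : ∀ x ≥ 0, u x = 0) {t : ℝ} (ht : 0 < t) :
    symHilbert u t = -(1 / (Real.pi : ℂ)) * ∫ y in Set.Ioi (0 : ℝ), (t + y)⁻¹ • u (-y) := by
  have h1 : ∫ s in Set.Ioi (0 : ℝ), symKernel u t s =
      ∫ s in Set.Ioi t, -((s : ℝ)⁻¹ • u (t - s)) := by
    rw [← integral_indicator measurableSet_Ioi, ← integral_indicator measurableSet_Ioi]
    congr 1; ext s
    simp only [Set.indicator, Set.mem_Ioi, symKernel]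
    rcases lt_or_ge 0 s with hs | hs
    · rw [if_pos hs, hu (t + s) (by linarith)]
      split_ifs with h
      · simp [Complex.real_smul, div_eq_inv_mul]
      · rw [hu (t - s) (by linarith)]; simp
    · rw [if_neg (not_lt.2 hs), if_neg (not_lt.2 (hs.trans ht.le))]
  have h2 := (measurePreserving_add_left volume t).setIntegral_preimage_emb
      (MeasurableEquiv.addLeft t).measurableEmbedding
      (fun s : ℝ => -((s : ℝ)⁻¹ • u (t - s))) (Set.Ioi t)
  rw [symHilbert, h1, ← h2]
  simp [integral_neg]

theorem projPlus_apply (u : vanishingMoments) (x : ℝ) :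
    projPlus u x = 1 / 2 * (u.1 x + Complex.I * hilbertTransform u x) := by
  simp [projPlus, mul_add]

theorem projMinus_apply (u : vanishingMoments) (x : ℝ) :
    projMinus u x = 1 / 2 * (u.1 x - Complex.I * hilbertTransform u x) := by
  simp [projMinus, sub_apply]

theorem hilbertTransform_apply (u : vanishingMoments) (x : ℝ) :
    hilbertTransform u x = symHilbert u.1 x := by
  rw [← hilbertPV_eq]; rfl

/-- Injectivity of the Stieltjes transform gives vanishing almost everywhere on the negative half
line; continuity removes the exceptional set. -/
theorem eq_zero_of_hilbertTransform_eq_zero (u : nMinus)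
    (hu : ∀ t > 0, hilbertTransform u.1 t = 0) : u = 0 := by
  have hu0 : ∀ x ≥ 0, u.1.1 x = 0 := fun x hx => nMinus_apply_eq_zero u hx
  have hc : Continuous fun y : ℝ => u.1.1 (-y) := u.1.1.continuous.comp continuous_neg
  have hi : Integrable fun y : ℝ => u.1.1 (-y) := (u.1.1.integrable (μ := volume)).comp_neg
  have h := ae_eq_zero_of_stieltjes_eq_zero (φ := fun y : ℝ => u.1.1 (-y))
    hc.aestronglyMeasurable
    (by
      refine (hi.norm.integrableOn (s := Set.Ioi 0)).mono'
        (aestronglyMeasurable_inv_smul hc.aestronglyMeasurable _) ?_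
      filter_upwards [ae_restrict_mem measurableSet_Ioi] with t ht
      have ht0 : 0 < t := ht
      rw [norm_smul, Real.norm_eq_abs, abs_of_pos (by positivity)]
      exact mul_le_of_le_one_left (norm_nonneg _) (inv_le_one_of_one_le₀ (by linarith)))
    (fun x hx => by
      have h1 := hu x hx
      rw [hilbertTransform_apply, symHilbert_of_pos hu0 hx, mul_eq_zero] at h1
      exact h1.resolve_left (by simp [Real.pi_ne_zero]))
  have h2 : Set.EqOn (fun y : ℝ => u.1.1 (-y)) 0 (Set.Ioi 0) :=
    Measure.eqOn_open_of_ae_eq (μ := volume) h isOpen_Ioi hc.continuousOn continuousOn_const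
  refine Subtype.ext (Subtype.ext (SchwartzMap.ext fun x => ?_))
  rcases lt_or_ge x 0 with hx | hx
  · have h3 := h2 (x := -x) (neg_pos.2 hx)
    simpa using h3
  · exact hu0 x hx

/-- The difference `h - g` enters locally and the sum `g + h` only through `ℍ`. This separates the
two unknowns in the uniqueness proof and the two orthogonality relations in the density proof. -/
theorem toSchwartz_ofPair_apply (g h : nMinus) (x : ℝ) :
    Psi.toSchwartz (Psi.ofPair (g, h)) x =
      1 / 2 * (Complex.I * (h - g : nMinus).1.1 x + hilbertTransform (g + h : nMinus).1 x) := by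
  have h1 : hilbertTransform (g + h : nMinus).1 = hilbertTransform g.1 + hilbertTransform h.1 :=
    map_add hilbertTransform g.1 h.1
  have h2 : (h - g : nMinus).1.1 = h.1.1 - g.1.1 := rfl
  rw [Psi.toSchwartz_ofPair, h1, h2]
  simp only [add_apply, smul_apply, sub_apply, projPlus_apply, projMinus_apply, smul_eq_mul]
  linear_combination (-(1 / 2) * hilbertTransform g.1 x - 1 / 2 * hilbertTransform h.1 x) * Complex.I_sq

/-- On the positive half line only `ℍ(g + h)` survives, so `g + h = 0`; what remains is `i(h - g) =
0`. -/
theorem ofPair_injective : Function.Injective Psi.ofPair := by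
  rw [← LinearMap.ker_eq_bot, LinearMap.ker_eq_bot']
  rintro ⟨g, h⟩ hgh
  have h0 : ∀ x, Complex.I * (h - g : nMinus).1.1 x + hilbertTransform (g + h : nMinus).1 x = 0 := by
    intro x
    have h1 := toSchwartz_ofPair_apply g h x
    rw [hgh, map_zero] at h1
    have h2 : (0 : 𝓢(ℝ, ℂ)) x = 0 := rfl
    rw [h2] at h1
    linear_combination -2 * h1
  have hs : g + h = 0 := eq_zero_of_hilbertTransform_eq_zero _ fun t ht => by
    have h1 := h0 t
    rwa [nMinus_apply_eq_zero _ ht.le, mul_zero, zero_add] at h1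
  have hd : h - g = 0 := by
    refine Subtype.ext (Subtype.ext (SchwartzMap.ext fun x => ?_))
    have h1 := h0 x
    rw [hs, show ((0 : nMinus) : vanishingMoments) = 0 from rfl, map_zero,
      show (0 : 𝓢(ℝ, ℂ)) x = 0 from rfl, add_zero] at h1
    exact (mul_eq_zero.1 h1).resolve_left Complex.I_ne_zero
  have hhg : h = g := sub_eq_zero.1 hd
  rw [hhg, ← two_smul ℂ, smul_eq_zero] at hs
  have hg : g = 0 := hs.resolve_left two_ne_zero
  rw [hhg, hg]; rfl

theorem pushSeminorm_apply {V W : Type*} [AddCommGroup V] [Module ℂ V] [AddCommGroup W]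
    [Module ℂ W] {T : V →ₗ[ℂ] W} (hT : Function.Surjective T) (hi : Function.Injective T)
    (q : Seminorm ℂ V) (v : V) : pushSeminorm T hT q (T v) = q v := by
  change (⨅ w : {w : V // T w = T v}, q w.1) = q v
  have h : ∀ w : {w : V // T w = T v}, q w.1 = q v := fun w => by rw [hi w.2]
  have : Nonempty {w : V // T w = T v} := ⟨⟨v, rfl⟩⟩
  rw [iInf_congr h, ciInf_const]

theorem psiNorm_ofPair (n : ℕ) (gh : nMinus × nMinus) :
    psiNorm n (Psi.ofPair gh) = pairNorm n gh :=
  pushSeminorm_apply _ ofPair_injective _ _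

/-! ### Continuity of the Hilbert transform at a point -/

/-- The bound of `symKernel_bound` with its constant expressed by a norm of `f`, as continuity of `f
↦ ℍf(t)` requires. The mean value inequality handles `s ≤ 1`, the decay of `f` handles `s ≥ 1`. -/
theorem norm_symKernel_le (f : 𝓢(ℝ, ℂ)) {t s : ℝ} (hs : 0 < s) :
    ‖symKernel f t s‖ ≤ 16 * schwartzNorm 4 f * (1 + t ^ 2) * (1 + s ^ 2)⁻¹ := by
  set A := 2 * schwartzNorm 4 f with hA
  have hA0 : 0 ≤ A := by positivity
  have hA' : ∀ x : ℝ, ‖f x‖ ≤ A * (1 + x ^ 2)⁻¹ := fun x => by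
    have h1 := one_add_sq_mul_norm_le 0 f x
    have h2 := schwartzNorm_mono (show 3 + 0 ≤ 4 by omega) f
    rw [iteratedDeriv_zero] at h1
    rw [← div_eq_mul_inv, le_div_iff₀ (by positivity)]
    linarith
  have hB' : ∀ x : ℝ, ‖deriv f x‖ ≤ A := fun x => by
    have h1 := one_add_sq_mul_norm_le 1 f x
    rw [iteratedDeriv_one] at h1
    nlinarith [norm_nonneg (deriv f x), sq_nonneg x]
  have key : ‖symKernel f t s‖ ≤ 8 * A * (1 + t ^ 2) * (1 + s ^ 2)⁻¹ := by
    rw [symKernel, norm_div, Complex.norm_real, Real.norm_eq_abs, abs_of_pos hs]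
    have h6 : 0 ≤ A * (1 + t ^ 2) * (1 + s ^ 2)⁻¹ := by positivity
    rcases le_total s 1 with h | h
    · have hlip : ‖f (t + s) - f (t - s)‖ ≤ A * ‖(t + s) - (t - s)‖ :=
        Convex.norm_image_sub_le_of_norm_hasDerivWithin_le (s := Set.univ)
          (fun x _ => (f.hasDerivAt x).hasDerivWithinAt) (fun x _ => hB' x) convex_univ
          (Set.mem_univ _) (Set.mem_univ _)
      have h2 : ‖(t + s) - (t - s)‖ = 2 * s := by
        rw [show (t + s) - (t - s) = 2 * s by ring, Real.norm_eq_abs, abs_of_pos (by positivity)]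
      rw [h2] at hlip
      have h3 : ‖f (t + s) - f (t - s)‖ / s ≤ 2 * A := by
        rw [div_le_iff₀ hs]; linarith
      have h4 : (1 : ℝ) ≤ 2 * (1 + s ^ 2)⁻¹ := by
        rw [← div_eq_mul_inv, le_div_iff₀ (by positivity)]; nlinarith
      have h5 : (1 : ℝ) ≤ 2 * (1 + s ^ 2)⁻¹ * (1 + t ^ 2) := by nlinarith [sq_nonneg t]
      nlinarith
    · have h1 := (hA' (t + s)).trans (mul_le_mul_of_nonneg_left (one_add_sq_inv_le t s) hA0)
      have h2 := (hA' (t - s)).trans (mul_le_mul_of_nonneg_left (by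
        simpa [sub_eq_add_neg] using one_add_sq_inv_le t (-s)) hA0)
      have h3 : ‖f (t + s) - f (t - s)‖ / s ≤ ‖f (t + s)‖ + ‖f (t - s)‖ :=
        (div_le_self (norm_nonneg _) h).trans (norm_sub_le _ _)
      nlinarith
  rw [hA] at key
  linarith

theorem tendsto_symHilbert {f : ℕ → 𝓢(ℝ, ℂ)} {F : 𝓢(ℝ, ℂ)} (hF : Tendsto f atTop (𝓝 F)) (t : ℝ) :
    Tendsto (fun k => symHilbert (f k) t) atTop (𝓝 (symHilbert F t)) := by
  rw [tendsto_iff_norm_sub_tendsto_zero]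
  set K := ∫ s in Set.Ioi (0 : ℝ), (1 + s ^ 2)⁻¹ with hK
  have h1 := (tendsto_schwartzNorm_sub hF 4).const_mul
    (‖(1 / (Real.pi : ℂ))‖ * (16 * (1 + t ^ 2) * K))
  rw [mul_zero] at h1
  refine squeeze_zero (fun k => norm_nonneg _) (fun k => ?_) h1
  have h2 : symHilbert (f k) t - symHilbert F t = symHilbert (f k - F : 𝓢(ℝ, ℂ)) t := by
    have h3 := symHilbert_add (f k - F) F t
    rw [sub_add_cancel] at h3
    rw [h3, add_sub_cancel_right]
  rw [h2, symHilbert, norm_mul, mul_assoc]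
  refine mul_le_mul_of_nonneg_left ?_ (norm_nonneg _)
  have h4 : ‖∫ s in Set.Ioi (0 : ℝ), symKernel (f k - F : 𝓢(ℝ, ℂ)) t s‖ ≤
      ∫ s in Set.Ioi (0 : ℝ), 16 * schwartzNorm 4 (f k - F) * (1 + t ^ 2) * (1 + s ^ 2)⁻¹ := by
    refine norm_integral_le_of_norm_le (integrable_inv_one_add_sq.const_mul _).integrableOn ?_
    filter_upwards [ae_restrict_mem measurableSet_Ioi] with s hs
    exact norm_symKernel_le _ hs
  rw [integral_const_mul] at h4
  refine h4.trans_eq ?_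
  ring

theorem tendsto_apply {f : ℕ → 𝓢(ℝ, ℂ)} {F : 𝓢(ℝ, ℂ)} (hF : Tendsto f atTop (𝓝 F)) (x : ℝ) :
    Tendsto (fun k => f k x) atTop (𝓝 (F x)) := by
  rw [tendsto_iff_norm_sub_tendsto_zero]
  exact squeeze_zero (fun k => norm_nonneg _)
    (fun k => norm_apply_le_schwartzNorm (f k - F) x) (tendsto_schwartzNorm_sub hF 1)

theorem isClosed_vanishingMoments : IsClosed (vanishingMoments : Set 𝓢(ℝ, ℂ)) := by
  have h : (vanishingMoments : Set 𝓢(ℝ, ℂ)) =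
      ⋂ n : ℕ, {f | SchwartzMap.integralCLM ℂ volume (mulX^[n] f) = 0} := by
    ext f
    simp only [Set.mem_iInter, Set.mem_ofPred_eq, SchwartzMap.integralCLM_apply, mulX_pow_apply]
    rfl
  rw [h]
  exact isClosed_iInter fun n => isClosed_eq
    ((SchwartzMap.integralCLM ℂ volume).continuous.comp (mulX.continuous.iterate n))
    continuous_const

/-! ### `Ψ` is a nuclear Fréchet space -/

/-- The map `g ↦ -iP₊g` on `𝒩₋`. -/
def upperPart : nMinus →ₗ[ℂ] 𝓢(ℝ, ℂ) := ((-Complex.I) • projPlus).comp nMinus.subtype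

/-- The map `g ↦ iP₋g` on `𝒩₋`. -/
def lowerPart : nMinus →ₗ[ℂ] 𝓢(ℝ, ℂ) := (Complex.I • projMinus).comp nMinus.subtype

theorem upperPart_apply (g : nMinus) (x : ℝ) :
    upperPart g x = -Complex.I * (1 / 2 * (g.1.1 x + Complex.I * symHilbert g.1.1 x)) := by
  rw [← hilbertTransform_apply, ← projPlus_apply]; rfl

theorem lowerPart_apply (g : nMinus) (x : ℝ) :
    lowerPart g x = Complex.I * (1 / 2 * (g.1.1 x - Complex.I * symHilbert g.1.1 x)) := by
  rw [← hilbertTransform_apply, ← projMinus_apply]; rfl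

theorem pairNorm_sq_eq (n : ℕ) (gh : nMinus × nMinus) :
    pairNorm n gh ^ 2 = schwartzNorm n (upperPart gh.1) ^ 2 + schwartzNorm n (lowerPart gh.2) ^ 2
      + schwartzNorm n (lowerPart gh.1) ^ 2 + schwartzNorm n (upperPart gh.2) ^ 2 :=
  pairNorm_sq n gh.1 gh.2

/-- Since `P₊ + P₋ = I`, convergence of both parts in the Schwartz space yields convergence of `g`
itself. Continuity of `ℍ` into the Schwartz space is not needed: pointwise continuity suffices to
recognize the limits as the two parts of `G`. -/
theorem exists_nMinus_limit (g : ℕ → nMinus)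
    (ha : ∀ n : ℕ, ∀ ε > 0, ∃ N, ∀ k ≥ N, ∀ l ≥ N, schwartzNorm n (upperPart (g k - g l)) < ε)
    (hb : ∀ n : ℕ, ∀ ε > 0, ∃ N, ∀ k ≥ N, ∀ l ≥ N, schwartzNorm n (lowerPart (g k - g l)) < ε) :
    ∃ G : nMinus, ∀ n : ℕ, Tendsto (fun k => schwartzNorm n (upperPart (g k - G))) atTop (𝓝 0) ∧
      Tendsto (fun k => schwartzNorm n (lowerPart (g k - G))) atTop (𝓝 0) := by
  simp only [map_sub] at ha hb ⊢
  obtain ⟨a, ha⟩ := exists_tendsto_of_cauchy_schwartzNorm _ ha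
  obtain ⟨b, hb⟩ := exists_tendsto_of_cauchy_schwartzNorm _ hb
  have hrec : ∀ k, (g k).1.1 = Complex.I • upperPart (g k) - Complex.I • lowerPart (g k) := by
    intro k
    ext x
    simp only [sub_apply, smul_apply, smul_eq_mul, upperPart_apply, lowerPart_apply]
    linear_combination (g k).1.1 x * Complex.I_sq
  have hlim : Tendsto (fun k => (g k).1.1) atTop (𝓝 (Complex.I • a - Complex.I • b)) := by
    simp only [hrec]
    exact (ha.const_smul Complex.I).sub (hb.const_smul Complex.I)
  set F : 𝓢(ℝ, ℂ) := Complex.I • a - Complex.I • b with hF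
  let G : nMinus := ⟨⟨F, isClosed_vanishingMoments.mem_of_tendsto hlim
      (Eventually.of_forall fun k => (g k).1.2)⟩, fun x hx => by
    by_contra hx0
    refine hx (tendsto_nhds_unique (tendsto_apply hlim x) ?_)
    simp only [nMinus_apply_eq_zero _ (not_lt.1 hx0)]
    exact tendsto_const_nhds⟩
  have hGa : upperPart G = a := by
    ext x
    refine tendsto_nhds_unique ?_ (tendsto_apply ha x)
    simp only [upperPart_apply]
    exact (((tendsto_apply hlim x).add
      ((tendsto_symHilbert hlim x).const_mul _)).const_mul _).const_mul _
  have hGb : lowerPart G = b := by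
    ext x
    refine tendsto_nhds_unique ?_ (tendsto_apply hb x)
    simp only [lowerPart_apply]
    exact (((tendsto_apply hlim x).sub
      ((tendsto_symHilbert hlim x).const_mul _)).const_mul _).const_mul _
  refine ⟨G, fun n => ⟨?_, ?_⟩⟩
  · rw [hGa]; exact tendsto_schwartzNorm_sub ha n
  · rw [hGb]; exact tendsto_schwartzNorm_sub hb n

/-! ### The Fréchet topology of `Ψ`. -/

instance : IsUniformAddGroup Psi := isUniformAddGroup_of_addCommGroup

instance : ContinuousSMul ℂ Psi := psi_withSeminorms.continuousSMul

instance : FirstCountableTopology Psi := psi_withSeminorms.firstCountableTopology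

instance : (uniformity Psi).IsCountablyGenerated :=
  IsUniformAddGroup.uniformity_countably_generated

theorem pairNorm_mono : Monotone pairNorm := by
  intro m n hmn gh
  refine le_of_sq_le_sq ?_ (apply_nonneg _ _)
  rw [pairNorm_sq_eq, pairNorm_sq_eq]
  gcongr <;> exact schwartzNorm_mono hmn _

theorem psiNorm_mono : Monotone psiNorm := by
  intro m n hmn f
  obtain ⟨gh, rfl⟩ := Psi.ofPair_surjective f
  rw [psiNorm_ofPair, psiNorm_ofPair]
  exact pairNorm_mono hmn gh

theorem upperPart_le_pairNorm (n : ℕ) (gh : nMinus × nMinus) :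
    schwartzNorm n (upperPart gh.1) ≤ pairNorm n gh ∧
    schwartzNorm n (lowerPart gh.2) ≤ pairNorm n gh ∧
    schwartzNorm n (lowerPart gh.1) ≤ pairNorm n gh ∧
    schwartzNorm n (upperPart gh.2) ≤ pairNorm n gh := by
  have h := pairNorm_sq_eq n gh
  refine ⟨?_, ?_, ?_, ?_⟩ <;> refine le_of_sq_le_sq ?_ (apply_nonneg _ _) <;> rw [h] <;>
    nlinarith [sq_nonneg (schwartzNorm n (upperPart gh.1)),
      sq_nonneg (schwartzNorm n (lowerPart gh.2)), sq_nonneg (schwartzNorm n (lowerPart gh.1)),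
      sq_nonneg (schwartzNorm n (upperPart gh.2))]

theorem norm_toL2_le (f : Psi) : ‖Psi.toL2 f‖ ≤ 2 * psiNorm 0 f := by
  obtain ⟨gh, rfl⟩ := Psi.ofPair_surjective f
  obtain ⟨h1, h2, -, -⟩ := upperPart_le_pairNorm 0 gh
  have h3 : Psi.toSchwartz (Psi.ofPair gh) = upperPart gh.1 + lowerPart gh.2 := rfl
  rw [psiNorm_ofPair]
  change schwartzNorm 0 (Psi.toSchwartz (Psi.ofPair gh)) ≤ _
  rw [h3]
  linarith [map_add_le_add (schwartzNorm 0) (upperPart gh.1) (lowerPart gh.2)]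

theorem toL2_injective : Function.Injective Psi.toL2 := by
  have h1 : Function.Injective schwartzToL2 := SchwartzMap.injective_toLp 2 volume
  exact h1.comp Subtype.val_injective

theorem continuous_toL2 : Continuous Psi.toL2 := by
  have h : Continuous ((normSeminorm ℂ L2).comp Psi.toL2) :=
    Seminorm.continuous_of_le (q := (2 : NNReal) • psiNorm 0)
      ((psi_withSeminorms.continuous_seminorm 0).const_smul (2 : NNReal)) fun f => by
        simpa [NNReal.smul_def] using norm_toL2_le f
  refine continuous_of_continuousAt_zero Psi.toL2.toAddMonoidHom ?_
  have h0 := h.tendsto 0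
  rw [map_zero] at h0
  change Tendsto Psi.toL2 (𝓝 0) (𝓝 (Psi.toL2 0))
  rw [map_zero]
  exact tendsto_zero_iff_norm_tendsto_zero.2 h0

instance : T1Space Psi := psi_withSeminorms.T1_of_separating fun f hf => by
  refine ⟨0, fun h => hf (toL2_injective ?_)⟩
  rw [map_zero, ← norm_le_zero_iff]
  simpa [h] using norm_toL2_le f

/-- The uniformity is countably generated, so sequences suffice. A Cauchy sequence lifts to pairs
with the same norms, and `pairNorm` dominates all four parts needed by `exists_nMinus_limit`. -/
instance : CompleteSpace Psi := by
  refine UniformSpace.complete_of_cauchySeq_tendsto fun u hu => ?_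
  choose gh hgh using fun k => Psi.ofPair_surjective (u k)
  have hc : ∀ n : ℕ, ∀ ε > 0, ∃ N, ∀ k ≥ N, ∀ l ≥ N, pairNorm n (gh k - gh l) < ε := by
    intro n ε hε
    have hV : {x : Psi × Psi | psiNorm n (x.2 - x.1) < ε} ∈ uniformity Psi := by
      rw [uniformity_eq_comap_nhds_zero Psi]
      have h0 : {x : Psi | psiNorm n x < ε} ∈ 𝓝 (0 : Psi) :=
        (isOpen_lt (psi_withSeminorms.continuous_seminorm n) continuous_const).mem_nhds
          (by simpa using hε)
      exact ⟨_, h0, fun x hx => hx⟩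
    obtain ⟨N, hN⟩ := cauchySeq_iff.1 hu _ hV
    refine ⟨N, fun k hk l hl => ?_⟩
    have h := hN l hl k hk
    rw [Set.mem_ofPred_eq, ← hgh, ← hgh, ← map_sub, psiNorm_ofPair] at h
    exact h
  have hcomp : ∀ L : (nMinus × nMinus) →ₗ[ℂ] 𝓢(ℝ, ℂ),
      (∀ n x, schwartzNorm n (L x) ≤ pairNorm n x) → ∀ n : ℕ, ∀ ε > 0, ∃ N, ∀ k ≥ N, ∀ l ≥ N,
        schwartzNorm n (L (gh k - gh l)) < ε := fun L hL n ε hε => by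
    obtain ⟨N, hN⟩ := hc n ε hε
    exact ⟨N, fun k hk l hl => (hL n _).trans_lt (hN k hk l hl)⟩
  obtain ⟨G, hG⟩ := exists_nMinus_limit (fun k => (gh k).1)
    (hcomp (upperPart.comp (LinearMap.fst ℂ _ _)) fun n x => (upperPart_le_pairNorm n x).1)
    (hcomp (lowerPart.comp (LinearMap.fst ℂ _ _)) fun n x => (upperPart_le_pairNorm n x).2.2.1)
  obtain ⟨H, hH⟩ := exists_nMinus_limit (fun k => (gh k).2)
    (hcomp (upperPart.comp (LinearMap.snd ℂ _ _)) fun n x => (upperPart_le_pairNorm n x).2.2.2)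
    (hcomp (lowerPart.comp (LinearMap.snd ℂ _ _)) fun n x => (upperPart_le_pairNorm n x).2.1)
  refine ⟨Psi.ofPair (G, H), ?_⟩
  rw [psi_withSeminorms.tendsto_nhds_atTop]
  intro n ε hε
  have h1 : Tendsto (fun k => pairNorm n (gh k - (G, H)) ^ 2) atTop (𝓝 0) := by
    simp only [pairNorm_sq_eq]
    simpa using ((((hG n).1.pow 2).add ((hH n).2.pow 2)).add ((hG n).2.pow 2)).add ((hH n).1.pow 2)
  have h2 : ∀ᶠ k in atTop, pairNorm n (gh k - (G, H)) ^ 2 < ε ^ 2 :=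
    h1.eventually (gt_mem_nhds (by positivity))
  obtain ⟨N, hN⟩ := eventually_atTop.1 h2
  refine ⟨N, fun k hk => ?_⟩
  rw [← hgh, ← map_sub, psiNorm_ofPair]
  exact lt_of_pow_lt_pow_left₀ 2 hε.le (hN k hk)

theorem isFrechetSpace_psi : IsFrechetSpace Psi where
  uniformAddGroup := inferInstance
  continuousSMul := inferInstance
  locallyConvex := psi_withSeminorms.toLocallyConvexSpace
  metrizable := UniformSpace.metrizableSpace
  complete := inferInstance

/-! ### Nuclearity of `Ψ`. -/

theorem pairNorm_eq (n : ℕ) : pairNorm n =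
    l2add (l2add (l2add ((schwartzNorm n).comp (upperPart.comp (LinearMap.fst ℂ nMinus nMinus)))
      ((schwartzNorm n).comp (lowerPart.comp (LinearMap.snd ℂ nMinus nMinus))))
      ((schwartzNorm n).comp (lowerPart.comp (LinearMap.fst ℂ nMinus nMinus))))
      ((schwartzNorm n).comp (upperPart.comp (LinearMap.snd ℂ nMinus nMinus))) := rfl

theorem squareSumDominated_pairNorm (n : ℕ) :
    SquareSumDominated (pairNorm n) (pairNorm (n + 5)) := by
  have h : ∀ L : (nMinus × nMinus) →ₗ[ℂ] 𝓢(ℝ, ℂ),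
      (∀ x, schwartzNorm (n + 5) (L x) ≤ pairNorm (n + 5) x) →
      SquareSumDominated ((schwartzNorm n).comp L) (pairNorm (n + 5)) := fun L hL =>
    ((squareSumDominated_schwartzNorm n).comp L).mono hL
  have h1 := h (upperPart.comp (LinearMap.fst ℂ nMinus nMinus)) fun x =>
    (upperPart_le_pairNorm (n + 5) x).1
  have h2 := h (lowerPart.comp (LinearMap.snd ℂ nMinus nMinus)) fun x =>
    (upperPart_le_pairNorm (n + 5) x).2.1
  have h3 := h (lowerPart.comp (LinearMap.fst ℂ nMinus nMinus)) fun x =>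
    (upperPart_le_pairNorm (n + 5) x).2.2.1
  have h4 := h (upperPart.comp (LinearMap.snd ℂ nMinus nMinus)) fun x =>
    (upperPart_le_pairNorm (n + 5) x).2.2.2
  rw [pairNorm_eq n]
  exact ((h1.l2add h2).l2add h3).l2add h4

theorem squareSumDominated_psiNorm (n : ℕ) :
    SquareSumDominated (psiNorm n) (psiNorm (n + 5)) := by
  let e : (nMinus × nMinus) ≃ₗ[ℂ] Psi :=
    LinearEquiv.ofBijective Psi.ofPair ⟨ofPair_injective, Psi.ofPair_surjective⟩
  have he : ∀ m, psiNorm m = (pairNorm m).comp e.symm.toLinearMap := fun m => by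
    ext f
    obtain ⟨gh, rfl⟩ := e.surjective f
    rw [Seminorm.comp_apply, LinearEquiv.coe_coe, e.symm_apply_apply]
    exact psiNorm_ofPair m gh
  rw [he, he]
  exact (squareSumDominated_pairNorm n).comp _

theorem SquareSumDominated.of_le {E : Type*} [AddCommGroup E] [Module ℂ E] {p p' q : Seminorm ℂ E}
    (h : SquareSumDominated p q) {C : ℝ} (hp : ∀ x, p' x ≤ C * p x) : SquareSumDominated p' q := by
  obtain ⟨l, c, hc, hl, hpl⟩ := h
  refine ⟨fun k => (C : ℂ) • l k, fun k => |C| * c k, hc.mul_left _, fun k x => ?_, fun x => ?_⟩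
  · rw [LinearMap.smul_apply, norm_smul, Complex.norm_real, Real.norm_eq_abs, mul_assoc]
    exact mul_le_mul_of_nonneg_left (hl k x) (abs_nonneg _)
  · simp only [LinearMap.smul_apply, norm_smul, Complex.norm_real, Real.norm_eq_abs, mul_pow,
      sq_abs, tsum_mul_left]
    calc p' x ^ 2 ≤ (C * p x) ^ 2 := pow_le_pow_left₀ (apply_nonneg _ _) (hp x) 2
      _ = C ^ 2 * p x ^ 2 := by ring
      _ ≤ _ := mul_le_mul_of_nonneg_left (hpl x) (sq_nonneg _)

theorem isNuclearSpace_psi : IsNuclearSpace Psi := by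
  intro p hp
  obtain ⟨s, C, -, hC⟩ := Seminorm.bound_of_continuous psi_withSeminorms p hp
  obtain ⟨N, hN⟩ : ∃ N, s.sup psiNorm ≤ psiNorm N := by
    obtain ⟨N, hN⟩ := s.exists_le
    exact ⟨N, Finset.sup_le fun i hi => psiNorm_mono (hN i hi)⟩
  have hpN : ∀ x, p x ≤ (C : ℝ) * psiNorm N x := fun x =>
    (hC x).trans (mul_le_mul_of_nonneg_left (hN x) C.2)
  -- The maximum with `p` is taken because the definition of nuclearity asks for `p ≤ q`.
  have h : SquareSumDominated p (p ⊔ psiNorm (N + 5)) :=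
    ((squareSumDominated_psiNorm N).of_le hpN).mono (le_sup_right (a := p) (b := psiNorm (N + 5)))
  exact ⟨p ⊔ psiNorm (N + 5), hp.sup (psi_withSeminorms.continuous_seminorm (N + 5)),
    le_sup_left, h.exists_nuclear⟩

/-! ### The antidual of a barrelled space -/

section
variable {Φ : Type*} [AddCommGroup Φ] [Module ℂ Φ] [UniformSpace Φ] [IsUniformAddGroup Φ]
  [ContinuousSMul ℂ Φ]

/-- A Cauchy filter has a pointwise limit, and only its continuity is at stake. A weak* bounded set
is pointwise bounded, hence equicontinuous by Banach–Steinhaus, and pointwise limits of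
equicontinuous families are continuous. -/
theorem antiDual_exists_limit [BarrelledSpace ℂ Φ] {l : Filter (AntiDual Φ)} (hl : Cauchy l)
    {s : Set (AntiDual Φ)} (hs : Bornology.IsVonNBounded ℂ s) (hsl : s ∈ l) :
    ∃ F : AntiDual Φ, l ≤ 𝓝 F := by
  have hne : l.NeBot := hl.1
  have hu : ∀ φ : Φ, UniformContinuous fun F : AntiDual Φ => F φ := fun φ =>
    (Pi.uniformContinuous_proj _ φ).comp
      (PointwiseConvergenceCLM.isUniformEmbedding_coeFn (starRingEnd ℂ) Φ ℂ).uniformContinuous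
  choose L hL using fun φ => CompleteSpace.complete (hl.map (hu φ))
  have hL' : Tendsto (fun (F : AntiDual Φ) (φ : Φ) => F φ) l (𝓝 L) :=
    tendsto_pi_nhds.2 fun φ => hL φ
  have he : UniformEquicontinuous (DFunLike.coe ∘ fun F : s => (F.1 : Φ →SL[starRingEnd ℂ] ℂ)) := by
    refine PolynormableSpace.banach_steinhaus (𝕜₁ := ℂ) (𝕜₂ := ℂ) fun φ => ?_
    refine (hs.image (PointwiseConvergenceCLM.evalCLM (starRingEnd ℂ) ℂ φ)).subset ?_
    rintro _ ⟨F, rfl⟩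
    exact ⟨F.1, F.2, rfl⟩
  have hne' : (comap (Subtype.val : s → AntiDual Φ) l).NeBot :=
    comap_coe_neBot_of_le_principal (le_principal_iff.2 hsl)
  have hc : Continuous L := (hL'.comp tendsto_comap).continuous_of_equicontinuous he.equicontinuous
  let F : AntiDual Φ :=
    { toLinearMap := linearMapOfTendsto L (fun F : AntiDual Φ => (F.toLinearMap)) hL'
      cont := hc }
  refine ⟨F, ?_⟩
  exact (PointwiseConvergenceCLM.tendsto_iff_forall_tendsto (a := id) (a₀ := F)).2 hL

theorem antiDual_quasiComplete [BarrelledSpace ℂ Φ] {s : Set (AntiDual Φ)} (hs : IsClosed s)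
    (hb : Bornology.IsVonNBounded ℂ s) : IsComplete s := by
  intro l hl hls
  obtain ⟨F, hF⟩ := antiDual_exists_limit hl hb (le_principal_iff.1 hls)
  have hne : l.NeBot := hl.1
  exact ⟨F, hs.mem_of_tendsto (f := id) hF (le_principal_iff.1 hls), hF⟩

/-- No boundedness has to be assumed: a pointwise convergent sequence is pointwise bounded, so
Banach–Steinhaus applies to it. -/
theorem antiDual_seqComplete [BarrelledSpace ℂ Φ] {u : ℕ → AntiDual Φ} (hu : CauchySeq u) :
    ∃ F : AntiDual Φ, Tendsto u atTop (𝓝 F) := by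
  have h : ∀ φ : Φ, ∃ y, Tendsto (fun n => u n φ) atTop (𝓝 y) := fun φ =>
    cauchySeq_tendsto_of_complete
      (hu.map ((Pi.uniformContinuous_proj _ φ).comp
        (PointwiseConvergenceCLM.isUniformEmbedding_coeFn (starRingEnd ℂ) Φ ℂ).uniformContinuous))
  choose L hL using h
  let F : AntiDual Φ := continuousLinearMapOfTendsto (𝕜₁ := ℂ) (𝕜₂ := ℂ)
    (fun n => (u n : Φ →SL[starRingEnd ℂ] ℂ)) (tendsto_pi_nhds.2 hL)
  exact ⟨F, PointwiseConvergenceCLM.tendsto_iff_forall_tendsto.2 hL⟩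

end

/-! ### The embedding of `H` in the antidual. -/

section
variable {Φ : Type*} [AddCommGroup Φ] [Module ℂ Φ] [TopologicalSpace Φ]
  {H : Type*} [NormedAddCommGroup H] [InnerProductSpace ℂ H] {j : Φ →ₗ[ℂ] H}

/-- A vector `v` as the antilinear functional `φ ↦ ⟪j φ, v⟫`. -/
def toAntiDual (hj : Continuous j) : H →ₗ[ℂ] AntiDual Φ where
  toFun v :=
    { toFun := fun φ => inner ℂ (j φ) v
      map_add' := fun φ ψ => by rw [map_add, inner_add_left]
      map_smul' := fun c φ => by rw [map_smul, inner_smul_left, smul_eq_mul]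
      cont := hj.inner continuous_const }
  map_add' v w := ContinuousLinearMap.ext fun φ => inner_add_right _ _ _
  map_smul' c v := ContinuousLinearMap.ext fun φ => inner_smul_right _ _ _

theorem toAntiDual_apply (hj : Continuous j) (v : H) (φ : Φ) :
    toAntiDual hj v φ = inner ℂ (j φ) v := rfl

theorem toAntiDual_injective (hj : Continuous j) (hd : DenseRange j) :
    Function.Injective (toAntiDual hj) := by
  intro v w h
  refine hd.eq_of_inner_right (𝕜 := ℂ) ?_
  intro φ
  exact DFunLike.congr_fun h φ

/-- Riesz representation on the finite-dimensional space `j(W)`, where continuity is automatic. `F`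
is antilinear, so its conjugate is the functional represented. -/
theorem exists_inner_eq_on [CompleteSpace H] (hji : Function.Injective j) (W : Submodule ℂ Φ)
    [FiniteDimensional ℂ W] (F : AntiDual Φ) : ∃ v : H, ∀ φ ∈ W, inner ℂ (j φ) v = F φ := by
  let e : W ≃ₗ[ℂ] W.map j := Submodule.equivMapOfInjective j hji W
  let g : W.map j →ₗ[ℂ] ℂ :=
    { toFun := fun x => starRingEnd ℂ (F (e.symm x))
      map_add' := fun x y => by simp
      map_smul' := fun c x => by
        rw [map_smul, Submodule.coe_smul, map_smulₛₗ, smul_eq_mul, map_mul, Complex.conj_conj]; rfl }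
  let w := (InnerProductSpace.toDual ℂ (W.map j)).symm (LinearMap.toContinuousLinearMap g)
  refine ⟨w, fun φ hφ => ?_⟩
  have h1 : inner ℂ w (e ⟨φ, hφ⟩) = g (e ⟨φ, hφ⟩) := by
    rw [InnerProductSpace.toDual_symm_apply]; rfl
  have h2 : inner ℂ (w : H) (j φ) = starRingEnd ℂ (F φ) := by
    have h3 : g (e ⟨φ, hφ⟩) = starRingEnd ℂ (F φ) := by
      change starRingEnd ℂ (F (e.symm (e ⟨φ, hφ⟩))) = _
      rw [LinearEquiv.symm_apply_apply]
    rw [← h3, ← h1]; rfl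
  rw [← inner_conj_symm, h2, Complex.conj_conj]

/-- A weak* neighbourhood of `F` constrains only finitely many values, and on the span of those
vectors some `v` reproduces `F` exactly. -/
theorem toAntiDual_denseRange [CompleteSpace H] (hj : Continuous j) (hji : Function.Injective j) :
    DenseRange (toAntiDual hj) := by
  intro F
  rw [mem_closure_iff_nhds]
  intro U hU
  have h := (PointwiseConvergenceCLM.isEmbedding_coeFn (starRingEnd ℂ) Φ ℂ).nhds_eq_comap F
  rw [h, mem_comap] at hU
  obtain ⟨V, hV, hVU⟩ := hU
  rw [nhds_pi, Filter.mem_pi] at hV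
  obtain ⟨I, hI, t, ht, htV⟩ := hV
  have : FiniteDimensional ℂ (Submodule.span ℂ I) := FiniteDimensional.span_of_finite ℂ hI
  obtain ⟨v, hv⟩ := exists_inner_eq_on hji (Submodule.span ℂ I) F
  refine ⟨toAntiDual hj v, hVU (htV fun φ hφ => ?_), v, rfl⟩
  have h1 : toAntiDual hj v φ = F φ := hv φ (Submodule.subset_span hφ)
  rw [h1]
  exact mem_of_mem_nhds (ht φ)

end

/-! ### Log-normal functions on the negative half line -/

/-- The function `P(log |x|) exp(-log² |x| / 2 + c log |x|)` on the negative half line,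
extended by zero. -/
def logGauss (P : Polynomial ℂ) (c : ℂ) (x : ℝ) : ℂ :=
  if x < 0 then P.eval (Real.log x : ℂ) *
    Complex.exp (-(Real.log x : ℂ) ^ 2 / 2 + c * (Real.log x : ℂ)) else 0

theorem logGauss_of_nonneg (P : Polynomial ℂ) (c : ℂ) {x : ℝ} (hx : 0 ≤ x) :
    logGauss P c x = 0 := if_neg (not_lt.2 hx)

theorem logGauss_of_neg (P : Polynomial ℂ) (c : ℂ) {x : ℝ} (hx : x < 0) :
    logGauss P c x = P.eval (Real.log x : ℂ) *
      Complex.exp (-(Real.log x : ℂ) ^ 2 / 2 + c * (Real.log x : ℂ)) := if_pos hx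

theorem cexp_log_of_neg {x : ℝ} (hx : x < 0) : Complex.exp (Real.log x : ℂ) = ((-x : ℝ) : ℂ) := by
  rw [← Complex.ofReal_exp, ← Real.log_neg_eq_log, Real.exp_log (neg_pos.2 hx)]

/-- Powers of `|x|` are absorbed into the parameter. Boundedness for every parameter therefore
yields both rapid decay at infinity and flatness at `0`. -/
theorem logGauss_add_nat (P : Polynomial ℂ) (c : ℂ) (k : ℕ) (x : ℝ) :
    logGauss P (c + k) x = (-x : ℂ) ^ k * logGauss P c x := by
  rcases lt_or_ge x 0 with hx | hx
  · have h := cexp_log_of_neg hx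
    rw [Complex.ofReal_neg] at h
    rw [logGauss_of_neg _ _ hx, logGauss_of_neg _ _ hx, ← h, ← Complex.exp_nat_mul,
      mul_left_comm, ← Complex.exp_add]
    congr 2; ring
  · rw [logGauss_of_nonneg _ _ hx, logGauss_of_nonneg _ _ hx, mul_zero]

theorem norm_cexp_logGauss (c : ℂ) (L : ℝ) :
    ‖Complex.exp (-(L : ℂ) ^ 2 / 2 + c * (L : ℂ))‖ = Real.exp (-L ^ 2 / 2 + c.re * L) := by
  rw [Complex.norm_exp]
  congr 1
  rw [show -(L : ℂ) ^ 2 / 2 + c * (L : ℂ) = ((-L ^ 2 / 2 : ℝ) : ℂ) + c * (L : ℂ) by push_cast; ring,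
    Complex.add_re, Complex.ofReal_re, Complex.re_mul_ofReal]

theorem logGauss_bounded (P : Polynomial ℂ) (c : ℂ) : ∃ K : ℝ, ∀ x, ‖logGauss P c x‖ ≤ K := by
  suffices h : ∃ K : ℝ, ∀ L : ℝ,
      ‖P.eval (L : ℂ) * Complex.exp (-(L : ℂ) ^ 2 / 2 + c * (L : ℂ))‖ ≤ K by
    obtain ⟨K, hK⟩ := h
    refine ⟨K, fun x => ?_⟩
    rcases lt_or_ge x 0 with hx | hx
    · rw [logGauss_of_neg _ _ hx]; exact hK _
    · rw [logGauss_of_nonneg _ _ hx, norm_zero]; exact (norm_nonneg _).trans (hK 0)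
  induction P using Polynomial.induction_on' with
  | add p q hp hq =>
    obtain ⟨K, hK⟩ := hp
    obtain ⟨K', hK'⟩ := hq
    refine ⟨K + K', fun L => ?_⟩
    rw [Polynomial.eval_add, add_mul]
    exact norm_add_le_of_le (hK L) (hK' L)
  | monomial n a =>
    -- With `|L|ⁿ ≤ n! exp |L|`, completing the square bounds `(1 + |Re c|)|L| - L²/2` by `(1 + |Re
    -- c|)²/2`.
    refine ⟨‖a‖ * (n.factorial * Real.exp ((1 + |c.re|) ^ 2 / 2)), fun L => ?_⟩
    rw [Polynomial.eval_monomial, norm_mul, norm_mul, norm_cexp_logGauss, mul_assoc, norm_pow,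
      Complex.norm_real, Real.norm_eq_abs]
    refine mul_le_mul_of_nonneg_left ?_ (norm_nonneg _)
    have h1 := Real.pow_div_factorial_le_exp |L| (abs_nonneg L) n
    rw [div_le_iff₀ (by positivity)] at h1
    calc |L| ^ n * Real.exp (-L ^ 2 / 2 + c.re * L)
        ≤ (Real.exp |L| * n.factorial) * Real.exp (-L ^ 2 / 2 + c.re * L) :=
          mul_le_mul_of_nonneg_right h1 (Real.exp_pos _).le
      _ = n.factorial * Real.exp (|L| + (-L ^ 2 / 2 + c.re * L)) := by rw [Real.exp_add |L| _]; ring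
      _ ≤ _ := by
          refine mul_le_mul_of_nonneg_left (Real.exp_le_exp.2 ?_) (by positivity)
          have h2 : c.re * L ≤ |c.re| * |L| := (le_abs_self _).trans_eq (abs_mul _ _)
          nlinarith [sq_nonneg (|L| - (1 + |c.re|)), sq_abs L]

theorem exists_norm_logGauss_le_sq (P : Polynomial ℂ) (c : ℂ) :
    ∃ K : ℝ, ∀ x, ‖logGauss P c x‖ ≤ K * x ^ 2 := by
  obtain ⟨K, hK⟩ := logGauss_bounded P (c - 2)
  refine ⟨K, fun x => ?_⟩
  have h := logGauss_add_nat P (c - 2) 2 x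
  rw [show c - 2 + ((2 : ℕ) : ℂ) = c by push_cast; ring] at h
  rw [h, norm_mul, norm_pow, norm_neg, Complex.norm_real, Real.norm_eq_abs, sq_abs, mul_comm]
  exact mul_le_mul_of_nonneg_right (hK x) (sq_nonneg x)

/-- The polynomial factor makes the class closed under differentiation: with `L = log|x|`, `d/dx` is
`x⁻¹ d/dL`, and `x⁻¹ = -exp(-L)` lowers `c` by one and changes the sign. At `0` the quadratic bound
gives derivative zero. -/
theorem hasDerivAt_logGauss (P : Polynomial ℂ) (c : ℂ) (x : ℝ) :
    HasDerivAt (logGauss P c)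
      (logGauss (-(P.derivative + P * (Polynomial.C c - Polynomial.X))) (c - 1) x) x := by
  rcases lt_trichotomy x 0 with hx | rfl | hx
  · have hl : HasDerivAt (fun y : ℝ => (Real.log y : ℂ)) ((x⁻¹ : ℝ) : ℂ) x :=
      (Real.hasDerivAt_log hx.ne).ofReal_comp
    have h1 : HasDerivAt (fun y : ℝ => P.eval (Real.log y : ℂ))
        (P.derivative.eval (Real.log x : ℂ) * ((x⁻¹ : ℝ) : ℂ)) x :=
      HasDerivAt.comp (h₂ := fun z => P.eval z) (h := fun y : ℝ => (Real.log y : ℂ)) x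
        (P.hasDerivAt _) hl
    have h2 : HasDerivAt (fun y : ℝ => -(Real.log y : ℂ) ^ 2 / 2 + c * (Real.log y : ℂ))
        ((c - (Real.log x : ℂ)) * ((x⁻¹ : ℝ) : ℂ)) x := by
      refine (((hl.pow 2).neg.div_const 2).add (hl.const_mul c)).congr_deriv ?_
      push_cast
      ring
    have h3 := h1.mul h2.cexp
    have he : logGauss P c =ᶠ[𝓝 x] fun y : ℝ => P.eval (Real.log y : ℂ) *
        Complex.exp (-(Real.log y : ℂ) ^ 2 / 2 + c * (Real.log y : ℂ)) := by
      filter_upwards [Iio_mem_nhds hx] with y hy using logGauss_of_neg _ _ hy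
    refine (h3.congr_of_eventuallyEq he).congr_deriv ?_
    have hx1 : ((x⁻¹ : ℝ) : ℂ) = -Complex.exp (-(Real.log x : ℂ)) := by
      rw [Complex.exp_neg, cexp_log_of_neg hx]
      push_cast
      rw [inv_neg, neg_neg]
    rw [logGauss_of_neg _ _ hx, hx1,
      show -(Real.log x : ℂ) ^ 2 / 2 + (c - 1) * (Real.log x : ℂ) =
        (-(Real.log x : ℂ) ^ 2 / 2 + c * (Real.log x : ℂ)) + -(Real.log x : ℂ) by ring,
      Complex.exp_add _ (-(Real.log x : ℂ))]
    simp only [Polynomial.eval_neg, Polynomial.eval_add, Polynomial.eval_mul, Polynomial.eval_sub,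
      Polynomial.eval_C, Polynomial.eval_X]
    ring
  · rw [logGauss_of_nonneg _ _ le_rfl]
    obtain ⟨K, hK⟩ := exists_norm_logGauss_le_sq P c
    rw [hasDerivAt_iff_isLittleO]
    simp only [logGauss_of_nonneg P c le_rfl, sub_zero, smul_zero]
    have h1 : logGauss P c =O[𝓝 0] fun x : ℝ => x ^ 2 :=
      Asymptotics.IsBigO.of_bound K (Eventually.of_forall fun x => by
        rw [norm_pow, Real.norm_eq_abs, sq_abs]; exact hK x)
    exact h1.trans_isLittleO (by simpa using Asymptotics.isLittleO_pow_pow (𝕜 := ℝ) one_lt_two)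
  · rw [logGauss_of_nonneg _ _ hx.le]
    refine (hasDerivAt_const x (0 : ℂ)).congr_of_eventuallyEq ?_
    filter_upwards [Ioi_mem_nhds hx] with y hy using logGauss_of_nonneg _ _ (le_of_lt hy)

theorem contDiff_logGauss (n : ℕ) (P : Polynomial ℂ) (c : ℂ) : ContDiff ℝ n (logGauss P c) := by
  induction n generalizing P c with
  | zero =>
    exact contDiff_zero.2 (continuous_iff_continuousAt.2 fun x =>
      (hasDerivAt_logGauss P c x).continuousAt)
  | succ n ih =>
    rw [Nat.cast_succ, contDiff_succ_iff_deriv]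
    refine ⟨fun x => (hasDerivAt_logGauss P c x).differentiableAt, by simp, ?_⟩
    rw [funext fun x => (hasDerivAt_logGauss P c x).deriv]
    exact ih _ _

theorem exists_iteratedDeriv_logGauss (n : ℕ) (P : Polynomial ℂ) (c : ℂ) :
    ∃ Q d, iteratedDeriv n (logGauss P c) = logGauss Q d := by
  induction n generalizing P c with
  | zero => exact ⟨P, c, iteratedDeriv_zero⟩
  | succ n ih =>
    rw [iteratedDeriv_succ', funext fun x => (hasDerivAt_logGauss P c x).deriv]
    exact ih _ _

/-- The Schwartz function `exp(-log² |x| / 2 + c log |x|)` on the negative half line. -/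
def logNormal (c : ℂ) : 𝓢(ℝ, ℂ) where
  toFun := logGauss 1 c
  smooth' := contDiff_infty.2 fun n => contDiff_logGauss n 1 c
  decay' := by
    intro k n
    obtain ⟨Q, d, h⟩ := exists_iteratedDeriv_logGauss n 1 c
    obtain ⟨K, hK⟩ := logGauss_bounded Q (d + k)
    refine ⟨K, fun x => ?_⟩
    rw [norm_iteratedFDeriv_eq_norm_iteratedDeriv, h]
    have h1 := hK x
    rwa [logGauss_add_nat, norm_mul, norm_pow, norm_neg, Complex.norm_real] at h1

theorem logNormal_of_neg (c : ℂ) {x : ℝ} (hx : x < 0) :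
    logNormal c x = Complex.exp (-(Real.log x : ℂ) ^ 2 / 2 + c * (Real.log x : ℂ)) := by
  refine (logGauss_of_neg 1 c hx).trans ?_
  rw [Polynomial.eval_one, one_mul]

theorem logNormal_of_nonneg (c : ℂ) {x : ℝ} (hx : 0 ≤ x) : logNormal c x = 0 :=
  logGauss_of_nonneg 1 c hx

theorem logNormal_neg_exp (c : ℂ) (s : ℝ) :
    logNormal c (-Real.exp s) = Complex.exp (-(s : ℂ) ^ 2 / 2 + c * (s : ℂ)) := by
  rw [logNormal_of_neg c (neg_neg_of_pos (Real.exp_pos s)), Real.log_neg_eq_log, Real.log_exp]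

theorem image_neg_exp : (fun s : ℝ => -Real.exp s) '' Set.univ = Set.Iio 0 := by
  ext x
  simp only [Set.image_univ, Set.mem_range, Set.mem_Iio]
  constructor
  · rintro ⟨s, rfl⟩; exact neg_neg_of_pos (Real.exp_pos s)
  · exact fun hx => ⟨Real.log (-x), by rw [Real.exp_log (neg_pos.2 hx), neg_neg]⟩

theorem hasDerivWithinAt_neg_exp (s : ℝ) :
    HasDerivWithinAt (fun s : ℝ => -Real.exp s) (-Real.exp s) Set.univ s :=
  (Real.hasDerivAt_exp s).neg.hasDerivWithinAt

theorem injOn_neg_exp : Set.InjOn (fun s : ℝ => -Real.exp s) Set.univ :=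
  fun _ _ _ _ h => Real.exp_injective (neg_injective h)

theorem integral_Iio_zero_eq {F : Type*} [NormedAddCommGroup F] [NormedSpace ℝ F] (g : ℝ → F) :
    ∫ x in Set.Iio (0 : ℝ), g x = ∫ s : ℝ, Real.exp s • g (-Real.exp s) := by
  have h := integral_image_eq_integral_abs_deriv_smul MeasurableSet.univ
    (fun s _ => hasDerivWithinAt_neg_exp s) injOn_neg_exp g
  rw [image_neg_exp, Measure.restrict_univ] at h
  simpa only [abs_neg, Real.abs_exp] using h

theorem integrableOn_Iio_zero_iff {F : Type*} [NormedAddCommGroup F] [NormedSpace ℝ F] (g : ℝ → F) :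
    IntegrableOn g (Set.Iio (0 : ℝ)) ↔ Integrable fun s : ℝ => Real.exp s • g (-Real.exp s) := by
  have h := integrableOn_image_iff_integrableOn_abs_deriv_smul MeasurableSet.univ
    (fun s _ => hasDerivWithinAt_neg_exp s) injOn_neg_exp g
  rw [image_neg_exp, integrableOn_univ] at h
  simpa only [abs_neg, Real.abs_exp] using h

/-- The substitution `x = -exp s` turns the moment into a Gaussian integral. -/
theorem integral_pow_mul_logNormal (c : ℂ) (n : ℕ) :
    ∫ x : ℝ, (x : ℂ) ^ n * logNormal c x =
      (-1) ^ n * ((Real.pi / (1 / 2 : ℂ)) ^ (1 / 2 : ℂ) * Complex.exp ((c + n + 1) ^ 2 / 2)) := by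
  have h1 : ∫ x : ℝ, (x : ℂ) ^ n * logNormal c x =
      ∫ x in Set.Iio (0 : ℝ), (x : ℂ) ^ n * logNormal c x := by
    rw [setIntegral_eq_integral_of_forall_compl_eq_zero]
    intro x hx
    rw [logNormal_of_nonneg c (not_lt.1 hx), mul_zero]
  have h2 : ∀ s : ℝ, Real.exp s • (((-Real.exp s : ℝ) : ℂ) ^ n * logNormal c (-Real.exp s)) =
      (-1) ^ n * Complex.exp (-(1 / 2 : ℂ) * (s : ℂ) ^ 2 + (c + n + 1) * (s : ℂ) + 0) := by
    intro s
    rw [logNormal_neg_exp, Complex.real_smul, Complex.ofReal_neg, Complex.ofReal_exp, neg_pow,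
      ← Complex.exp_nat_mul]
    rw [show -(1 / 2 : ℂ) * (s : ℂ) ^ 2 + (c + n + 1) * (s : ℂ) + 0 =
      (s : ℂ) + (n * (s : ℂ) + (-(s : ℂ) ^ 2 / 2 + c * (s : ℂ))) by ring,
      Complex.exp_add (s : ℂ) _, Complex.exp_add (n * (s : ℂ)) _]
    ring
  rw [h1, integral_Iio_zero_eq]
  simp only [h2]
  rw [integral_const_mul, integral_cexp_quadratic (by norm_num)]
  congr 2
  · rw [neg_neg]
  · congr 1; ring

/-- The combination of `logNormal c` and `logNormal (c + 2πi)` with vanishing moments. -/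
def logNormalDiff (c : ℂ) : nMinus :=
  ⟨⟨logNormal (c + 2 * Real.pi * Complex.I) -
      Complex.exp (2 * Real.pi * Complex.I * c - 2 * Real.pi ^ 2) • logNormal c, fun n => by
    simp only [sub_apply, smul_apply, smul_eq_mul, mul_sub, mul_left_comm _ (Complex.exp _)]
    rw [integral_sub (integrable_pow_mul n _) ((integrable_pow_mul n _).const_mul _),
      integral_const_mul, integral_pow_mul_logNormal, integral_pow_mul_logNormal]
    have h : Complex.exp ((c + 2 * Real.pi * Complex.I + n + 1) ^ 2 / 2) =
        Complex.exp (2 * Real.pi * Complex.I * c - 2 * Real.pi ^ 2) *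
          Complex.exp ((c + n + 1) ^ 2 / 2) := by
      rw [← Complex.exp_add]
      -- Replacing `c` by `c + 2πi` changes the exponent by a term independent of `n` and an integer
      -- multiple of `2πi`; this is why one combination annihilates all moments at once.
      have h2 : (c + 2 * Real.pi * Complex.I + n + 1) ^ 2 / 2 =
          (2 * Real.pi * Complex.I * c - 2 * Real.pi ^ 2 + (c + n + 1) ^ 2 / 2) +
            ((n + 1 : ℕ) : ℤ) * (2 * Real.pi * Complex.I) := by
        push_cast
        linear_combination (2 * (Real.pi : ℂ) ^ 2) * Complex.I_sq
      rw [h2, Complex.exp_add, Complex.exp_int_mul_two_pi_mul_I, mul_one]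
    rw [h]
    ring⟩, fun x hx => by
    by_contra h
    refine hx ?_
    simp only [sub_apply, smul_apply, logNormal_of_nonneg _ (not_lt.1 h), smul_zero, sub_zero]⟩

theorem logNormalDiff_apply (c : ℂ) (x : ℝ) : (logNormalDiff c).1.1 x =
    logNormal (c + 2 * Real.pi * Complex.I) x -
      Complex.exp (2 * Real.pi * Complex.I * c - 2 * Real.pi ^ 2) * logNormal c x := rfl

/-! ### Functions annihilated by all elements of `𝒩₋` -/

theorem hasDerivAt_logNormal (c : ℂ) {x : ℝ} (hx : x < 0) :
    HasDerivAt (fun c => logNormal c x) ((Real.log x : ℂ) * logNormal c x) c := by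
  simp only [logNormal_of_neg _ hx]
  have h := (((hasDerivAt_id c).mul_const (Real.log x : ℂ)).const_add
    (-(Real.log x : ℂ) ^ 2 / 2)).cexp
  refine h.congr_deriv ?_
  rw [id, one_mul, mul_comm]

theorem norm_logNormal_of_neg (c : ℂ) {x : ℝ} (hx : x < 0) :
    ‖logNormal c x‖ = Real.exp (-(Real.log x) ^ 2 / 2 + c.re * Real.log x) := by
  rw [logNormal_of_neg _ hx, norm_cexp_logGauss]

/-- Domination for differentiating under the integral in `c`: the factor `|L|` and the displacement
of `d` from `c` each cost at most `exp |L|`, and `exp(2|L|)` is one of `exp(±2L)`. -/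
theorem norm_log_mul_logNormal_le {c d : ℂ} (h : ‖d - c‖ ≤ 1) {x : ℝ} (hx : x < 0) :
    ‖(Real.log x : ℂ) * logNormal d x‖ ≤ ‖logNormal (c + 2) x‖ + ‖logNormal (c - 2) x‖ := by
  have h1 : |d.re - c.re| ≤ 1 := by
    rw [← Complex.sub_re]; exact (Complex.abs_re_le_norm _).trans h
  rw [norm_mul, Complex.norm_real, Real.norm_eq_abs, norm_logNormal_of_neg _ hx,
    norm_logNormal_of_neg _ hx, norm_logNormal_of_neg _ hx]
  set L := Real.log x
  have h2 : |L| ≤ Real.exp |L| := by linarith [Real.add_one_le_exp |L|]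
  have h3 : (d.re - c.re) * L ≤ |L| := (le_abs_self _).trans (by
    rw [abs_mul]; exact mul_le_of_le_one_left (abs_nonneg _) h1)
  have h4 : |L| * Real.exp (-L ^ 2 / 2 + d.re * L) ≤
      Real.exp (2 * |L| + (-L ^ 2 / 2 + c.re * L)) := by
    refine (mul_le_mul_of_nonneg_right h2 (Real.exp_pos _).le).trans ?_
    rw [← Real.exp_add]
    exact Real.exp_le_exp.2 (by linarith)
  refine h4.trans ?_
  rcases abs_cases L with ⟨h5, _⟩ | ⟨h5, _⟩
  · refine le_add_of_le_of_nonneg (Real.exp_le_exp.2 ?_) (Real.exp_pos _).le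
    simp only [Complex.add_re, Complex.re_ofNat, h5]; linarith
  · refine le_add_of_nonneg_of_le (Real.exp_pos _).le (Real.exp_le_exp.2 ?_)
    simp only [Complex.sub_re, Complex.re_ofNat, h5]; linarith

theorem differentiable_integral_mul_logNormal {θ : ℝ → ℂ}
    (hθ : ∀ c, IntegrableOn (fun x => θ x * logNormal c x) (Set.Iio 0)) :
    Differentiable ℂ fun c => ∫ x in Set.Iio (0 : ℝ), θ x * logNormal c x := by
  intro c
  refine (hasDerivAt_integral_of_dominated_loc_of_deriv_le (𝕜 := ℂ)
    (F' := fun d x => θ x * ((Real.log x : ℂ) * logNormal d x)) (s := Metric.ball c 1)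
    (bound := fun x => ‖θ x * logNormal (c + 2) x‖ + ‖θ x * logNormal (c - 2) x‖)
    (Metric.ball_mem_nhds c one_pos) (Eventually.of_forall fun d => (hθ d).aestronglyMeasurable)
    (hθ c) ?_ ?_ ((hθ _).norm.add (hθ _).norm) ?_).2.differentiableAt
  · have h : AEStronglyMeasurable (fun x : ℝ => (Real.log x : ℂ)) (volume.restrict (Set.Iio 0)) :=
      (Complex.measurable_ofReal.comp Real.measurable_log).aestronglyMeasurable
    refine (h.mul (hθ c).aestronglyMeasurable).congr (Eventually.of_forall fun x => ?_)
    exact mul_left_comm _ _ _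
  · filter_upwards [ae_restrict_mem measurableSet_Iio] with x hx d hd
    rw [norm_mul, norm_mul (θ x), norm_mul (θ x), ← mul_add]
    exact mul_le_mul_of_nonneg_left
      (norm_log_mul_logNormal_le (mem_ball_iff_norm.1 hd).le hx) (norm_nonneg _)
  · filter_upwards [ae_restrict_mem measurableSet_Iio] with x hx d _
    exact (hasDerivAt_logNormal d hx).const_mul _

/-- `|E|` has period `2πi`, so the bound on the strip `0 ≤ Im c < 2π` holds everywhere. By Liouville
`E` is constant, and antiperiodicity gives `E = -E`. -/
theorem eq_zero_of_antiperiodic_of_norm_le {E : ℂ → ℂ} (hd : Differentiable ℂ E)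
    (hp : Function.Antiperiodic E (2 * Real.pi * Complex.I)) {C : ℝ}
    (hb : ∀ c, ‖E c‖ ≤ C * Real.exp (c.im ^ 2 / 2)) (c : ℂ) : E c = 0 := by
  have hC : 0 ≤ C := nonneg_of_mul_nonneg_left ((norm_nonneg _).trans (hb 0)) (Real.exp_pos _)
  have hper : Function.Periodic (fun c => ‖E c‖) (2 * Real.pi * Complex.I) := fun c => by
    simp only [hp c, norm_neg]
  have hbdd : Bornology.IsBounded (Set.range E) := by
    refine (isBounded_iff_forall_norm_le).2 ⟨C * Real.exp ((2 * Real.pi) ^ 2 / 2), ?_⟩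
    rintro _ ⟨c, rfl⟩
    obtain ⟨n, hn, -⟩ := existsUnique_sub_zsmul_mem_Ico Real.two_pi_pos c.im 0
    have h1 := hper.sub_zsmul_eq (x := c) n
    have h2 : (c - n • (2 * Real.pi * Complex.I)).im = c.im - n • (2 * Real.pi) := by simp
    rw [← h1]
    refine (hb _).trans ?_
    rw [h2]
    have h3 := hn.1
    have h4 := hn.2
    rw [zero_add] at h4
    gcongr
  have h1 : E c = -E c := (hd.apply_eq_apply_of_bounded hbdd c _).trans (hp c)
  exact self_eq_neg.1 h1

/-- The factor `exp(-c²/2)` cancels the multiplier of the functional equation. The factor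
`exp(-c/2)` does two things: it cancels the linear term of the growth bound centred at `-1/2`, and
it contributes `exp(-πi) = -1`, hence antiperiodicity. -/
theorem integral_mul_logNormal_eq_zero {θ : ℝ → ℂ}
    (hθ : ∀ c, IntegrableOn (fun x => θ x * logNormal c x) (Set.Iio 0)) {C : ℝ}
    (hb : ∀ c : ℂ, ‖∫ x in Set.Iio (0 : ℝ), θ x * logNormal c x‖ ≤
      C * Real.exp ((c.re + 1 / 2) ^ 2 / 2))
    (h0 : ∀ u : nMinus, ∫ x in Set.Iio (0 : ℝ), θ x * u.1.1 x = 0) (c : ℂ) :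
    ∫ x in Set.Iio (0 : ℝ), θ x * logNormal c x = 0 := by
  set A : ℂ → ℂ := fun c => ∫ x in Set.Iio (0 : ℝ), θ x * logNormal c x with hA
  have hper : ∀ c, A (c + 2 * Real.pi * Complex.I) =
      Complex.exp (2 * Real.pi * Complex.I * c - 2 * Real.pi ^ 2) * A c := by
    intro c
    have h1 := h0 (logNormalDiff c)
    simp only [logNormalDiff_apply, mul_sub, mul_left_comm _ (Complex.exp _)] at h1
    rw [integral_sub (hθ _) ((hθ _).const_mul _), integral_const_mul, sub_eq_zero] at h1
    exact h1
  have h := eq_zero_of_antiperiodic_of_norm_le (C := C * Real.exp (1 / 8))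
    (E := fun c => A c * Complex.exp (-c ^ 2 / 2 - c / 2))
    ((differentiable_integral_mul_logNormal hθ).mul (by fun_prop)) ?_ ?_ c
  · exact (mul_eq_zero.1 h).resolve_right (Complex.exp_ne_zero _)
  · intro c
    change A _ * _ = -(A c * _)
    rw [hper, mul_right_comm, ← Complex.exp_add,
      show 2 * Real.pi * Complex.I * c - 2 * Real.pi ^ 2 +
        (-(c + 2 * Real.pi * Complex.I) ^ 2 / 2 - (c + 2 * Real.pi * Complex.I) / 2) =
        (-c ^ 2 / 2 - c / 2) + -(Real.pi * Complex.I) by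
          linear_combination (-2 * (Real.pi : ℂ) ^ 2) * Complex.I_sq,
      Complex.exp_add, Complex.exp_neg, Complex.exp_pi_mul_I]
    norm_num
    ring
  · intro c
    rw [norm_mul, Complex.norm_exp]
    refine (mul_le_mul_of_nonneg_right (hb c) (Real.exp_pos _).le).trans_eq ?_
    rw [mul_assoc, mul_assoc, ← Real.exp_add, ← Real.exp_add]
    congr 2
    have h1 : (-c ^ 2 / 2 - c / 2).re = -(c.re ^ 2 - c.im ^ 2) / 2 - c.re / 2 := by
      simp [pow_two]
    rw [h1]
    ring

/-- A smooth compactly supported test function is the Fourier transform of a Schwartz function `η`,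
and the transform can be moved from `η` to `F`. -/
theorem ae_eq_zero_of_fourier_eq_zero {F : ℝ → ℂ} (hF : Integrable F)
    (h : ∀ τ : ℝ, ∫ s : ℝ, F s * Complex.exp (τ * Complex.I * s) = 0) : ∀ᵐ s, F s = 0 := by
  have hzero : ∀ w : ℝ, VectorFourier.fourierIntegral Real.fourierChar volume
      (innerₗ ℝ).flip F w = 0 := by
    intro w
    rw [← h (-2 * Real.pi * w)]
    simp only [VectorFourier.fourierIntegral, Circle.smul_def, smul_eq_mul]
    congr 1
    ext s
    rw [Real.fourierChar_apply, mul_comm]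
    congr 2
    simp
    ring
  refine ae_eq_zero_of_integral_contDiff_smul_eq_zero hF.locallyIntegrable fun g hg hs => ?_
  have hs' : HasCompactSupport fun x => (g x : ℂ) := hs.comp_left Complex.ofReal_zero
  let G : 𝓢(ℝ, ℂ) := hs'.toSchwartzMap (Complex.ofRealCLM.contDiff.comp hg)
  obtain ⟨η, hη⟩ : ∃ η : 𝓢(ℝ, ℂ), FourierTransform.fourier η = G :=
    ⟨FourierTransformInv.fourierInv G, by simp⟩
  have h1 := VectorFourier.integral_fourierIntegral_smul_eq_flip (L := innerₗ ℝ)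
    (μ := volume) (ν := volume) Real.continuous_fourierChar continuous_inner η.integrable hF
  simp only [hzero, smul_zero, integral_zero] at h1
  rw [← h1]
  congr 1
  ext x
  have h2 : G x = VectorFourier.fourierIntegral Real.fourierChar volume (innerₗ ℝ) η x := by
    rw [← hη]; rfl
  rw [← h2]
  exact (Complex.real_smul).trans rfl

/-- A function on the negative half line that is orthogonal to `𝒩₋` vanishes almost everywhere,
provided that its integrals against the log-normal functions are suitably bounded. -/
theorem ae_eq_zero_of_integral_nMinus_eq_zero {θ : ℝ → ℂ}
    (hθ : ∀ c, IntegrableOn (fun x => θ x * logNormal c x) (Set.Iio 0)) {C : ℝ}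
    (hb : ∀ c : ℂ, ‖∫ x in Set.Iio (0 : ℝ), θ x * logNormal c x‖ ≤
      C * Real.exp ((c.re + 1 / 2) ^ 2 / 2))
    (h0 : ∀ u : nMinus, ∫ x in Set.Iio (0 : ℝ), θ x * u.1.1 x = 0) :
    ∀ᵐ x ∂volume.restrict (Set.Iio (0 : ℝ)), θ x = 0 := by
  have hA := integral_mul_logNormal_eq_zero hθ hb h0
  -- On the imaginary axis `c = iτ`, the substitution `x = -exp s` makes `A(c)` the Fourier integral
  -- of the integrand for `c = 0`.
  have hF := ae_eq_zero_of_fourier_eq_zero ((integrableOn_Iio_zero_iff _).1 (hθ 0)) fun τ => by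
    refine Eq.trans ?_ (hA (τ * Complex.I))
    rw [integral_Iio_zero_eq]
    congr 1
    ext s
    rw [logNormal_neg_exp, logNormal_neg_exp, zero_mul, add_zero, Complex.exp_add]
    simp only [Complex.real_smul]
    ring
  have h1 : ∫ x in Set.Iio (0 : ℝ), ‖θ x * logNormal 0 x‖ = 0 := by
    rw [integral_Iio_zero_eq]
    refine integral_eq_zero_of_ae (hF.mono fun s hs => ?_)
    have h2 := (smul_eq_zero.1 hs).resolve_left (Real.exp_pos s).ne'
    simp only [h2, norm_zero, smul_zero, Pi.zero_apply]
  rw [integral_eq_zero_iff_of_nonneg (fun _ => norm_nonneg _) (hθ 0).norm] at h1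
  filter_upwards [h1, ae_restrict_mem measurableSet_Iio] with x hx hx0
  refine (mul_eq_zero.1 (norm_eq_zero.1 hx)).resolve_right ?_
  rw [logNormal_of_neg _ hx0]
  exact Complex.exp_ne_zero _

/-! ### Density of `Ψ` in `L²(ℝ)` -/

theorem integral_norm_mul_norm_le {α : Type*} [MeasurableSpace α] {μ : Measure α} {f g : α → ℂ}
    (hf : MemLp f 2 μ) (hg : MemLp g 2 μ) :
    ∫ a, ‖f a‖ * ‖g a‖ ∂μ ≤ √(∫ a, ‖f a‖ ^ 2 ∂μ) * √(∫ a, ‖g a‖ ^ 2 ∂μ) := by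
  have h2 : ENNReal.ofReal 2 = 2 := by norm_num
  have h := integral_mul_norm_le_Lp_mul_Lq (p := 2) (q := 2) Real.HolderConjugate.two_two
    (h2.symm ▸ hf) (h2.symm ▸ hg)
  simpa only [Real.rpow_two, ← Real.sqrt_eq_rpow] using h

theorem integral_gaussian_sub (b a : ℝ) :
    ∫ s : ℝ, Real.exp (-b * (s - a) ^ 2) = √(Real.pi / b) := by
  rw [integral_sub_right_eq_self (fun s => Real.exp (-b * s ^ 2)) a, integral_gaussian]

theorem norm_logNormal_neg_exp (c : ℂ) (s : ℝ) :
    ‖logNormal c (-Real.exp s)‖ = Real.exp (-s ^ 2 / 2 + c.re * s) := by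
  rw [logNormal_neg_exp, norm_cexp_logGauss]

/-- The Jacobian `exp s` moves the centre of the Gaussian from `Re c` to `Re c + 1/2`; this is the
origin of the `1/2` in the growth condition. -/
theorem integral_norm_logNormal_sq (c : ℂ) :
    ∫ x in Set.Iio (0 : ℝ), ‖logNormal c x‖ ^ 2 =
      Real.exp ((c.re + 1 / 2) ^ 2 / 2) ^ 2 * √(Real.pi / 1) := by
  rw [integral_Iio_zero_eq, ← integral_gaussian_sub 1 (c.re + 1 / 2), ← integral_const_mul]
  congr 1
  ext s
  rw [norm_logNormal_neg_exp, smul_eq_mul, pow_two, pow_two (Real.exp _), ← Real.exp_add,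
    ← Real.exp_add, ← Real.exp_add, ← Real.exp_add]
  congr 1
  ring

/-- The weight `|x|^(-1/2)` scales like a function of `L²`, so the centre is again `Re c + 1/2` and
the same growth condition results. -/
theorem sqrt_mul_logNormal_eq (c : ℂ) (s : ℝ) :
    Real.exp s • ((√(-(-Real.exp s)))⁻¹ * ‖logNormal c (-Real.exp s)‖) =
      Real.exp ((c.re + 1 / 2) ^ 2 / 2) * Real.exp (-(1 / 2) * (s - (c.re + 1 / 2)) ^ 2) := by
  rw [norm_logNormal_neg_exp, smul_eq_mul, neg_neg, ← Real.exp_half, ← Real.exp_neg,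
    ← Real.exp_add, ← Real.exp_add, ← Real.exp_add]
  congr 1
  ring

theorem integral_sqrt_inv_mul_norm_logNormal (c : ℂ) :
    ∫ x in Set.Iio (0 : ℝ), (√(-x))⁻¹ * ‖logNormal c x‖ =
      Real.exp ((c.re + 1 / 2) ^ 2 / 2) * √(Real.pi / (1 / 2)) := by
  rw [integral_Iio_zero_eq, ← integral_gaussian_sub (1 / 2) (c.re + 1 / 2), ← integral_const_mul]
  simp only [sqrt_mul_logNormal_eq]

theorem integrableOn_sqrt_inv_mul_norm_logNormal (c : ℂ) :
    IntegrableOn (fun x => (√(-x))⁻¹ * ‖logNormal c x‖) (Set.Iio (0 : ℝ)) := by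
  rw [integrableOn_Iio_zero_iff]
  simp only [sqrt_mul_logNormal_eq]
  exact ((integrable_exp_neg_mul_sq one_half_pos).comp_sub_right _).const_mul _

theorem ae_eq_zero_of_memLp_of_integral_nMinus {θ : ℝ → ℂ} (hθ : MemLp θ 2)
    (h0 : ∀ u : nMinus, ∫ x in Set.Iio (0 : ℝ), θ x * u.1.1 x = 0) :
    ∀ᵐ x ∂volume.restrict (Set.Iio (0 : ℝ)), θ x = 0 := by
  have hV : ∀ c, MemLp (logNormal c) 2 (volume.restrict (Set.Iio (0 : ℝ))) := fun c =>
    ((logNormal c).memLp 2 volume).restrict _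
  refine ae_eq_zero_of_integral_nMinus_eq_zero
    (C := √(∫ x in Set.Iio (0 : ℝ), ‖θ x‖ ^ 2) * √(√(Real.pi / 1)))
    (fun c => (hθ.restrict _).integrable_mul (hV c)) (fun c => ?_) h0
  refine (norm_integral_le_integral_norm _).trans ?_
  simp only [norm_mul]
  refine (integral_norm_mul_norm_le (hθ.restrict _) (hV c)).trans_eq ?_
  rw [integral_norm_logNormal_sq, Real.sqrt_mul (sq_nonneg _), Real.sqrt_sq (Real.exp_pos _).le]
  ring

/-! ### Stieltjes transforms of square integrable functions. -/

theorem hasDerivAt_neg_inv_add {a : ℝ} (ha : 0 < a) {t : ℝ} (ht : 0 ≤ t) :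
    HasDerivAt (fun t => -(a + t)⁻¹) (((a + t)⁻¹) ^ 2) t := by
  have h := (((hasDerivAt_id t).const_add a).inv (add_pos_of_pos_of_nonneg ha ht).ne').neg
  refine h.congr_deriv ?_
  simp only [id, inv_pow]
  ring

theorem tendsto_neg_inv_add (a : ℝ) : Tendsto (fun t : ℝ => -(a + t)⁻¹) atTop (𝓝 0) := by
  simpa using (tendsto_inv_atTop_zero.comp (tendsto_atTop_add_const_left atTop a tendsto_id)).neg

theorem integrableOn_inv_add_sq {a : ℝ} (ha : 0 < a) :
    IntegrableOn (fun t => ((a + t)⁻¹) ^ 2) (Set.Ioi 0) :=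
  integrableOn_Ioi_deriv_of_nonneg' (fun _ ht => hasDerivAt_neg_inv_add ha ht)
    (fun _ _ => sq_nonneg _) (tendsto_neg_inv_add a)

theorem integral_inv_add_sq {a : ℝ} (ha : 0 < a) :
    ∫ t in Set.Ioi 0, ((a + t)⁻¹) ^ 2 = a⁻¹ := by
  rw [integral_Ioi_of_hasDerivAt_of_tendsto' (fun _ ht => hasDerivAt_neg_inv_add ha ht)
    (integrableOn_inv_add_sq ha) (tendsto_neg_inv_add a)]
  simp

theorem norm_inv_add_sq (a t : ℝ) : ‖(((a + t)⁻¹ : ℝ) : ℂ)‖ ^ 2 = ((a + t)⁻¹) ^ 2 := by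
  rw [Complex.norm_real, Real.norm_eq_abs, sq_abs]

theorem memLp_inv_add {a : ℝ} (ha : 0 < a) :
    MemLp (fun t : ℝ => (((a + t)⁻¹ : ℝ) : ℂ)) 2 (volume.restrict (Set.Ioi 0)) := by
  rw [memLp_two_iff_integrable_sq_norm (Measurable.aestronglyMeasurable (by fun_prop))]
  simp only [norm_inv_add_sq]
  exact integrableOn_inv_add_sq ha

theorem integrableOn_inv_add_smul {θ : ℝ → ℂ} (hθ : MemLp θ 2 (volume.restrict (Set.Ioi 0)))
    {a : ℝ} (ha : 0 < a) : IntegrableOn (fun t => (a + t)⁻¹ • θ t) (Set.Ioi 0) := by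
  simpa only [Complex.real_smul] using! (memLp_inv_add ha).integrable_mul hθ

/-- Cauchy–Schwarz, the kernel having `L²` norm `a^(-1/2)`. This bound is all that the annihilation
criterion needs; square integrability of the transform is not required. -/
theorem norm_stieltjes_le {θ : ℝ → ℂ} (hθ : MemLp θ 2 (volume.restrict (Set.Ioi 0)))
    {a : ℝ} (ha : 0 < a) : ‖∫ t in Set.Ioi 0, (a + t)⁻¹ • θ t‖ ≤
      √(∫ t in Set.Ioi 0, ‖θ t‖ ^ 2) * (√a)⁻¹ := by
  refine (norm_integral_le_integral_norm _).trans ?_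
  simp only [Complex.real_smul, norm_mul]
  refine (integral_norm_mul_norm_le (memLp_inv_add ha) hθ).trans_eq ?_
  simp only [norm_inv_add_sq]
  rw [integral_inv_add_sq ha, Real.sqrt_inv, mul_comm]

theorem continuousOn_stieltjes {θ : ℝ → ℂ} (hθ : MemLp θ 2 (volume.restrict (Set.Ioi 0))) :
    ContinuousOn (fun a => ∫ t in Set.Ioi 0, (a + t)⁻¹ • θ t) (Set.Ioi 0) := fun a ha => by
  have h := hasDerivAt_stieltjes hθ.aestronglyMeasurable (integrableOn_inv_add_smul hθ one_pos) 0 ha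
  simpa using h.continuousAt.continuousWithinAt

/-- `u(-y)/y` is minus the symmetrized kernel at `t = 0`, because `u(y) = 0`; so the singularity at
`0` is harmless. -/
theorem integrableOn_inv_smul_neg (u : nMinus) :
    IntegrableOn (fun y : ℝ => ((1 + y) / y) • u.1.1 (-y)) (Set.Ioi 0) := by
  have h1 : IntegrableOn (fun y : ℝ => u.1.1 (-y)) (Set.Ioi 0) :=
    ((u.1.1.integrable (μ := volume)).comp_neg).integrableOn
  refine (h1.sub (symKernel_integrable u.1.1 0)).congr_fun (fun y hy => ?_) measurableSet_Ioi
  have hy' : (y : ℂ) ≠ 0 := by exact_mod_cast (ne_of_gt hy)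
  simp only [Pi.sub_apply, symKernel, zero_add, zero_sub, Complex.real_smul,
    nMinus_apply_eq_zero u (le_of_lt hy)]
  push_cast
  field_simp
  ring

/-- The Stieltjes kernel is symmetric, so Fubini moves it from `u` to `θ`. -/
theorem integral_mul_hilbertTransform_eq {θ : ℝ → ℂ}
    (hθ : MemLp θ 2 (volume.restrict (Set.Ioi 0))) (u : nMinus) :
    ∫ t in Set.Ioi 0, θ t * hilbertTransform u.1 t =
      -(1 / Real.pi) * ∫ x in Set.Iio (0 : ℝ), (∫ t in Set.Ioi 0, (-x + t)⁻¹ • θ t) * u.1.1 x := by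
  have h1 : ∫ x in Set.Iio (0 : ℝ), (∫ t in Set.Ioi 0, (-x + t)⁻¹ • θ t) * u.1.1 x =
      ∫ y in Set.Ioi 0, ∫ t in Set.Ioi 0, ((y + t)⁻¹ • θ t) * u.1.1 (-y) := by
    have h := integral_comp_neg_Ioi 0
      (fun x => (∫ t in Set.Ioi 0, (-x + t)⁻¹ • θ t) * u.1.1 x)
    rw [neg_zero, integral_Iic_eq_integral_Iio] at h
    rw [← h]
    simp only [neg_neg, integral_mul_const]
  have h2 : Integrable (Function.uncurry fun y t : ℝ => ((y + t)⁻¹ • θ t) * u.1.1 (-y))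
      ((volume.restrict (Set.Ioi 0)).prod (volume.restrict (Set.Ioi 0))) := by
    refine ((integrableOn_inv_smul_neg u).mul_prod
      (integrableOn_inv_add_smul hθ one_pos)).mono ?_ ?_
    · have a1 : AEStronglyMeasurable (fun p : ℝ × ℝ => θ p.2)
          ((volume.restrict (Set.Ioi 0)).prod (volume.restrict (Set.Ioi 0))) :=
        hθ.aestronglyMeasurable.comp_snd
      have a2 : AEStronglyMeasurable (fun p : ℝ × ℝ => (p.1 + p.2)⁻¹)
          ((volume.restrict (Set.Ioi 0)).prod (volume.restrict (Set.Ioi 0))) :=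
        Measurable.aestronglyMeasurable (by fun_prop)
      have a3 : AEStronglyMeasurable (fun p : ℝ × ℝ => u.1.1 (-p.1))
          ((volume.restrict (Set.Ioi 0)).prod (volume.restrict (Set.Ioi 0))) :=
        (u.1.1.continuous.comp (continuous_neg.comp continuous_fst)).aestronglyMeasurable
      exact (a2.smul a1).mul a3
    · rw [Measure.prod_restrict]
      filter_upwards [ae_restrict_mem (measurableSet_Ioi.prod measurableSet_Ioi)] with p hp
      have hy : 0 < p.1 := hp.1
      have ht : 0 < p.2 := hp.2
      -- This separates the variables: the two factors are integrable against `u(-y)` and `θ(t)`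
      -- respectively.
      have h3 : (p.1 + p.2)⁻¹ ≤ (1 + p.1) / p.1 * (1 + p.2)⁻¹ := by
        rw [div_mul_eq_mul_div, ← div_eq_mul_inv, div_div, inv_eq_one_div,
          div_le_div_iff₀ (by positivity) (by positivity)]
        nlinarith [mul_pos hy hy]
      have h4 : 0 ≤ ‖θ p.2‖ * ‖u.1.1 (-p.1)‖ := by positivity
      simp only [Function.uncurry, norm_mul, norm_smul,
        Real.norm_eq_abs]
      rw [abs_of_pos (by positivity : 0 < (p.1 + p.2)⁻¹), abs_of_pos (by positivity :
        0 < (1 + p.1) / p.1), abs_of_pos (by positivity : 0 < (1 + p.2)⁻¹)]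
      calc _ = (p.1 + p.2)⁻¹ * (‖θ p.2‖ * ‖u.1.1 (-p.1)‖) := by ring
        _ ≤ (1 + p.1) / p.1 * (1 + p.2)⁻¹ * (‖θ p.2‖ * ‖u.1.1 (-p.1)‖) :=
            mul_le_mul_of_nonneg_right h3 h4
        _ = _ := by ring
  rw [h1, integral_integral_swap h2, ← integral_const_mul]
  refine setIntegral_congr_fun measurableSet_Ioi fun t ht => ?_
  change _ = -(1 / (Real.pi : ℂ)) * _
  rw [hilbertTransform_apply,
    symHilbert_of_pos (fun x hx => nMinus_apply_eq_zero u hx) ht, mul_left_comm,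
    ← integral_const_mul]
  congr 2
  ext y
  rw [add_comm t y, Complex.real_smul, Complex.real_smul]
  ring

/-- The Stieltjes transform of `θ`, reflected to the negative half line, annihilates `𝒩₋` and is
`O(|x|^(-1/2))`, so it vanishes; injectivity of the transform finishes. -/
theorem ae_eq_zero_of_memLp_of_integral_hilbertTransform {θ : ℝ → ℂ}
    (hθ : MemLp θ 2 (volume.restrict (Set.Ioi 0)))
    (h0 : ∀ u : nMinus, ∫ t in Set.Ioi 0, θ t * hilbertTransform u.1 t = 0) :
    ∀ᵐ t ∂volume.restrict (Set.Ioi (0 : ℝ)), θ t = 0 := by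
  set G : ℝ → ℂ := fun x => ∫ t in Set.Ioi 0, (-x + t)⁻¹ • θ t with hG
  set K := √(∫ t in Set.Ioi 0, ‖θ t‖ ^ 2)
  have hcont : ContinuousOn G (Set.Iio 0) :=
    (continuousOn_stieltjes hθ).comp continuousOn_neg
      fun x (hx : x < 0) => neg_pos.2 hx
  have hle : ∀ c : ℂ, ∀ᵐ x ∂volume.restrict (Set.Iio (0 : ℝ)),
      ‖G x * logNormal c x‖ ≤ K * ((√(-x))⁻¹ * ‖logNormal c x‖) := by
    intro c
    filter_upwards [ae_restrict_mem measurableSet_Iio] with x hx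
    rw [norm_mul, ← mul_assoc]
    exact mul_le_mul_of_nonneg_right (norm_stieltjes_le hθ (neg_pos.2 hx)) (norm_nonneg _)
  have hae : ∀ᵐ x ∂volume.restrict (Set.Iio (0 : ℝ)), G x = 0 := by
    refine ae_eq_zero_of_integral_nMinus_eq_zero (C := K * √(Real.pi / (1 / 2)))
      (fun c => ?_) (fun c => ?_) fun u => ?_
    · exact ((integrableOn_sqrt_inv_mul_norm_logNormal c).const_mul K).mono'
        ((hcont.aestronglyMeasurable measurableSet_Iio).mul
          (logNormal c).continuous.aestronglyMeasurable) (hle c)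
    · refine (norm_integral_le_of_norm_le
        ((integrableOn_sqrt_inv_mul_norm_logNormal c).const_mul K) (hle c)).trans_eq ?_
      rw [integral_const_mul, integral_sqrt_inv_mul_norm_logNormal]
      ring
    · have h1 := integral_mul_hilbertTransform_eq hθ u
      rw [h0 u] at h1
      refine (mul_eq_zero.1 h1.symm).resolve_left ?_
      simp [Real.pi_ne_zero]
  have hzero : Set.EqOn G 0 (Set.Iio 0) :=
    Measure.eqOn_open_of_ae_eq hae isOpen_Iio hcont continuousOn_const
  refine ae_eq_zero_of_stieltjes_eq_zero hθ.aestronglyMeasurable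
    (integrableOn_inv_add_smul hθ one_pos) fun a ha => ?_
  simpa [hG] using hzero (neg_neg_of_pos ha)

theorem denseRange_toL2 : DenseRange Psi.toL2 := by
  have hK : (LinearMap.range Psi.toL2)ᗮ = ⊥ := by
    rw [Submodule.eq_bot_iff]
    intro φ hφ
    set θ : ℝ → ℂ := fun x => starRingEnd ℂ (φ x) with hθ
    have hL : MemLp θ 2 := (Lp.memLp φ).star
    have h0 : ∀ f : Psi, ∫ x, θ x * Psi.toSchwartz f x = 0 := by
      intro f
      have h1 := hφ _ (LinearMap.mem_range_self Psi.toL2 f)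
      rw [L2.inner_def] at h1
      have h2 := congrArg (starRingEnd ℂ) h1
      rw [← integral_conj, map_zero] at h2
      rw [← h2]
      refine integral_congr_ae ?_
      filter_upwards [(Psi.toSchwartz f).coeFn_toLp 2 volume] with x hx
      change _ = starRingEnd ℂ (inner ℂ ((Psi.toSchwartz f).toLp 2 volume x) (φ x))
      rw [hx, RCLike.inner_apply, map_mul, Complex.conj_conj]
    have h1 : ∀ u : nMinus, ∫ x, θ x * u.1.1 x = 0 := by
      intro u
      -- The pair `(-u, u)` produces `iu`; below, `(u, u)` produces `ℍu`.
      have h := h0 (Psi.ofPair (-u, u))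
      have h2 : ∀ x, θ x * Psi.toSchwartz (Psi.ofPair (-u, u)) x =
          Complex.I * (θ x * u.1.1 x) := fun x => by
        rw [toSchwartz_ofPair_apply, neg_add_cancel, sub_neg_eq_add]
        simp
        ring
      simp only [h2, integral_const_mul] at h
      exact (mul_eq_zero.1 h).resolve_left Complex.I_ne_zero
    have h2 : ∀ u : nMinus, ∫ x, θ x * hilbertTransform u.1 x = 0 := by
      intro u
      rw [← h0 (Psi.ofPair (u, u))]
      congr 1
      ext x
      rw [toSchwartz_ofPair_apply, sub_self, Submodule.coe_add, map_add, add_apply]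
      simp only [ZeroMemClass.coe_zero, zero_apply, mul_zero, zero_add]
      ring
    have hneg := ae_eq_zero_of_memLp_of_integral_nMinus hL fun u => by
      rw [← h1 u, setIntegral_eq_integral_of_forall_compl_eq_zero]
      intro x hx
      rw [nMinus_apply_eq_zero u (not_lt.1 hx), mul_zero]
    have hIic : ∀ᵐ x, x ∈ Set.Iic (0 : ℝ) → θ x = 0 := by
      rw [← ae_restrict_iff' measurableSet_Iic, ← Measure.restrict_congr_set Iio_ae_eq_Iic]
      exact hneg
    -- As `θ` already vanishes on the negative half line, the relation with `ℍu` involves only the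
    -- positive one.
    have hpos := ae_eq_zero_of_memLp_of_integral_hilbertTransform (hL.restrict _) fun u => by
      rw [← h2 u, setIntegral_eq_integral_of_ae_compl_eq_zero]
      filter_upwards [hIic] with x hx hx0
      rw [hx (Set.mem_Iic.2 (not_lt.1 hx0)), zero_mul]
    rw [ae_restrict_iff' measurableSet_Ioi] at hpos
    rw [Lp.eq_zero_iff_ae_eq_zero]
    filter_upwards [hIic, hpos] with x hx hx'
    have : θ x = 0 := (le_or_gt x 0).elim hx hx'
    exact (map_eq_zero (starRingEnd ℂ)).1 this
  rw [← Submodule.topologicalClosure_eq_top_iff] at hK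
  have := Submodule.dense_iff_topologicalClosure_eq_top.2 hK
  rwa [LinearMap.coe_range] at this

/-! ### The rigged Hilbert space and the main theorem. -/

theorem isRiggedHilbertSpace_psi : IsRiggedHilbertSpace Psi.toL2 where
  hilbert := inferInstance
  injective := toL2_injective
  dense := denseRange_toL2
  uniformAddGroup := inferInstance
  continuousSMul := inferInstance
  locallyConvex := isFrechetSpace_psi.locallyConvex
  complete := inferInstance
  nuclear := isNuclearSpace_psi
  continuous := continuous_toL2
  -- `Ψ` is barrelled, since it is complete with a countably generated uniformity and therefore a
  -- Baire space.
  antidual_seqComplete _ hu := antiDual_seqComplete hu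
  antidual_quasiComplete _ hs hb := antiDual_quasiComplete hs hb
  antidual_contains := ⟨toAntiDual continuous_toL2, toAntiDual_apply continuous_toL2,
    toAntiDual_injective continuous_toL2 denseRange_toL2,
    toAntiDual_denseRange continuous_toL2 toL2_injective⟩

theorem eq_ofPair_of_toSchwartz_eq {f : Psi} {g h : nMinus} (hf : Psi.toSchwartz f =
    (-Complex.I) • projPlus g.1 + Complex.I • projMinus h.1) : f = Psi.ofPair (g, h) :=
  Subtype.ext (hf.trans (Psi.toSchwartz_ofPair g h).symm)

end
end HardyRigged

theorem proposition3 :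
    (∀ f : HardyRigged.Psi, ∃! gh : HardyRigged.nMinus × HardyRigged.nMinus,
      HardyRigged.Psi.toSchwartz f =
        (-Complex.I) • HardyRigged.projPlus gh.1.1 + Complex.I • HardyRigged.projMinus gh.2.1) ∧
    (∀ (n : ℕ) (f : HardyRigged.Psi) (g h : HardyRigged.nMinus),
      HardyRigged.Psi.toSchwartz f =
        (-Complex.I) • HardyRigged.projPlus g.1 + Complex.I • HardyRigged.projMinus h.1 →
      HardyRigged.psiNorm n f ^ 2 =
        HardyRigged.schwartzNorm n ((-Complex.I) • HardyRigged.projPlus g.1) ^ 2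
          + HardyRigged.schwartzNorm n (Complex.I • HardyRigged.projMinus h.1) ^ 2
          + HardyRigged.schwartzNorm n (Complex.I • HardyRigged.projMinus g.1) ^ 2
          + HardyRigged.schwartzNorm n ((-Complex.I) • HardyRigged.projPlus h.1) ^ 2) ∧
    HardyRigged.IsFrechetSpace HardyRigged.Psi ∧
    HardyRigged.IsNuclearSpace HardyRigged.Psi ∧
    HardyRigged.IsRiggedHilbertSpace HardyRigged.Psi.toL2 := by
  refine ⟨fun f => ?_, fun n f g h hf => ?_, HardyRigged.isFrechetSpace_psi,
    HardyRigged.isNuclearSpace_psi, HardyRigged.isRiggedHilbertSpace_psi⟩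
  · obtain ⟨gh, rfl⟩ := HardyRigged.Psi.ofPair_surjective f
    refine ⟨gh, HardyRigged.Psi.toSchwartz_ofPair gh.1 gh.2, fun gh' h => ?_⟩
    exact HardyRigged.ofPair_injective (HardyRigged.eq_ofPair_of_toSchwartz_eq h).symm
  · rw [HardyRigged.eq_ofPair_of_toSchwartz_eq hf, HardyRigged.psiNorm_ofPair,
      HardyRigged.pairNorm_sq]
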